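/- **Setting.** There are $K\ge 1$ arms $[K]=\{1,\dots,K\}$ and $T\ge 2$ rounds. An oblivious adversary fixes, for every round $t$, a law of the reward vector $(Y_t(a))_{a\in[K]}\in[0,1]^K$; reward vectors of different rounds are independent (and independent of the internal randomness of the player). Let $\mu_t(a)=\mathbb E[Y_t(a)]$. In round $t$ a randomized policy $\pi$ plays an arm $\pi_t$ and observes $Y_t(\pi_t)$ only. Its dynamic regret is $$R(\pi,T)=\sum_{t=1}^T\max_{a\in[K]}\mu_t(a)-\mathbb E\Big[\sum_{t=1}^T\mu_t(\pi_t)\Big],$$ and the total variation is $V=\sum_{t=2}^T\max_{a\in[K]}|\mu_t(a)-\mu_{t-1}(a)|$. **The META procedure** (input: horizon $T$; parameter $C_0>0$). Let $\mathcal A_t$ be the candidate arm set at round $t$, let $\hat\delta_t(a',a)=|\mathcal A_t|\,\big(Y_t(a')\mathbf 1\{\pi_t=a'\}-Y_t(a)\mathbf 1\{\pi_t=a\}\big)$, and say that arm $a$ is *bad on* an interval $I$ of rounds if there are rounds $s_1<s_2$ with $[s_1,s_2]\subseteq I$ and $$\max_{a'\in[K]}\sum_{s=s_1}^{s_2}\hat\delta_s(a',a)>\log(T)\sqrt{C_0\,\big(K(s_2-s_1)\vee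 K^2\big)} .$$ *Episodes.* Start with $t=1$. To start an episode at the current round $t$, set $t_\ell=t$ and $\mathcal A_{\rm master}=[K]$, sample independent $B_{s,m}\sim\mathrm{Bernoulli}\big(1/\sqrt{m(s-t_\ell)}\big)$ for all $s=t_\ell+1,\dots,T$ and $m\in\{2,4,\dots,2^{\lceil\log_2T\rceil}\}$, and run $\textsf{Base-Alg}(t_\ell,T+1-t_\ell)$. Whenever this run returns with $t\le T$, start a new episode. *$\textsf{Base-Alg}(t_{\rm start},m_0)$.* Set $\mathcal A_t=[K]$ at $t=t_{\rm start}$. While $t\le T$, repeat: (1) play an arm drawn uniformly at random from $\mathcal A_t$; (2) save $\mathcal A_{\rm current}=\mathcal A_t$ and increase $t$ by one; (3) if $B_{t,m}=1$ for some $m$, run $\textsf{Base-Alg}(t,m)$ with the largest such $m$ (this child run advances the global round count $t$); (4) if $t>t_{\rm start}+m_0$, return; (5) remove from $\mathcal A_{\rm master}$ all arms that are bad on $[t_\ell,t)$, and let $\mathcal A_t$ be $\mathcal A_{\rm current}$ without the arms that are bad on $[t_{\rm start},t)$; (6) if $\mathcal A_{\rm master}=\emptyset$, return. Here $t$, $t_\ell$,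 $\mathcal A_t$, $\mathcal A_{\rm master}$ and $(B_{s,m})$ are global variables, while $t_{\rm start}$, $m_0$ and $\mathcal A_{\rm current}$ are local to each call. **Corollary 2 (Bounding by Total Variation).** There is a universal constant $c_0>0$ such that for every $C_0\ge c_0$ there is a constant $C>0$, depending only on $C_0$, with the following property. For all $K\ge1$, all $T\ge2$ and all sequences of reward laws as above, the META procedure $\pi$ with horizon $T$ and parameter $C_0$ satisfies $$R(\pi,T)\le C\log^3(T)\left(\sqrt{KT}+(KV)^{1/3}T^{2/3}\right).$$ -/

import Mathlib

open MeasureTheory ProbabilityTheory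

noncomputable section

namespace SwitchingBandit

/-! ### Environment, dynamic regret, total variation

Arms are `Fin K`, rounds are `1, 2, …, T`.  The environment is the sequence `ν` of the laws of the
reward vectors `(Y_t(a))_a`; reward vectors of distinct rounds are independent. -/

/-- `ν t` is the law of the reward vector of round `t`: a probability measure carried by
`[0,1]^K`. -/
structure IsRewardLaw {K : ℕ} (ν : ℕ → Measure (Fin K → ℝ)) : Prop where
  isProbabilityMeasure : ∀ t, IsProbabilityMeasure (ν t)
  bounded : ∀ t, ∀ᵐ y ∂(ν t), ∀ a, y a ∈ Set.Icc (0 : ℝ) 1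

/-- The mean reward `μ_t(a)`. -/
def meanReward {K : ℕ} (ν : ℕ → Measure (Fin K → ℝ)) (t : ℕ) (a : Fin K) : ℝ :=
  ∫ y, y a ∂(ν t)

/-- The dynamic regret of a random sequence of arms `π` over the rounds `1, …, T`, for mean
rewards `μ`. The suprema are maxima over the finitely many arms. -/
def dynamicRegret {K : ℕ} (μ : ℕ → Fin K → ℝ) {Ω : Type*} [MeasurableSpace Ω] (P : Measure Ω)
    (π : ℕ → Ω → Fin K) (T : ℕ) : ℝ :=
  ∑ t ∈ Finset.Icc 1 T, (⨆ a : Fin K, μ t a)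
    - ∫ ω, ∑ t ∈ Finset.Icc 1 T, μ t (π t ω) ∂P

/-- The total variation `V` of the mean rewards up to round `T`. -/
def totalVariation {K : ℕ} (μ : ℕ → Fin K → ℝ) (T : ℕ) : ℝ :=
  ∑ t ∈ Finset.Icc 2 T, ⨆ a : Fin K, |μ t a - μ (t - 1) a|

/-! ### The randomness: rewards, arm choices, replay schedules -/

/-- The law of an arm drawn from the candidate set `A`: uniform on `A`.  (Candidate sets are never
empty when an arm is played; the convention for `A = ∅` only makes the law total.) -/
def armLaw {K : ℕ} (A : Finset (Fin K)) : Measure (Fin K) :=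
  uniformOn (if A.Nonempty then (A : Set (Fin K)) else Set.univ)

instance {K : ℕ} [NeZero K] (A : Finset (Fin K)) : IsProbabilityMeasure (armLaw A) := by
  unfold armLaw
  split_ifs with h
  · exact isProbabilityMeasure_uniformOn A.finite_toSet (Finset.coe_nonempty.mpr h)
  · exact isProbabilityMeasure_uniformOn Set.finite_univ Set.univ_nonempty

/-- The success probability `1 / √(m (s - t_ℓ))` of `B_{s,m}` in the episode that starts at round
`t_ℓ` (used for `s > t_ℓ` only). -/
def replayProb (tl s m : ℕ) : unitInterval :=
  ⟨1 / √((m : ℝ) * ((s - tl : ℕ) : ℝ)), by positivity, by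
    rcases Nat.eq_zero_or_pos (m * (s - tl)) with h | h
    · rw [← Nat.cast_mul, h]; simp
    · rw [← Nat.cast_mul]
      have h1 : (1 : ℝ) ≤ ((m * (s - tl) : ℕ) : ℝ) := by exact_mod_cast h
      have h2 : (1 : ℝ) ≤ √((m * (s - tl) : ℕ) : ℝ) := Real.one_le_sqrt.mpr h1
      rw [div_le_one (by linarith)]
      exact h2⟩

/-- An outcome of all the randomness: the reward vector of each round; for each round `t` and each
candidate set `A` the arm that is played if the candidate set at round `t` is `A`; and, for each
episode start `t_ℓ`, the replay schedule `B_{s,m}`, stored at the index `(t_ℓ, s, m)`. -/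
abbrev Outcome (K : ℕ) : Type :=
  (ℕ → Fin K → ℝ) × (ℕ × Finset (Fin K) → Fin K) × (ℕ × ℕ × ℕ → Bool)

/-- The law of the randomness: all reward vectors, arm draws and Bernoulli variables are
independent. -/
def outcomeLaw {K : ℕ} [NeZero K] (ν : ℕ → Measure (Fin K → ℝ)) (hν : IsRewardLaw ν) :
    Measure (Outcome K) :=
  haveI := hν.isProbabilityMeasure
  (Measure.infinitePi ν).prod
    ((Measure.infinitePi fun i : ℕ × Finset (Fin K) => armLaw i.2).prod
      (Measure.infinitePi fun i : ℕ × ℕ × ℕ =>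
        bernoulliMeasure true false (replayProb i.1 i.2.1 i.2.2)))

/-! ### The META procedure

A run is described round by round.  Recursive calls of the base algorithm are kept on an explicit
call stack: its top is the active instance, below it are its interrupted ancestors, and the
bottom is the instance that was started with the episode. -/

/-- An instance `Base-Alg(t_start, m₀)` of the base algorithm with its own candidate arm set: the
set `𝒜_t` if the instance is active, the saved set `𝒜_current` if it is interrupted. -/
structure BaseAlg (K : ℕ) where
  start : ℕ
  duration : ℕ
  arms : Finset (Fin K)

/-- The state of META between two rounds.  `played s` and `width s` record the arm played at
round `s` and the size `|𝒜_s|` of the candidate set it was drawn from. -/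
structure State (K : ℕ) where
  /-- first round `t_ℓ` of the current episode -/
  episode : ℕ
  /-- the set `𝒜_master` -/
  master : Finset (Fin K)
  /-- the active instance -/
  active : BaseAlg K
  /-- the interrupted instances, from the parent of the active one down to the root -/
  parents : List (BaseAlg K)
  played : ℕ → Fin K
  width : ℕ → ℕ

/-- The importance-weighted estimate of the relative gap `δ_s(a', a)`; it uses only the reward of
the arm that was played at round `s`. -/
def gapEstimate {K : ℕ} (y : ℕ → Fin K → ℝ) (played : ℕ → Fin K) (width : ℕ → ℕ) (s : ℕ)
    (a' a : Fin K) : ℝ :=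
  (width s : ℝ) *
    (y s a' * (if played s = a' then 1 else 0) - y s a * (if played s = a then 1 else 0))

/-- The eviction criterion for arm `a` on an interval `[s₁, s₂] ⊆ [lo, t)` with `s₁ < s₂`: the
maximum over `a'` of the aggregate gap estimates exceeds the threshold
`log T · √(C₀ (K (s₂ - s₁) ∨ K²))`. -/
def MeetsEviction {K : ℕ} (C₀ : ℝ) (T : ℕ) (y : ℕ → Fin K → ℝ) (played : ℕ → Fin K)
    (width : ℕ → ℕ) (lo t : ℕ) (a : Fin K) : Prop :=
  ∃ s₁ s₂ : ℕ, lo ≤ s₁ ∧ s₁ < s₂ ∧ s₂ < t ∧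
    ∃ a' : Fin K,
      Real.log T * √(C₀ * max ((K : ℝ) * ((s₂ : ℝ) - (s₁ : ℝ))) ((K : ℝ) ^ 2))
        < ∑ s ∈ Finset.Icc s₁ s₂, gapEstimate y played width s a' a

open scoped Classical in
/-- The arms that meet the eviction criterion on some interval inside `[lo, t)`. -/
def badArms {K : ℕ} (C₀ : ℝ) (T : ℕ) (y : ℕ → Fin K → ℝ) (played : ℕ → Fin K) (width : ℕ → ℕ)
    (lo t : ℕ) : Finset (Fin K) :=
  Finset.univ.filter fun a : Fin K => MeetsEviction C₀ T y played width lo t a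

/-- The possible replay lengths `2, 4, …, 2 ^ ⌈log₂ T⌉`. -/
def replayLengths (T : ℕ) : Finset ℕ :=
  (Finset.Icc 1 (Nat.clog 2 T)).image fun n => 2 ^ n

/-- The lengths of the replays that the schedule `B` of the episode started at `tl` has for
round `t`. -/
def scheduled (T : ℕ) (B : ℕ × ℕ × ℕ → Bool) (tl t : ℕ) : Finset ℕ :=
  (replayLengths T).filter fun m => B (tl, t, m) = true

/-- Every instance that runs out of its scheduled duration at round count `t` returns to its
parent; the result is the instance that goes on, with its ancestors.  (The root of an episode never
runs out of its duration.) -/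
def returnExpired {K : ℕ} (t : ℕ) : BaseAlg K → List (BaseAlg K) → BaseAlg K × List (BaseAlg K)
  | f, [] => (f, [])
  | f, p :: ps => if f.start + f.duration < t then returnExpired t p ps else (f, p :: ps)

/-- Start of a new episode at round `t`: master set `[K]`, and a call of
`Base-Alg(t, T + 1 - t)`. -/
def newEpisode {K : ℕ} (T t : ℕ) (played : ℕ → Fin K) (width : ℕ → ℕ) : State K where
  episode := t
  master := Finset.univ
  active := ⟨t, T + 1 - t, Finset.univ⟩
  parents := []
  played := played
  width := width

/-- Round `t` of META, up to the moment at which the next arm is to be played.  An arm is drawn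
from `𝒜_t` and the round count becomes `t + 1`.  If a replay is scheduled there, the longest
one interrupts the active instance.  (What happens after round `T` is irrelevant.)  Otherwise expired instances return, the instance that goes
on evicts arms from `𝒜_master` and from its own set, and if `𝒜_master` has become empty, all
instances return and a new episode starts. -/
def step {K : ℕ} (C₀ : ℝ) (T : ℕ) (ω : Outcome K) (t : ℕ) (σ : State K) : State K :=
  let played := Function.update σ.played t (ω.2.1 (t, σ.active.arms))
  let width := Function.update σ.width t σ.active.arms.card
  let S := scheduled T ω.2.2 σ.episode (t + 1)
  if h : S.Nonempty then
    { σ with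
      active := ⟨t + 1, S.max' h, Finset.univ⟩
      parents := σ.active :: σ.parents
      played := played
      width := width }
  else
    let r := returnExpired (t + 1) σ.active σ.parents
    let bad := badArms C₀ T ω.1 played width
    let master := σ.master \ bad σ.episode (t + 1)
    if master = ∅ then
      newEpisode T (t + 1) played width
    else
      { episode := σ.episode
        master := master
        active := { r.1 with arms := r.1.arms \ bad r.1.start (t + 1) }
        parents := r.2
        played := played
        width := width }

/-- The state of META after `n` rounds. -/
def stateAfter {K : ℕ} [NeZero K] (C₀ : ℝ) (T : ℕ) (ω : Outcome K) : ℕ → State K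
  | 0 => newEpisode T 1 (fun _ => 0) (fun _ => 0)
  | n + 1 => step C₀ T ω (n + 1) (stateAfter C₀ T ω n)

/-- The arm played by META (horizon `T`, eviction constant `C₀`) at round `t ≥ 1`. -/
def metaArm {K : ℕ} [NeZero K] (C₀ : ℝ) (T : ℕ) (t : ℕ) (ω : Outcome K) : Fin K :=
  (stateAfter C₀ T ω t).played t

end SwitchingBandit

end

/-!
The horizon is divided into phases in which every mean reward stays within `ε` of a constant, so
short that a gap `ε` is invisible against the noise `√(K / n)` of `n` rounds (`IsPhasing`). In each
phase one arm, the safe arm of the phase, is optimal up to `2 ε`. On the event `GoodOutcome` the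
regret is bounded round by round, without any further randomness:

* An instance of the base algorithm that has been running for `n` rounds of a phase has candidates
  whose gaps, relative to any other arm that is still a candidate, are at most `ε` plus
  `√(K / n)` up to logarithms (`candidate_gap_le`). Calls are nested, and the candidate set at any
  moment consists of the arms not evicted since the active instance was started
  (`mem_armsAt_iff`, `startAt_le_startAt`), so the recursion needs no other description.
* An instance or an episode that started in a phase does not evict the safe arm of the phase while
  the phase lasts (`safe_mem_armsAt`). Hence an episode does not end in the phase in which it started,
  and there are no more episodes than phases (`phase_lt_of_restart`).
* While an episode lasts, some arm `x`, the anchor, has not been evicted from the master set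
  (`exists_anchor`). If its gap is `δ ≥ 8 ε`, a replay of length about `K / δ²` inside the phase
  would reveal this; the schedule provides such replays with probability `1 / √(m (s - t_ℓ))`, so
  the sum of these probabilities over the rounds where the anchor is bad is at most logarithmic.
  This is a bound for the regret of the anchor (`anchor_gap_le`, `sum_detectionRounds_le`).
* The replays themselves cost at most `∑ √m` over the scheduled lengths, which is of the order of
  the square root of the length of the episode (`sum_replayTerm_le`).

Summed over episodes and phases with the Cauchy–Schwarz inequality this gives `good_regret_le`.

Outcomes are good up to probability `5 / T` (`measure_not_goodOutcome_le`). The candidate set of a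
round is a function of the past, so the centred gap estimates form a martingale; its exponential
supermartingale is obtained by resampling the rewards and draws of one round from an independent
copy of the outcome (`lintegral_round_le`, `lintegral_exp_sum_le`). The schedule is independent of
everything else and is handled by Chernoff's bound. Finally the number of phases is chosen to
balance `√(K T · phases)` against the total variation (`exists_phase_number`).
-/

open MeasureTheory ProbabilityTheory

noncomputable section

namespace SwitchingBandit

/-! ### The run of META as a sequence of episodes, active instances and candidate sets -/

section CallStack

variable {K T : ℕ}

/-- The shape of the call stack in an episode that starts at round `e`: the bottom instance was
started at `e`; every instance above it is a scheduled replay that was started no earlier than the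
instance it interrupts. -/
def StackOK (T : ℕ) (B : ℕ × ℕ × ℕ → Bool) (e : ℕ) : BaseAlg K → List (BaseAlg K) → Prop
  | f, [] => f.start = e
  | f, p :: ps => e < f.start ∧ p.start ≤ f.start ∧ f.duration ∈ replayLengths T ∧
      B (e, f.start, f.duration) = true ∧ StackOK T B e p ps

theorem StackOK.with_arms {B : ℕ × ℕ × ℕ → Bool} {e : ℕ} {f : BaseAlg K} {l : List (BaseAlg K)}
    (h : StackOK T B e f l) (A : Finset (Fin K)) : StackOK T B e { f with arms := A } l := by
  cases l <;> exact h

theorem StackOK.start_le {B : ℕ × ℕ × ℕ → Bool} {e : ℕ} {l : List (BaseAlg K)} :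
    ∀ {f : BaseAlg K}, StackOK T B e f l → ∀ x ∈ f :: l, x.start ≤ f.start := by
  induction l with
  | nil => intro f _ x hx; simp at hx; simp [hx]
  | cons p ps ih =>
    intro f h x hx
    rcases List.mem_cons.1 hx with rfl | hx
    · exact le_rfl
    · exact (ih h.2.2.2.2 x hx).trans h.2.1

theorem StackOK.returnExpired {B : ℕ × ℕ × ℕ → Bool} {e t : ℕ} {l : List (BaseAlg K)} :
    ∀ {f : BaseAlg K}, StackOK T B e f l →
      StackOK T B e (returnExpired t f l).1 (returnExpired t f l).2 := by
  induction l with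
  | nil => intro f h; exact h
  | cons p ps ih =>
    intro f h
    unfold SwitchingBandit.returnExpired
    split_ifs
    · exact ih h.2.2.2.2
    · exact h

theorem mem_of_mem_returnExpired {t : ℕ} {l : List (BaseAlg K)} :
    ∀ {f x : BaseAlg K}, x ∈ (returnExpired t f l).1 :: (returnExpired t f l).2 → x ∈ f :: l := by
  induction l with
  | nil => intro f x h; exact h
  | cons p ps ih =>
    intro f x h
    unfold returnExpired at h
    split_ifs at h
    · exact List.mem_cons_of_mem _ (ih h)
    · exact h

theorem mem_returnExpired_of_le {t : ℕ} {l : List (BaseAlg K)} :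
    ∀ {f x : BaseAlg K}, x ∈ f :: l → t ≤ x.start + x.duration →
      x ∈ (returnExpired t f l).1 :: (returnExpired t f l).2 := by
  induction l with
  | nil => intro f x h _; exact h
  | cons p ps ih =>
    intro f x h hx
    unfold returnExpired
    split_ifs with hf
    · rcases List.mem_cons.1 h with rfl | h
      · omega
      · exact ih h hx
    · exact h

theorem returnExpired_not_expired {t : ℕ} {l : List (BaseAlg K)} :
    ∀ {f : BaseAlg K}, (returnExpired t f l).2 = [] ∨
      t ≤ (returnExpired t f l).1.start + (returnExpired t f l).1.duration := by
  induction l with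
  | nil => intro f; exact Or.inl rfl
  | cons p ps ih =>
    intro f
    unfold returnExpired
    split_ifs with hf
    · exact ih
    · exact Or.inr (by simpa using hf)

theorem meetsEviction_congr {C₀ : ℝ} {y : ℕ → Fin K → ℝ} {p p' : ℕ → Fin K} {w w' : ℕ → ℕ}
    {lo t : ℕ}
    (hp : ∀ s, lo ≤ s → s < t → p s = p' s) (hw : ∀ s, lo ≤ s → s < t → w s = w' s) (a : Fin K) :
    MeetsEviction C₀ T y p w lo t a ↔ MeetsEviction C₀ T y p' w' lo t a := by
  unfold MeetsEviction
  refine exists_congr fun s₁ => exists_congr fun s₂ => and_congr_right fun h1 =>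
    and_congr_right fun h2 => and_congr_right fun h3 => exists_congr fun a' => ?_
  rw [Finset.sum_congr rfl fun s hs => ?_]
  rw [Finset.mem_Icc] at hs
  unfold gapEstimate
  rw [hp s (by omega) (by omega), hw s (by omega) (by omega)]

end CallStack

section Run

variable {K : ℕ} [NeZero K] (C₀ : ℝ) (T : ℕ) (ω : Outcome K)

/-- The candidate set `𝒜_r` from which the arm of round `r ≥ 1` is drawn. -/
def armsAt (r : ℕ) : Finset (Fin K) := (stateAfter C₀ T ω (r - 1)).active.arms

/-- The first round of the base-algorithm instance that is active at round `r ≥ 1`. -/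
def startAt (r : ℕ) : ℕ := (stateAfter C₀ T ω (r - 1)).active.start

/-- The first round of the episode that contains round `r ≥ 1`. -/
def episodeAt (r : ℕ) : ℕ := (stateAfter C₀ T ω (r - 1)).episode

/-- The arm played at round `r ≥ 1`, read off the candidate set of that round. -/
def armDrawn (r : ℕ) : Fin K := ω.2.1 (r, armsAt C₀ T ω r)

/-- The estimate `δ̂_s(a', a)` along the run. -/
def runEstimate (s : ℕ) (a' a : Fin K) : ℝ :=
  gapEstimate ω.1 (armDrawn C₀ T ω) (fun r => (armsAt C₀ T ω r).card) s a' a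

/-- The eviction criterion for arm `a` on `[lo, t)` along the run. -/
def Bad (lo t : ℕ) (a : Fin K) : Prop :=
  MeetsEviction C₀ T ω.1 (armDrawn C₀ T ω) (fun r => (armsAt C₀ T ω r).card) lo t a

variable {C₀ T ω}

theorem Bad.mono {lo t lo' t' : ℕ} {a : Fin K} (h : Bad C₀ T ω lo t a) (hlo : lo' ≤ lo)
    (ht : t ≤ t') : Bad C₀ T ω lo' t' a := by
  obtain ⟨s₁, s₂, h1, h2, h3, h4⟩ := h
  exact ⟨s₁, s₂, hlo.trans h1, h2, h3.trans_le ht, h4⟩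

theorem not_bad_of_le {lo t : ℕ} (h : t ≤ lo + 1) (a : Fin K) : ¬ Bad C₀ T ω lo t a := by
  rintro ⟨s₁, s₂, h1, h2, h3, -⟩
  omega

variable (C₀ T ω)

/-- What holds after `n` rounds of META, that is before round `n + 1`. -/
structure RunInvariant (n : ℕ) : Prop where
  played : ∀ s, 1 ≤ s → s ≤ n → (stateAfter C₀ T ω n).played s = armDrawn C₀ T ω s
  width : ∀ s, 1 ≤ s → s ≤ n → (stateAfter C₀ T ω n).width s = (armsAt C₀ T ω s).card
  episode_pos : 1 ≤ (stateAfter C₀ T ω n).episode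
  master : ∀ a, a ∉ (stateAfter C₀ T ω n).master →
    Bad C₀ T ω (stateAfter C₀ T ω n).episode (n + 1) a
  entries : ∀ x ∈ (stateAfter C₀ T ω n).active :: (stateAfter C₀ T ω n).parents,
    (stateAfter C₀ T ω n).episode ≤ x.start ∧ x.start ≤ n + 1 ∧
    (∀ a, a ∉ x.arms → Bad C₀ T ω x.start (n + 1) a) ∧
    (∀ r, x.start ≤ r → r ≤ n + 1 → x.start ≤ startAt C₀ T ω r)
  active_arms : ∀ a ∈ (stateAfter C₀ T ω n).active.arms,
    ¬ Bad C₀ T ω (stateAfter C₀ T ω n).active.start (n + 1) a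
  stack : StackOK T ω.2.2 (stateAfter C₀ T ω n).episode (stateAfter C₀ T ω n).active
    (stateAfter C₀ T ω n).parents
  not_expired : (stateAfter C₀ T ω n).parents = [] ∨
    n + 1 ≤ (stateAfter C₀ T ω n).active.start + (stateAfter C₀ T ω n).active.duration

/-- The sets of evicted arms that round `t` of META computes are those of `Bad`. -/
theorem mem_badArms_iff {n lo : ℕ} (h : RunInvariant C₀ T ω n) (hlo : 1 ≤ lo) (a : Fin K) :
    a ∈ badArms C₀ T ω.1
      (Function.update (stateAfter C₀ T ω n).played (n + 1)
        (ω.2.1 (n + 1, (stateAfter C₀ T ω n).active.arms)))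
      (Function.update (stateAfter C₀ T ω n).width (n + 1)
        (stateAfter C₀ T ω n).active.arms.card) lo (n + 1 + 1) ↔ Bad C₀ T ω lo (n + 2) a := by
  unfold badArms Bad
  simp only [Finset.mem_filter, Finset.mem_univ, true_and]
  apply meetsEviction_congr
  · intro s h1 h2
    rcases Nat.lt_or_ge n s with h3 | h3
    · obtain rfl : s = n + 1 := by omega
      simp [armDrawn, armsAt]
    · rw [Function.update_of_ne (by omega), h.played s (by omega) h3]
  · intro s h1 h2
    rcases Nat.lt_or_ge n s with h3 | h3
    · obtain rfl : s = n + 1 := by omega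
      simp [armsAt]
    · rw [Function.update_of_ne (by omega), h.width s (by omega) h3]

/-- The three things that can happen between round `n + 1` and round `n + 2`: a replay starts, the
episode goes on, or a new episode starts. -/
theorem stateAfter_succ_cases {n : ℕ} (h : RunInvariant C₀ T ω n) :
    (∃ hS : (scheduled T ω.2.2 (stateAfter C₀ T ω n).episode (n + 2)).Nonempty,
      (stateAfter C₀ T ω (n + 1)).episode = (stateAfter C₀ T ω n).episode ∧
      (stateAfter C₀ T ω (n + 1)).master = (stateAfter C₀ T ω n).master ∧
      (stateAfter C₀ T ω (n + 1)).active =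
        ⟨n + 2, (scheduled T ω.2.2 (stateAfter C₀ T ω n).episode (n + 2)).max' hS, Finset.univ⟩ ∧
      (stateAfter C₀ T ω (n + 1)).parents =
        (stateAfter C₀ T ω n).active :: (stateAfter C₀ T ω n).parents) ∨
    (¬ (scheduled T ω.2.2 (stateAfter C₀ T ω n).episode (n + 2)).Nonempty ∧
      (∃ a, ¬ Bad C₀ T ω (stateAfter C₀ T ω n).episode (n + 2) a) ∧
      (stateAfter C₀ T ω (n + 1)).episode = (stateAfter C₀ T ω n).episode ∧
      (∀ a, a ∉ (stateAfter C₀ T ω (n + 1)).master →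
        Bad C₀ T ω (stateAfter C₀ T ω n).episode (n + 2) a) ∧
      (∃ A : Finset (Fin K), (∀ a, a ∈ A ↔
        a ∈ (returnExpired (n + 2) (stateAfter C₀ T ω n).active
          (stateAfter C₀ T ω n).parents).1.arms ∧
        ¬ Bad C₀ T ω (returnExpired (n + 2) (stateAfter C₀ T ω n).active
          (stateAfter C₀ T ω n).parents).1.start (n + 2) a) ∧
        (stateAfter C₀ T ω (n + 1)).active = { (returnExpired (n + 2) (stateAfter C₀ T ω n).active
          (stateAfter C₀ T ω n).parents).1 with arms := A }) ∧
      (stateAfter C₀ T ω (n + 1)).parents = (returnExpired (n + 2) (stateAfter C₀ T ω n).active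
          (stateAfter C₀ T ω n).parents).2) ∨
    ((∀ a, Bad C₀ T ω (stateAfter C₀ T ω n).episode (n + 2) a) ∧
      (stateAfter C₀ T ω (n + 1)).episode = n + 2 ∧
      (stateAfter C₀ T ω (n + 1)).master = Finset.univ ∧
      (stateAfter C₀ T ω (n + 1)).active = ⟨n + 2, T + 1 - (n + 2), Finset.univ⟩ ∧
      (stateAfter C₀ T ω (n + 1)).parents = []) := by
  have hbad := fun lo hlo a => mem_badArms_iff C₀ T ω (lo := lo) h hlo a
  have hstart : 1 ≤ (returnExpired (n + 2) (stateAfter C₀ T ω n).active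
      (stateAfter C₀ T ω n).parents).1.start :=
    h.episode_pos.trans (h.entries _ (mem_of_mem_returnExpired (List.mem_cons_self ..))).1
  have hE := h.episode_pos
  have hM := h.master
  simp only [stateAfter]
  rw [step]
  set σ := stateAfter C₀ T ω n with hσ
  dsimp only
  by_cases hS : (scheduled T ω.2.2 σ.episode (n + 1 + 1)).Nonempty
  · left
    rw [dif_pos hS]
    exact ⟨hS, rfl, rfl, rfl, rfl⟩
  rw [dif_neg hS]
  right
  set m := σ.master \ badArms C₀ T ω.1
      (Function.update σ.played (n + 1) (ω.2.1 (n + 1, σ.active.arms)))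
      (Function.update σ.width (n + 1) σ.active.arms.card) σ.episode (n + 1 + 1) with hm
  by_cases hme : m = ∅
  · right
    rw [if_pos hme]
    refine ⟨fun a => ?_, rfl, rfl, rfl, rfl⟩
    by_cases ha : a ∈ σ.master
    · rw [← hbad _ hE]
      by_contra hb
      have : a ∈ m := by rw [hm, Finset.mem_sdiff]; exact ⟨ha, hb⟩
      simp [hme] at this
    · exact (hM a ha).mono le_rfl (by omega)
  · left
    rw [if_neg hme]
    refine ⟨hS, ?_, rfl, fun a ha => ?_, ⟨_, fun a => ?_, rfl⟩, rfl⟩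
    · obtain ⟨a, ha⟩ := Finset.nonempty_iff_ne_empty.2 hme
      rw [hm, Finset.mem_sdiff, hbad _ hE] at ha
      exact ⟨a, ha.2⟩
    · dsimp only at ha
      rw [hm, Finset.mem_sdiff, hbad _ hE] at ha
      by_cases ha' : a ∈ σ.master
      · tauto
      · exact (hM a ha').mono le_rfl (by omega)
    · rw [Finset.mem_sdiff, hbad _ hstart]

theorem stateAfter_succ_played (n : ℕ) :
    (stateAfter C₀ T ω (n + 1)).played =
      Function.update (stateAfter C₀ T ω n).played (n + 1) (armDrawn C₀ T ω (n + 1)) ∧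
    (stateAfter C₀ T ω (n + 1)).width =
      Function.update (stateAfter C₀ T ω n).width (n + 1) (armsAt C₀ T ω (n + 1)).card := by
  simp only [stateAfter, armDrawn, armsAt, Nat.add_sub_cancel]
  rw [step]
  dsimp only
  split_ifs <;> exact ⟨rfl, rfl⟩

theorem metaArm_eq_armDrawn {t : ℕ} (ht : 1 ≤ t) : metaArm C₀ T t ω = armDrawn C₀ T ω t := by
  obtain ⟨n, rfl⟩ : ∃ n, t = n + 1 := ⟨t - 1, by omega⟩
  rw [metaArm, (stateAfter_succ_played C₀ T ω n).1, Function.update_self]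

theorem runInvariant (n : ℕ) : RunInvariant C₀ T ω n := by
  induction n with
  | zero =>
    constructor
    · intros; omega
    · intros; omega
    · exact le_rfl
    · intro a ha; simp [stateAfter, newEpisode] at ha
    · intro x hx
      simp only [stateAfter, newEpisode, List.mem_cons, List.not_mem_nil, or_false] at hx
      subst hx
      refine ⟨le_rfl, le_rfl, fun a ha => by simp at ha, fun r h1 h2 => ?_⟩
      dsimp only at h1 ⊢
      obtain rfl : r = 1 := by omega
      exact le_rfl
    · intro a _; exact not_bad_of_le (by simp [stateAfter, newEpisode]) a
    · exact rfl
    · exact Or.inl rfl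
  | succ n ih =>
    have hpl : ∀ s, 1 ≤ s → s ≤ n + 1 →
        (stateAfter C₀ T ω (n + 1)).played s = armDrawn C₀ T ω s := by
      intro s h1 h2
      rw [(stateAfter_succ_played C₀ T ω n).1]
      rcases Nat.lt_or_ge n s with h3 | h3
      · obtain rfl : s = n + 1 := by omega
        simp
      · rw [Function.update_of_ne (by omega), ih.played s (by omega) h3]
    have hwi : ∀ s, 1 ≤ s → s ≤ n + 1 →
        (stateAfter C₀ T ω (n + 1)).width s = (armsAt C₀ T ω s).card := by
      intro s h1 h2
      rw [(stateAfter_succ_played C₀ T ω n).2]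
      rcases Nat.lt_or_ge n s with h3 | h3
      · obtain rfl : s = n + 1 := by omega
        simp
      · rw [Function.update_of_ne (by omega), ih.width s (by omega) h3]
    have hst : startAt C₀ T ω (n + 1 + 1) = (stateAfter C₀ T ω (n + 1)).active.start := rfl
    rcases stateAfter_succ_cases C₀ T ω ih with ⟨hS, h1, h2, h3, h4⟩ |
      ⟨-, h0, h1, h2, ⟨A, hA, h3⟩, h4⟩ | ⟨h0, h1, h2, h3, h4⟩
    · constructor
      · exact hpl
      · exact hwi
      · rw [h1]; exact ih.episode_pos
      · rw [h1, h2]; exact fun a ha => (ih.master a ha).mono le_rfl (by omega)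
      · rw [h1, h3, h4]
        rw [h3] at hst
        have hep := (ih.entries _ (List.mem_cons_self ..))
        intro x hx
        rcases List.mem_cons.1 hx with rfl | hx
        · refine ⟨by dsimp only; omega, le_rfl, fun a ha => by simp at ha, fun r h1 h2 => ?_⟩
          dsimp only at h1 ⊢
          obtain rfl : r = n + 2 := by omega
          exact hst.ge
        · obtain ⟨g1, g2, g3, g4⟩ := ih.entries x hx
          refine ⟨g1, by omega, fun a ha => (g3 a ha).mono le_rfl (by omega), fun r h1 h2 => ?_⟩
          rcases Nat.lt_or_ge (n + 1) r with h3 | h3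
          · obtain rfl : r = n + 1 + 1 := by omega
            rw [hst]; dsimp only; omega
          · exact g4 r h1 h3
      · rw [h3]; exact fun a _ => not_bad_of_le (by simp) a
      · rw [h1, h3, h4]
        have hep := (ih.entries _ (List.mem_cons_self ..))
        have hmax := Finset.max'_mem _ hS
        have hmax2 := (Finset.mem_filter.1 hmax)
        exact ⟨by dsimp only; omega, by dsimp only; omega, hmax2.1, hmax2.2, ih.stack⟩
      · rw [h3]; exact Or.inr (by dsimp only; omega)
    · have hstk := ih.stack.returnExpired (t := n + 2)
      have hmem := fun x => mem_of_mem_returnExpired (t := n + 2)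
        (f := (stateAfter C₀ T ω n).active) (l := (stateAfter C₀ T ω n).parents) (x := x)
      have hne := returnExpired_not_expired (t := n + 2)
        (f := (stateAfter C₀ T ω n).active) (l := (stateAfter C₀ T ω n).parents)
      set g := returnExpired (n + 2) (stateAfter C₀ T ω n).active (stateAfter C₀ T ω n).parents
        with hg
      rw [h3] at hst
      dsimp only at hst
      constructor
      · exact hpl
      · exact hwi
      · rw [h1]; exact ih.episode_pos
      · rw [h1]; exact h2
      · rw [h1, h3, h4]
        have key : ∀ x ∈ g.1 :: g.2, ∀ r, x.start ≤ r → r ≤ n + 1 + 1 →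
            x.start ≤ startAt C₀ T ω r := by
          intro x hx r h1 h2
          rcases Nat.lt_or_ge (n + 1) r with h3 | h3
          · obtain rfl : r = n + 1 + 1 := by omega
            rw [hst]; exact hstk.start_le x hx
          · exact (ih.entries x (hmem x hx)).2.2.2 r h1 h3
        intro x hx
        rcases List.mem_cons.1 hx with rfl | hx
        · obtain ⟨g1, g2, g3, g4⟩ := ih.entries _ (hmem _ (List.mem_cons_self ..))
          refine ⟨g1, by dsimp only; omega, fun a ha => ?_, key g.1 (List.mem_cons_self ..)⟩
          dsimp only at ha ⊢
          rw [hA] at ha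
          by_cases hb : a ∈ g.1.arms
          · tauto
          · exact (g3 a hb).mono le_rfl (by omega)
        · have hx' := List.mem_cons_of_mem g.1 hx
          obtain ⟨g1, g2, g3, g4⟩ := ih.entries x (hmem x hx')
          exact ⟨g1, by omega, fun a ha => (g3 a ha).mono le_rfl (by omega), key x hx'⟩
      · rw [h3]; intro a ha; exact ((hA a).1 ha).2
      · rw [h1, h3, h4]; exact hstk.with_arms A
      · rw [h3, h4]; exact hne
    · constructor
      · exact hpl
      · exact hwi
      · rw [h1]; omega
      · rw [h2]; simp
      · rw [h1, h3, h4]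
        rw [h3] at hst
        intro x hx
        rw [List.mem_singleton] at hx
        subst hx
        refine ⟨le_rfl, le_rfl, fun a ha => by simp at ha, fun r h1 h2 => ?_⟩
        dsimp only at h1 ⊢
        obtain rfl : r = n + 2 := by omega
        exact hst.ge
      · rw [h3]; exact fun a _ => not_bad_of_le (by simp) a
      · rw [h1, h3, h4]; exact rfl
      · exact Or.inl h4

variable {C₀ T ω}

theorem one_le_episodeAt (r : ℕ) : 1 ≤ episodeAt C₀ T ω r :=
  (runInvariant C₀ T ω (r - 1)).episode_pos

theorem episodeAt_le_startAt (r : ℕ) : episodeAt C₀ T ω r ≤ startAt C₀ T ω r :=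
  ((runInvariant C₀ T ω (r - 1)).entries _ (List.mem_cons_self ..)).1

theorem startAt_le {r : ℕ} (hr : 1 ≤ r) : startAt C₀ T ω r ≤ r := by
  have := ((runInvariant C₀ T ω (r - 1)).entries _ (List.mem_cons_self ..)).2.1
  rwa [Nat.sub_add_cancel hr] at this

theorem episodeAt_le {r : ℕ} (hr : 1 ≤ r) : episodeAt C₀ T ω r ≤ r :=
  (episodeAt_le_startAt r).trans (startAt_le hr)

/-- The candidate set consists of the arms not evicted since the active instance was started,
whatever the recursive calls in between. -/
theorem mem_armsAt_iff {r : ℕ} (hr : 1 ≤ r) (a : Fin K) :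
    a ∈ armsAt C₀ T ω r ↔ ¬ Bad C₀ T ω (startAt C₀ T ω r) r a := by
  have h := runInvariant C₀ T ω (r - 1)
  have h1 := (h.entries _ (List.mem_cons_self ..)).2.2.1 a
  have h2 := h.active_arms a
  rw [Nat.sub_add_cancel hr] at h1 h2
  exact ⟨h2, fun hb => by_contra fun hc => hb (h1 hc)⟩

/-- Instances are nested: an instance that is active at round `r'` has not been suspended by
anything but its descendants since it was started. -/
theorem startAt_le_startAt {r r' : ℕ} (h1 : startAt C₀ T ω r' ≤ r) (h2 : r ≤ r') :
    startAt C₀ T ω r' ≤ startAt C₀ T ω r :=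
  ((runInvariant C₀ T ω (r' - 1)).entries _ (List.mem_cons_self ..)).2.2.2 r h1 (by omega)

theorem episodeAt_succ {r : ℕ} (hr : 1 ≤ r) :
    episodeAt C₀ T ω (r + 1) = episodeAt C₀ T ω r ∨
      (episodeAt C₀ T ω (r + 1) = r + 1 ∧ ∀ a, Bad C₀ T ω (episodeAt C₀ T ω r) (r + 1) a) := by
  obtain ⟨n, rfl⟩ : ∃ n, r = n + 1 := ⟨r - 1, by omega⟩
  rcases stateAfter_succ_cases C₀ T ω (runInvariant C₀ T ω n) with ⟨_, h, -⟩ | ⟨-, -, h, -⟩ |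
    ⟨h, h', -⟩
  · exact Or.inl h
  · exact Or.inl h
  · exact Or.inr ⟨h', h⟩

/-- Within an episode, every round is the first round of a replay or comes after a check that left
the master set nonempty. -/
theorem startAt_succ_or_exists_not_bad {r : ℕ} (hr : 1 ≤ r)
    (he : episodeAt C₀ T ω (r + 1) = episodeAt C₀ T ω r) :
    startAt C₀ T ω (r + 1) = r + 1 ∨ ∃ a, ¬ Bad C₀ T ω (episodeAt C₀ T ω r) (r + 1) a := by
  obtain ⟨n, rfl⟩ : ∃ n, r = n + 1 := ⟨r - 1, by omega⟩
  rcases stateAfter_succ_cases C₀ T ω (runInvariant C₀ T ω n) with ⟨_, -, -, h, -⟩ |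
    ⟨-, h, -⟩ | ⟨-, -, -, h, -⟩
  · left; change (stateAfter C₀ T ω (n + 1)).active.start = _; rw [h]
  · exact Or.inr h
  · left; change (stateAfter C₀ T ω (n + 1)).active.start = _; rw [h]

theorem episodeAt_mono {r r' : ℕ} (hr : 1 ≤ r) (h : r ≤ r') :
    episodeAt C₀ T ω r ≤ episodeAt C₀ T ω r' := by
  induction r', h using Nat.le_induction with
  | base => exact le_rfl
  | succ n hn ih =>
    rcases episodeAt_succ (C₀ := C₀) (T := T) (ω := ω) (hr.trans hn) with h | h
    · omega
    · have := episodeAt_le (C₀ := C₀) (T := T) (ω := ω) hr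
      omega

theorem episodeAt_eq_of_le {r r' : ℕ} (hr : 1 ≤ r) (h1 : episodeAt C₀ T ω r' ≤ r) (h2 : r ≤ r') :
    episodeAt C₀ T ω r = episodeAt C₀ T ω r' := by
  induction r', h2 using Nat.le_induction with
  | base => rfl
  | succ n hn ih =>
    rcases episodeAt_succ (C₀ := C₀) (T := T) (ω := ω) (hr.trans hn) with h | h
    · rw [h] at h1 ⊢; exact ih h1
    · omega

/-- A replay that is active at round `r` has been scheduled and has not run out of its duration. -/
theorem exists_scheduled_of_lt {r : ℕ} (hr : 1 ≤ r)
    (h : episodeAt C₀ T ω r < startAt C₀ T ω r) :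
    ∃ m ∈ replayLengths T, ω.2.2 (episodeAt C₀ T ω r, startAt C₀ T ω r, m) = true ∧
      r ≤ startAt C₀ T ω r + m := by
  have hI := runInvariant C₀ T ω (r - 1)
  have h1 := hI.stack
  have h2 := hI.not_expired
  unfold episodeAt startAt at h ⊢
  rw [Nat.sub_add_cancel hr] at h2
  cases hp : (stateAfter C₀ T ω (r - 1)).parents with
  | nil =>
    rw [hp] at h1
    have h3 : (stateAfter C₀ T ω (r - 1)).active.start =
      (stateAfter C₀ T ω (r - 1)).episode := h1
    omega
  | cons p ps =>
    rw [hp] at h1 h2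
    exact ⟨_, h1.2.2.1, h1.2.2.2.1, by simpa using h2⟩

/-- A scheduled replay of length `m` keeps all earlier instances from being active for `m` further
rounds, unless the episode ends. -/
theorem le_startAt_of_scheduled {e u m r : ℕ} (hm : m ∈ replayLengths T)
    (hB : ω.2.2 (e, u, m) = true) (her : episodeAt C₀ T ω r = e) (heu : e < u) (hur : u ≤ r)
    (hrm : r ≤ u + m) : u ≤ startAt C₀ T ω r := by
  have he1 : 1 ≤ e := her ▸ one_le_episodeAt r
  have key : ∀ r, u ≤ r → r ≤ u + m → episodeAt C₀ T ω r = e →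
      ∃ x ∈ (stateAfter C₀ T ω (r - 1)).active :: (stateAfter C₀ T ω (r - 1)).parents,
        x.start = u ∧ m ≤ x.duration := by
    intro r hr
    induction r, hr using Nat.le_induction with
    | base =>
      intro _ heu'
      obtain ⟨n, rfl⟩ : ∃ n, u = n + 2 := ⟨u - 2, by omega⟩
      have hen : episodeAt C₀ T ω (n + 1) = e :=
        (episodeAt_eq_of_le (by omega) (by rw [heu']; omega) (by omega)).trans heu'
      have hmS : m ∈ scheduled T ω.2.2 (stateAfter C₀ T ω n).episode (n + 2) := by
        rw [scheduled, Finset.mem_filter]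
        have : (stateAfter C₀ T ω n).episode = e := hen
        rw [this]
        exact ⟨hm, hB⟩
      rcases stateAfter_succ_cases C₀ T ω (runInvariant C₀ T ω n) with ⟨hS, -, -, h, -⟩ |
        ⟨h, -⟩ | ⟨-, h, -⟩
      · refine ⟨_, List.mem_cons_self .., ?_⟩
        change (stateAfter C₀ T ω (n + 1)).active.start = _ ∧
          m ≤ (stateAfter C₀ T ω (n + 1)).active.duration
        rw [h]
        exact ⟨rfl, Finset.le_max' _ _ hmS⟩
      · exact absurd ⟨m, hmS⟩ h
      · have : (stateAfter C₀ T ω (n + 1)).episode = e := heu'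
        omega
    | succ r hr ih =>
      intro hrm' her'
      obtain ⟨n, rfl⟩ : ∃ n, r = n + 1 := ⟨r - 1, by omega⟩
      have hen : episodeAt C₀ T ω (n + 1) = e :=
        (episodeAt_eq_of_le (by omega) (by rw [her']; omega) (by omega)).trans her'
      obtain ⟨x, hx, hx1, hx2⟩ := ih (by omega) hen
      change x ∈ (stateAfter C₀ T ω n).active :: (stateAfter C₀ T ω n).parents at hx
      change ∃ x ∈ (stateAfter C₀ T ω (n + 1)).active :: (stateAfter C₀ T ω (n + 1)).parents, _
      rcases stateAfter_succ_cases C₀ T ω (runInvariant C₀ T ω n) with ⟨hS, -, -, h, h'⟩ |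
        ⟨-, -, -, -, ⟨A, -, h⟩, h'⟩ | ⟨-, h, -⟩
      · exact ⟨x, by rw [h']; exact List.mem_cons_of_mem _ hx, hx1, hx2⟩
      · have := mem_returnExpired_of_le (t := n + 2) hx (by omega)
        rcases List.mem_cons.1 this with h1 | h1
        · refine ⟨_, List.mem_cons_self .., ?_⟩
          rw [h]
          dsimp only
          rw [← h1]
          exact ⟨hx1, hx2⟩
        · exact ⟨x, by rw [h']; exact List.mem_cons_of_mem _ h1, hx1, hx2⟩
      · have : (stateAfter C₀ T ω (n + 1)).episode = e := her'
        omega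
  obtain ⟨x, hx, hx1, -⟩ := key r hur hrm her
  rw [← hx1]
  exact (runInvariant C₀ T ω (r - 1)).stack.start_le x hx

end Run

/-! ### Sums of inverse square roots -/

theorem two_sqrt_add_inv_sqrt_le (n : ℕ) :
    2 * √(n : ℝ) + 1 / √((n : ℝ) + 1) ≤ 2 * √((n : ℝ) + 1) := by
  have h1 : 0 < √((n : ℝ) + 1) := Real.sqrt_pos.2 (by positivity)
  have h2 : √((n : ℝ) + 1) * √((n : ℝ) + 1) = n + 1 := Real.mul_self_sqrt (by positivity)
  have h3 : √(n : ℝ) * √(n : ℝ) = n := Real.mul_self_sqrt (by positivity)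
  have h4 : 1 / √((n : ℝ) + 1) * √((n : ℝ) + 1) = 1 := by field_simp
  nlinarith [sq_nonneg (√((n : ℝ) + 1) - √(n : ℝ))]

theorem sum_inv_sqrt_sub_left_le (F : Finset ℕ) (s : ℕ) (hF : ∀ r ∈ F, s ≤ r) :
    ∑ r ∈ F, 1 / √(((r - s : ℕ) : ℝ) + 1) ≤ 2 * √(F.card : ℝ) := by
  induction F using Finset.induction_on_max with
  | empty => simp
  | insert a F ha ih =>
    have hn : a ∉ F := fun h => lt_irrefl _ (ha a h)
    rw [Finset.sum_insert hn, Finset.card_insert_of_notMem hn]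
    have hc : F.card ≤ a - s := by
      rw [← Nat.card_Ico]
      exact Finset.card_le_card fun x hx =>
        Finset.mem_Ico.2 ⟨hF x (Finset.mem_insert_of_mem hx), ha x hx⟩
    have hc' : (F.card : ℝ) ≤ ((a - s : ℕ) : ℝ) := by exact_mod_cast hc
    have h1 : 1 / √(((a - s : ℕ) : ℝ) + 1) ≤ 1 / √((F.card : ℝ) + 1) := by
      apply one_div_le_one_div_of_le (Real.sqrt_pos.2 (by positivity))
      exact Real.sqrt_le_sqrt (by linarith)
    have h2 := ih fun r hr => hF r (Finset.mem_insert_of_mem hr)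
    have h3 := two_sqrt_add_inv_sqrt_le F.card
    push_cast
    linarith

theorem sum_inv_sqrt_sub_right_le (F : Finset ℕ) (t : ℕ) (hF : ∀ r ∈ F, r ≤ t) :
    ∑ r ∈ F, 1 / √(((t - r : ℕ) : ℝ) + 1) ≤ 2 * √(F.card : ℝ) := by
  have hinj : Set.InjOn (fun r => t - r) (F : Set ℕ) := by
    intro a ha b hb hab
    have := hF a ha
    have := hF b hb
    dsimp only at hab
    omega
  have h := sum_inv_sqrt_sub_left_le (F.image fun r => t - r) 0 fun _ _ => Nat.zero_le _
  rw [Finset.sum_image hinj, Finset.card_image_of_injOn hinj] at h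
  simpa using h

/-- The Cauchy–Schwarz inequality for the sizes of the fibres of a map. -/
theorem sum_sqrt_card_fiber_le (S : Finset ℕ) (f : ℕ → ℕ) (E : Finset ℕ)
    (hf : ∀ r ∈ S, f r ∈ E) :
    ∑ k ∈ E, √((S.filter fun r => f r = k).card : ℝ) ≤ √((E.card : ℝ) * S.card) := by
  apply Real.le_sqrt_of_sq_le
  refine (sq_sum_le_card_mul_sum_sq (s := E)).trans ?_
  rw [Finset.card_eq_sum_card_fiberwise hf]
  push_cast
  gcongr with k
  rw [Real.sq_sqrt (by positivity)]

/-- The first element of `[1, T]` with the same value of `κ` as `r`. -/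
def blockFirst (κ : ℕ → ℕ) (r : ℕ) : ℕ := sInf {r' | 1 ≤ r' ∧ κ r' = κ r}

/-- The last element of `[1, T]` with the same value of `κ` as `r`. -/
def blockLast (T : ℕ) (κ : ℕ → ℕ) (r : ℕ) : ℕ :=
  ((Finset.Icc 1 T).filter fun r' => κ r' = κ r).sup id

theorem blockFirst_mem {κ : ℕ → ℕ} {r : ℕ} (hr : 1 ≤ r) :
    1 ≤ blockFirst κ r ∧ κ (blockFirst κ r) = κ r :=
  Nat.sInf_mem (s := {r' | 1 ≤ r' ∧ κ r' = κ r}) ⟨r, hr, rfl⟩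

theorem blockFirst_le {κ : ℕ → ℕ} {r r' : ℕ} (hr : 1 ≤ r') (h : κ r' = κ r) :
    blockFirst κ r ≤ r' := Nat.sInf_le ⟨hr, h⟩

theorem le_blockLast {T : ℕ} {κ : ℕ → ℕ} {r r' : ℕ} (hr : 1 ≤ r') (hT : r' ≤ T)
    (h : κ r' = κ r) : r' ≤ blockLast T κ r :=
  Finset.le_sup (f := id) (Finset.mem_filter.2 ⟨Finset.mem_Icc.2 ⟨hr, hT⟩, h⟩)

theorem blockLast_mem {T : ℕ} {κ : ℕ → ℕ} {r : ℕ} (hr : 1 ≤ r) (hT : r ≤ T) :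
    blockLast T κ r ≤ T ∧ κ (blockLast T κ r) = κ r := by
  obtain ⟨x, hx, h⟩ := Finset.exists_mem_eq_sup ((Finset.Icc 1 T).filter fun r' => κ r' = κ r)
    ⟨r, Finset.mem_filter.2 ⟨Finset.mem_Icc.2 ⟨hr, hT⟩, rfl⟩⟩ id
  rw [blockLast, h]
  rw [Finset.mem_filter, Finset.mem_Icc] at hx
  exact ⟨hx.1.2, hx.2⟩

/-- Summed over `N + 1` blocks that cover `[1, T]`, the inverse square roots of the distances to the
ends of the blocks are at most of order `√((N + 1) T)`. -/
theorem sum_block_le (T : ℕ) (κ : ℕ → ℕ) (N : ℕ) (hκ : ∀ r ∈ Finset.Icc 1 T, κ r ≤ N) :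
    ∑ r ∈ Finset.Icc 1 T, (1 / √(((r - blockFirst κ r : ℕ) : ℝ) + 1) +
      1 / √(((blockLast T κ r - r : ℕ) : ℝ) + 1)) ≤ 4 * √(((N : ℝ) + 1) * T) := by
  have hmap : ∀ r ∈ Finset.Icc 1 T, κ r ∈ Finset.range (N + 1) := fun r hr =>
    Finset.mem_range.2 (Nat.lt_succ_of_le (hκ r hr))
  have h := sum_sqrt_card_fiber_le (Finset.Icc 1 T) κ _ hmap
  rw [Finset.card_range, Nat.card_Icc, Nat.add_sub_cancel] at h
  push_cast at h
  rw [← Finset.sum_fiberwise_of_maps_to hmap]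
  calc _ ≤ ∑ k ∈ Finset.range (N + 1),
        4 * √((((Finset.Icc 1 T).filter fun r => κ r = k).card : ℝ)) := by
        refine Finset.sum_le_sum fun k _ => ?_
        set F := (Finset.Icc 1 T).filter fun r => κ r = k with hF
        rcases F.eq_empty_or_nonempty with h0 | ⟨r₀, hr₀⟩
        · simp [h0]
        rw [hF, Finset.mem_filter, Finset.mem_Icc] at hr₀
        have hb : ∀ r ∈ F, blockFirst κ r = blockFirst κ r₀ ∧
            blockLast T κ r = blockLast T κ r₀ ∧ blockFirst κ r₀ ≤ r ∧
            r ≤ blockLast T κ r₀ := by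
          intro r hr
          rw [hF, Finset.mem_filter, Finset.mem_Icc] at hr
          have hrr : κ r = κ r₀ := hr.2.trans hr₀.2.symm
          refine ⟨by rw [blockFirst, blockFirst, hrr], by rw [blockLast, blockLast, hrr],
            blockFirst_le hr.1.1 hrr, le_blockLast hr.1.1 hr.1.2 hrr⟩
        have h1 := sum_inv_sqrt_sub_left_le F (blockFirst κ r₀) fun r hr => (hb r hr).2.2.1
        have h2 := sum_inv_sqrt_sub_right_le F (blockLast T κ r₀) fun r hr => (hb r hr).2.2.2
        rw [Finset.sum_add_distrib,
          Finset.sum_congr (g := fun r => 1 / √(((r - blockFirst κ r₀ : ℕ) : ℝ) + 1)) rfl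
            fun r hr => by rw [(hb r hr).1],
          Finset.sum_congr (f := fun r => 1 / √(((blockLast T κ r - r : ℕ) : ℝ) + 1))
            (g := fun r => 1 / √(((blockLast T κ r₀ - r : ℕ) : ℝ) + 1)) rfl
            fun r hr => by rw [(hb r hr).2.1]]
        linarith
    _ = 4 * ∑ k ∈ Finset.range (N + 1),
        √((((Finset.Icc 1 T).filter fun r => κ r = k).card : ℝ)) := by rw [Finset.mul_sum]
    _ ≤ _ := by linarith

/-! ### Phases of small variation and the good event -/

/-- The gap `max_b μ_r(b) - μ_r(a)` of arm `a` at round `r`. -/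
def gap {K : ℕ} (μ : ℕ → Fin K → ℝ) (r : ℕ) (a : Fin K) : ℝ := (⨆ b, μ r b) - μ r a

/-- The order of magnitude `√(K n ∨ K²)` of the fluctuations over `n` rounds of the gap
estimates. -/
def devScale (K n : ℕ) : ℝ := √(max ((K : ℝ) * n) ((K : ℝ) ^ 2))

/-- The conditional mean of the estimate `δ̂_s(a', a)` for the candidate set `A`. -/
def meanEstimate {K : ℕ} (m : Fin K → ℝ) (A : Finset (Fin K)) (a' a : Fin K) : ℝ :=
  (if a' ∈ A then m a' else 0) - (if a ∈ A then m a else 0)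

/-- The level sets of `J` are phases of `[1, T]` in which every mean reward is constant up to `ε`
and which are so short that a gap of order `ε` stays below the noise level `√(K n)`. -/
structure IsPhasing {K : ℕ} (μ : ℕ → Fin K → ℝ) (T : ℕ) (J : ℕ → ℕ) (ε : ℝ) : Prop where
  pos : 0 < ε
  mono : Monotone J
  close : ∀ r r', 1 ≤ r → r ≤ r' → r' ≤ T → J r = J r' → ∀ a, |μ r a - μ r' a| ≤ ε
  short : ∀ r r', 1 ≤ r → r ≤ r' → r' ≤ T → J r = J r' →
    ε * ((r' - r : ℕ) : ℝ) ≤ √((K : ℝ) * ((r' - r : ℕ) : ℝ))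

/-- The length of a replay that detects a gap `δ`: a power of two of order
`(H log T)² K / δ²`. -/
def detectionLength (K T : ℕ) (H δ : ℝ) : ℕ :=
  2 ^ Nat.clog 2 (⌊(H * Real.log T) ^ 2 * K / δ ^ 2⌋₊ + 1)

/-- The rounds at which a replay of the detection length would reveal the gap of arm `a`, before
round `t` and within one phase. -/
def detectionRounds {K : ℕ} (μ : ℕ → Fin K → ℝ) (T : ℕ) (J : ℕ → ℕ) (ε H : ℝ) (e t : ℕ)
    (a : Fin K) : Finset ℕ :=
  (Finset.Ioc e t).filter fun u => 8 * ε ≤ gap μ u a ∧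
    u + detectionLength K T H (gap μ u a) < t ∧ J (u + detectionLength K T H (gap μ u a)) = J u

/-- The cost `∑ 1 / √(r - s + 1)`, over rounds `r ≤ l`, of a replay of length `m` that starts at
round `s`. -/
def replayCost (s m l : ℕ) : ℝ :=
  ∑ r ∈ (Finset.Icc s l).filter (fun r => r ≤ s + m), 1 / √(((r - s : ℕ) : ℝ) + 1)

/-- The event on which the regret is small: drawn arms are candidates, gap estimates are close to
their conditional means, arms with a large gap meet a replay that detects it, and replays are
neither too long nor too many. -/
structure GoodOutcome {K : ℕ} [NeZero K] (μ : ℕ → Fin K → ℝ) (T : ℕ) (J : ℕ → ℕ) (ε C₀ : ℝ)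
    (ω : Outcome K) : Prop where
  drawn : ∀ r (A : Finset (Fin K)), A.Nonempty → ω.2.1 (r, A) ∈ A
  concentration : ∀ s₁ s₂, 1 ≤ s₁ → s₁ < s₂ → s₂ ≤ T → ∀ a' a,
    ∑ s ∈ Finset.Icc s₁ s₂, (runEstimate C₀ T ω s a' a -
      meanEstimate (μ s) (armsAt C₀ T ω s) a' a) ≤ 14 * Real.log T * devScale K (s₂ - s₁)
  detection : ∀ e t, 1 ≤ e → e ≤ t → t ≤ T → ∀ a,
    6 * Real.log T ≤ ∑ u ∈ detectionRounds μ T J ε (2 * (√C₀ + 14)) e t a,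
      (replayProb e u (detectionLength K T (2 * (√C₀ + 14)) (gap μ u a)) : ℝ) →
    ∃ u ∈ detectionRounds μ T J ε (2 * (√C₀ + 14)) e t a,
      ω.2.2 (e, u, detectionLength K T (2 * (√C₀ + 14)) (gap μ u a)) = true
  replays : ∀ e l, 1 ≤ e → e ≤ l → l ≤ T →
    ∑ s ∈ Finset.Ioc e l, ∑ m ∈ replayLengths T,
      (if ω.2.2 (e, s, m) = true then replayCost s m l else 0) ≤
        50 * Real.log T * √((l - e : ℕ) : ℝ)

theorem devScale_mono {K n m : ℕ} (h : n ≤ m) : devScale K n ≤ devScale K m := by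
  unfold devScale
  have : (n : ℝ) ≤ m := by exact_mod_cast h
  gcongr

theorem sqrt_le_devScale (K n : ℕ) : √((K : ℝ) * n) ≤ devScale K n :=
  Real.sqrt_le_sqrt (le_max_left _ _)

theorem devScale_of_le {K n : ℕ} (h : K ≤ n) : devScale K n = √(K : ℝ) * √(n : ℝ) := by
  have : (K : ℝ) ≤ n := by exact_mod_cast h
  rw [devScale, max_eq_left (by nlinarith [(Nat.cast_nonneg K : (0 : ℝ) ≤ K)]),
    Real.sqrt_mul (by positivity)]

theorem two_thirds_le_log {T : ℕ} (hT : 2 ≤ T) : 2 / 3 ≤ Real.log T := by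
  have h1 := Real.log_two_gt_d9
  have h2 : Real.log 2 ≤ Real.log T := Real.log_le_log (by norm_num) (by exact_mod_cast hT)
  linarith

theorem bad_iff {K : ℕ} [NeZero K] {C₀ : ℝ} {T : ℕ} {ω : Outcome K} (hC : 0 ≤ C₀) {lo t : ℕ}
    {a : Fin K} : Bad C₀ T ω lo t a ↔ ∃ s₁ s₂, lo ≤ s₁ ∧ s₁ < s₂ ∧ s₂ < t ∧ ∃ a',
      Real.log T * (√C₀ * devScale K (s₂ - s₁)) <
        ∑ s ∈ Finset.Icc s₁ s₂, runEstimate C₀ T ω s a' a := by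
  unfold Bad MeetsEviction
  refine exists_congr fun s₁ => exists_congr fun s₂ => and_congr_right fun h1 =>
    and_congr_right fun h2 => and_congr_right fun h3 => exists_congr fun a' => ?_
  rw [devScale, ← Real.sqrt_mul hC, Nat.cast_sub h2.le]
  rfl

section Gap

variable {K : ℕ} {μ : ℕ → Fin K → ℝ} (hμ : ∀ r a, μ r a ∈ Set.Icc (0 : ℝ) 1)

theorem le_ciSup_arm (r : ℕ) (a : Fin K) : μ r a ≤ ⨆ b, μ r b :=
  le_ciSup (Set.finite_range _).bddAbove a

theorem gap_nonneg (r : ℕ) (a : Fin K) : 0 ≤ gap μ r a := sub_nonneg.2 (le_ciSup_arm r a)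

include hμ in
theorem gap_le_one (r : ℕ) (a : Fin K) : gap μ r a ≤ 1 := by
  have : Nonempty (Fin K) := ⟨a⟩
  have : ⨆ b, μ r b ≤ 1 := ciSup_le fun b => (hμ r b).2
  have := (hμ r a).1
  unfold gap
  linarith

theorem exists_gap_eq (r : ℕ) [Nonempty (Fin K)] (a : Fin K) : ∃ b, gap μ r a = μ r b - μ r a := by
  obtain ⟨b, hb⟩ := exists_eq_ciSup_of_finite (f := μ r)
  exact ⟨b, by rw [gap, hb]⟩

end Gap

section Deterministic

variable {K : ℕ} [NeZero K] {μ : ℕ → Fin K → ℝ} {T : ℕ} {J : ℕ → ℕ} {ε C₀ : ℝ} {ω : Outcome K}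

/-- In each phase one arm is optimal up to `2 ε` throughout. -/
theorem IsPhasing.exists_safe (hP : IsPhasing μ T J ε) :
    ∃ star : ℕ → Fin K, ∀ r, 1 ≤ r → r ≤ T → ∀ a, μ r a - μ r (star (J r)) ≤ 2 * ε := by
  have h : ∀ j, ∃ b : Fin K, ∀ r, 1 ≤ r → r ≤ T → J r = j → ∀ a, μ r a - μ r b ≤ 2 * ε := by
    intro j
    by_cases hj : ∃ r, 1 ≤ r ∧ r ≤ T ∧ J r = j
    · obtain ⟨r₀, h1, h2, h3⟩ := hj
      obtain ⟨b, hb⟩ := Finite.exists_max (μ r₀)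
      refine ⟨b, fun r hr hrT hrj a => ?_⟩
      have key : ∀ c, |μ r₀ c - μ r c| ≤ ε := by
        intro c
        rcases le_total r₀ r with h | h
        · exact hP.close r₀ r h1 h hrT (h3.trans hrj.symm) c
        · rw [abs_sub_comm]; exact hP.close r r₀ hr h h2 (hrj.trans h3.symm) c
      have ha := abs_le.1 (key a)
      have hb' := abs_le.1 (key b)
      linarith [hb a, ha.1, hb'.2]
    · exact ⟨0, fun r h1 h2 h3 => (hj ⟨r, h1, h2, h3⟩).elim⟩
  choose star hstar using h
  exact ⟨star, fun r h1 h2 => hstar _ r h1 h2 rfl⟩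

variable (hμ : ∀ r a, μ r a ∈ Set.Icc (0 : ℝ) 1) (hC : 400 ≤ C₀) (hT : 2 ≤ T)
  (hP : IsPhasing μ T J ε) (hG : GoodOutcome μ T J ε C₀ ω) {star : ℕ → Fin K}
  (hstar : ∀ r, 1 ≤ r → r ≤ T → ∀ a, μ r a - μ r (star (J r)) ≤ 2 * ε)

theorem twenty_le_sqrt (hC : 400 ≤ C₀) : 20 ≤ √C₀ :=
  Real.le_sqrt_of_sq_le (by norm_num; exact hC)

include hμ hC hT hP hG hstar

/-- A near-optimal arm is not evicted on account of an interval in its phase in which it is always a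
candidate. -/
theorem sum_runEstimate_safe_le {s₁ s₂ : ℕ} (h1 : 1 ≤ s₁) (h12 : s₁ < s₂) (h2 : s₂ ≤ T)
    (hJ : J s₁ = J s₂) (hmem : ∀ s, s₁ ≤ s → s ≤ s₂ → star (J s₁) ∈ armsAt C₀ T ω s)
    (a' : Fin K) : ∑ s ∈ Finset.Icc s₁ s₂, runEstimate C₀ T ω s a' (star (J s₁)) ≤
      Real.log T * (√C₀ * devScale K (s₂ - s₁)) := by
  have hJs : ∀ s, s₁ ≤ s → s ≤ s₂ → J s = J s₁ := fun s h h' =>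
    le_antisymm ((hP.mono h').trans hJ.ge) (hP.mono h)
  have hc := hG.concentration s₁ s₂ h1 h12 h2 a' (star (J s₁))
  rw [Finset.sum_sub_distrib] at hc
  have hM : ∑ s ∈ Finset.Icc s₁ s₂, meanEstimate (μ s) (armsAt C₀ T ω s) a' (star (J s₁)) ≤
      ∑ s ∈ Finset.Icc s₁ s₂, 2 * ε := by
    refine Finset.sum_le_sum fun s hs => ?_
    rw [Finset.mem_Icc] at hs
    unfold meanEstimate
    rw [if_pos (hmem s hs.1 hs.2)]
    -- an arm that is not a candidate counts as an arm with mean reward `0`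
    have := hstar s (h1.trans hs.1) (hs.2.trans h2) a'
    rw [hJs s hs.1 hs.2] at this
    have := (hμ s (star (J s₁))).1
    have := hP.pos
    split_ifs <;> linarith
  rw [Finset.sum_const, Nat.card_Icc, nsmul_eq_mul] at hM
  have hsh := hP.short s₁ s₂ h1 h12.le h2 hJ
  have hsc := sqrt_le_devScale K (s₂ - s₁)
  have hn : ((s₂ + 1 - s₁ : ℕ) : ℝ) ≤ 2 * ((s₂ - s₁ : ℕ) : ℝ) := by
    have : s₂ + 1 - s₁ ≤ 2 * (s₂ - s₁) := by omega
    exact_mod_cast this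
  have h20 := twenty_le_sqrt hC
  have hlg := two_thirds_le_log hT
  have hd : 0 ≤ devScale K (s₂ - s₁) := Real.sqrt_nonneg _
  have hε := hP.pos
  have e1 : ((s₂ + 1 - s₁ : ℕ) : ℝ) * (2 * ε) ≤ 4 * devScale K (s₂ - s₁) := by
    nlinarith
  -- `20 ≤ √C₀` leaves room for the bias `6` on top of the fluctuations `14`
  have e2 : 4 * devScale K (s₂ - s₁) ≤ 6 * (Real.log T * devScale K (s₂ - s₁)) := by nlinarith
  have e3 : 20 * (Real.log T * devScale K (s₂ - s₁)) ≤
      √C₀ * (Real.log T * devScale K (s₂ - s₁)) := by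
    apply mul_le_mul_of_nonneg_right h20
    positivity
  linarith

/-- The near-optimal arm of a phase is a candidate of every instance started in the phase. -/
theorem safe_mem_armsAt {r : ℕ} (hr : 1 ≤ r) (hrT : r ≤ T) (hJ : J (startAt C₀ T ω r) = J r) :
    star (J r) ∈ armsAt C₀ T ω r := by
  induction r using Nat.strong_induction_on with
  | _ r ih =>
    rw [mem_armsAt_iff hr, bad_iff (by linarith)]
    rintro ⟨s₁, s₂, h1, h12, h2, a', h⟩
    have hpos : 1 ≤ startAt C₀ T ω r := (one_le_episodeAt r).trans (episodeAt_le_startAt r)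
    have hJs : ∀ s, startAt C₀ T ω r ≤ s → s ≤ r → J s = J r := fun s h h' =>
      le_antisymm (hP.mono h') (hJ.ge.trans (hP.mono h))
    have hr1 := hJs s₁ h1 (by omega)
    have hr2 := hJs s₂ (by omega) (by omega)
    rw [← hr1] at h
    refine absurd h (not_lt.2 (sum_runEstimate_safe_le hμ hC hT hP hG hstar (by omega) h12
      (by omega) (hr1.trans hr2.symm) (fun s hs hs' => ?_) a'))
    have hss : J s = J r := hJs s (by omega) (by omega)
    rw [hr1, ← hss]
    refine ih s (by omega) (by omega) (by omega) ?_
    have := startAt_le_startAt (C₀ := C₀) (T := T) (ω := ω) (r := s) (r' := r) (by omega) (by omega)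
    have h3 := startAt_le (C₀ := C₀) (T := T) (ω := ω) (r := s) (by omega)
    rw [hJs _ this (by omega), hss]

/-- An episode that ends has left the phase in which it started. -/
theorem phase_lt_of_restart {r : ℕ} (hr : 1 ≤ r) (hrT : r ≤ T)
    (h : episodeAt C₀ T ω (r + 1) ≠ episodeAt C₀ T ω r) : J (episodeAt C₀ T ω r) < J r := by
  have hbad := ((episodeAt_succ hr).resolve_left h).2
  by_contra hlt
  have hJ : J (episodeAt C₀ T ω r) = J r :=
    le_antisymm (hP.mono (episodeAt_le hr)) (not_lt.1 hlt)
  have hJs : ∀ s, episodeAt C₀ T ω r ≤ s → s ≤ r → J s = J r := fun s h h' =>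
    le_antisymm (hP.mono h') (hJ.ge.trans (hP.mono h))
  obtain ⟨s₁, s₂, h1, h12, h2, a', hlt⟩ := (bad_iff (by linarith)).1 (hbad (star (J r)))
  have hpos : 1 ≤ episodeAt C₀ T ω r := one_le_episodeAt r
  have hr1 := hJs s₁ h1 (by omega)
  have hr2 := hJs s₂ (by omega) (by omega)
  rw [← hr1] at hlt
  refine absurd hlt (not_lt.2 (sum_runEstimate_safe_le hμ hC hT hP hG hstar (by omega) h12
    (by omega) (hr1.trans hr2.symm) (fun s hs hs' => ?_) a'))
  have hss : J s = J r := hJs s (by omega) (by omega)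
  rw [hr1, ← hss]
  refine safe_mem_armsAt hμ hC hT hP hG hstar (by omega) (by omega) ?_
  have he := episodeAt_eq_of_le (C₀ := C₀) (T := T) (ω := ω) (r := s) (r' := r) (by omega)
    (by omega) (by omega)
  have h3 := episodeAt_le_startAt (C₀ := C₀) (T := T) (ω := ω) s
  rw [hJs _ (he ▸ h3) ((startAt_le (by omega)).trans (by omega)), hss]

/-- Different episodes start in different phases. -/
theorem episodeAt_eq_of_phase_eq {r r' : ℕ} (hr : 1 ≤ r) (hrr : r ≤ r') (hrT : r' ≤ T)
    (h : J (episodeAt C₀ T ω r) = J (episodeAt C₀ T ω r')) :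
    episodeAt C₀ T ω r = episodeAt C₀ T ω r' := by
  by_contra hne
  have hlt : r < episodeAt C₀ T ω r' := by
    by_contra hle
    exact hne (episodeAt_eq_of_le hr (not_lt.1 hle) hrr)
  obtain ⟨n, hn⟩ : ∃ n, episodeAt C₀ T ω r' = n + 1 := ⟨episodeAt C₀ T ω r' - 1, by omega⟩
  have hle' := episodeAt_le (C₀ := C₀) (T := T) (ω := ω) (r := r') (by omega)
  have h1 : episodeAt C₀ T ω (n + 1) = n + 1 := by
    rw [← hn]
    exact (episodeAt_eq_of_le (by omega) le_rfl hle')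
  have h2 := episodeAt_le (C₀ := C₀) (T := T) (ω := ω) (r := n) (by omega)
  have h3 := phase_lt_of_restart hμ hC hT hP hG hstar (r := n) (by omega) (by omega) (by omega)
  have h4 : J n ≤ J (n + 1) := hP.mono (by omega)
  have h5 : J (episodeAt C₀ T ω r) ≤ J (episodeAt C₀ T ω n) :=
    hP.mono (episodeAt_mono hr (by omega))
  rw [hn] at h
  omega

omit hμ hC hT hP hG hstar in
/-- In every episode some arm survives in all candidate sets up to the last check of the master set;
the rounds since then all start a replay, since a replay that starts takes the place of the
check. -/
theorem exists_anchor {r : ℕ} (hr : 1 ≤ r) :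
    ∃ t x, episodeAt C₀ T ω r ≤ t ∧ t ≤ r ∧ ¬ Bad C₀ T ω (episodeAt C₀ T ω r) t x ∧
      ∀ r', t < r' → r' ≤ r → startAt C₀ T ω r' = r' := by
  induction r, hr using Nat.le_induction with
  | base =>
    have h1 := one_le_episodeAt (C₀ := C₀) (T := T) (ω := ω) 1
    have h2 := episodeAt_le (C₀ := C₀) (T := T) (ω := ω) (r := 1) le_rfl
    exact ⟨1, 0, h2, le_rfl, not_bad_of_le (by omega) _, fun r' h h' => by omega⟩
  | succ r hr ih =>
    by_cases he : episodeAt C₀ T ω (r + 1) = episodeAt C₀ T ω r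
    · rw [he]
      have hle := episodeAt_le (C₀ := C₀) (T := T) (ω := ω) hr
      rcases startAt_succ_or_exists_not_bad hr he with h | ⟨a, ha⟩
      · obtain ⟨t, x, h1, h2, h3, h4⟩ := ih
        refine ⟨t, x, h1, by omega, h3, fun r' h5 h6 => ?_⟩
        rcases Nat.lt_or_ge r r' with h7 | h7
        · obtain rfl : r' = r + 1 := by omega
          exact h
        · exact h4 r' h5 h7
      · exact ⟨r + 1, a, by omega, le_rfl, ha, fun r' h h' => by omega⟩
    · have h := ((episodeAt_succ hr).resolve_left he).1
      rw [h]
      exact ⟨r + 1, 0, le_rfl, le_rfl, not_bad_of_le (by omega) _, fun r' h h' => by omega⟩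

omit hμ hC hT hP hG hstar in
/-- An arm that is not bad on the interval from the start of the episode is a candidate
throughout. -/
theorem mem_armsAt_of_not_bad {r t : ℕ} {x : Fin K} (hr : 1 ≤ r) (hrt : r ≤ t)
    (hx : ¬ Bad C₀ T ω (episodeAt C₀ T ω r) t x) : x ∈ armsAt C₀ T ω r := by
  rw [mem_armsAt_iff hr]
  exact fun h => hx (h.mono (episodeAt_le_startAt r) hrt)

omit hstar in
/-- A candidate arm `a` of an instance that has been running for `n` rounds in the present phase has
a gap of order at most `ε + √(K / n)` relative to an arm `x` that is not evicted in the episode up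
to round `t`. -/
theorem candidate_gap_le {r t u : ℕ} {x a : Fin K} (hr : 1 ≤ r) (hrT : r ≤ T) (hrt : r ≤ t)
    (hx : ¬ Bad C₀ T ω (episodeAt C₀ T ω r) t x) (ha : a ∈ armsAt C₀ T ω r)
    (hu : startAt C₀ T ω r ≤ u) (hur : u ≤ r) (hJ : J u = J r) :
    μ r x - μ r a ≤ 2 * ε + 2 * (√C₀ + 14) * Real.log T * √(K : ℝ) *
      (1 / √(((r - u : ℕ) : ℝ) + 1)) := by
  have h20 := twenty_le_sqrt hC
  have hlg := two_thirds_le_log hT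
  have hε := hP.pos
  have hK : (1 : ℝ) ≤ K := by exact_mod_cast NeZero.one_le
  have hpos : 1 ≤ startAt C₀ T ω r := (one_le_episodeAt r).trans (episodeAt_le_startAt r)
  set D := √C₀ + 14 with hD
  set n := r - u with hn
  have hn1 : 0 < √((n : ℝ) + 1) := Real.sqrt_pos.2 (by positivity)
  have hDlg : 2 ≤ D * Real.log T := by nlinarith
  have htriv : μ r x - μ r a ≤ 1 := by linarith [(hμ r x).2, (hμ r a).1]
  -- as long as `n + 1 ≤ 2 K`, the claim is weaker than the trivial bound
  by_cases hsmall : n + 1 ≤ 2 * K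
  · have h1 : √((n : ℝ) + 1) ≤ 2 * √(K : ℝ) := by
      rw [show (2 : ℝ) * √(K : ℝ) = √(4 * K) by
        rw [Real.sqrt_mul (by norm_num), show (4 : ℝ) = 2 ^ 2 by norm_num,
          Real.sqrt_sq (by norm_num)]]
      apply Real.sqrt_le_sqrt
      have : (n : ℝ) + 1 ≤ 2 * K := by exact_mod_cast hsmall
      linarith
    have h2 : 1 ≤ 2 * D * Real.log T * √(K : ℝ) * (1 / √((n : ℝ) + 1)) := by
      rw [mul_one_div, le_div_iff₀ hn1]
      nlinarith [Real.sqrt_nonneg (K : ℝ)]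
    linarith
  have hKn : K ≤ n := by omega
  have hn2 : 2 ≤ n := by have := NeZero.one_le (n := K); omega
  have hJs : ∀ s, u ≤ s → s ≤ r → J s = J r := fun s h h' =>
    le_antisymm (hP.mono h') (hJ.ge.trans (hP.mono h))
  rw [mem_armsAt_iff hr, bad_iff (by linarith)] at ha
  push Not at ha
  have hest := ha u (r - 1) hu (by omega) (by omega) x
  have hc := hG.concentration u (r - 1) (by omega) (by omega) (by omega) a x
  rw [Finset.sum_sub_distrib] at hc
  -- the estimates and their means are antisymmetric in the two arms
  have hanti : ∑ s ∈ Finset.Icc u (r - 1), runEstimate C₀ T ω s a x =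
      - ∑ s ∈ Finset.Icc u (r - 1), runEstimate C₀ T ω s x a := by
    rw [← Finset.sum_neg_distrib]
    refine Finset.sum_congr rfl fun s _ => ?_
    unfold runEstimate gapEstimate
    ring
  have hM : ∑ s ∈ Finset.Icc u (r - 1), meanEstimate (μ s) (armsAt C₀ T ω s) a x ≤
      ∑ s ∈ Finset.Icc u (r - 1), (2 * ε - (μ r x - μ r a)) := by
    refine Finset.sum_le_sum fun s hs => ?_
    rw [Finset.mem_Icc] at hs
    have hse : episodeAt C₀ T ω s = episodeAt C₀ T ω r :=
      episodeAt_eq_of_le (by omega) ((episodeAt_le_startAt r).trans (by omega)) (by omega)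
    have hxs : x ∈ armsAt C₀ T ω s :=
      mem_armsAt_of_not_bad (t := t) (by omega) (by omega) (by rwa [hse])
    have has : a ∈ armsAt C₀ T ω s := by
      rw [mem_armsAt_iff (by omega)]
      intro hb
      have h3 := startAt_le_startAt (C₀ := C₀) (T := T) (ω := ω) (r := s) (r' := r)
        (by omega) (by omega)
      obtain ⟨s₁, s₂, g1, g2, g3, a', g4⟩ :=
        (bad_iff (by linarith)).1 (hb.mono h3 (by omega : s ≤ r))
      exact absurd g4 (not_lt.2 (ha s₁ s₂ g1 g2 g3 a'))
    unfold meanEstimate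
    rw [if_pos hxs, if_pos has]
    have e1 := abs_le.1 (hP.close s r (by omega) (by omega) hrT (hJs s hs.1 (by omega)) x)
    have e2 := abs_le.1 (hP.close s r (by omega) (by omega) hrT (hJs s hs.1 (by omega)) a)
    linarith [e1.1, e2.2]
  rw [Finset.sum_const, Nat.card_Icc, nsmul_eq_mul, show r - 1 + 1 - u = n by omega] at hM
  have hmono : devScale K (r - 1 - u) ≤ devScale K n := devScale_mono (by omega)
  rw [devScale_of_le hKn] at hmono
  have hsq : 0 < √(n : ℝ) := Real.sqrt_pos.2 (by exact_mod_cast (by omega : 0 < n))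
  have hnn : √(n : ℝ) * √(n : ℝ) = n := Real.mul_self_sqrt (by positivity)
  have hsK := Real.sqrt_nonneg (K : ℝ)
  have e4 : (n : ℝ) * (μ r x - μ r a - 2 * ε) ≤ D * Real.log T * (√(K : ℝ) * √(n : ℝ)) := by
    have : D * Real.log T * devScale K (r - 1 - u) ≤
        D * Real.log T * (√(K : ℝ) * √(n : ℝ)) :=
      mul_le_mul_of_nonneg_left hmono (by positivity)
    rw [hD] at this ⊢
    linarith
  have e5 : √(n : ℝ) * (μ r x - μ r a - 2 * ε) ≤ D * Real.log T * √(K : ℝ) := by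
    have : √(n : ℝ) * (√(n : ℝ) * (μ r x - μ r a - 2 * ε)) ≤
        √(n : ℝ) * (D * Real.log T * √(K : ℝ)) := by
      rw [← mul_assoc, hnn]; linarith
    exact le_of_mul_le_mul_left this hsq
  have e6 : √((n : ℝ) + 1) ≤ 2 * √(n : ℝ) := by
    rw [show (2 : ℝ) * √(n : ℝ) = √(4 * n) by
        rw [Real.sqrt_mul (by norm_num), show (4 : ℝ) = 2 ^ 2 by norm_num,
          Real.sqrt_sq (by norm_num)]]
    apply Real.sqrt_le_sqrt
    have : (2 : ℝ) ≤ n := by exact_mod_cast hn2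
    linarith
  rcases le_or_gt (μ r x - μ r a - 2 * ε) 0 with h0 | h0
  · have : 0 ≤ 2 * D * Real.log T * √(K : ℝ) * (1 / √((n : ℝ) + 1)) := by positivity
    linarith
  · have : μ r x - μ r a - 2 * ε ≤ 2 * D * Real.log T * √(K : ℝ) * (1 / √((n : ℝ) + 1)) := by
      rw [mul_one_div, le_div_iff₀ hn1]
      nlinarith
    linarith

/-- A replay of length `m` within a phase, in an episode that does not evict arm `x`, bounds the gap
of `x`. -/
theorem gap_le_of_replay {e r t m : ℕ} {x : Fin K} (her : e < r) (htT : t ≤ T)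
    (het : episodeAt C₀ T ω t = e) (hx : ¬ Bad C₀ T ω e t x) (hm : m ∈ replayLengths T)
    (hm0 : 0 < m) (hB : ω.2.2 (e, r, m) = true) (hrm : r + m < t) (hJ : J (r + m) = J r)
    (hgap : 8 * ε ≤ gap μ r x) :
    (m : ℝ) * gap μ r x ≤ 2 * (√C₀ + 14) * Real.log T * devScale K m := by
  have hε := hP.pos
  have he1 : 1 ≤ e := het ▸ one_le_episodeAt t
  have hJs : ∀ s, r ≤ s → s ≤ r + m → J s = J r := fun s h h' =>
    le_antisymm ((hP.mono h').trans hJ.le) (hP.mono h)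
  have hes : ∀ s, e ≤ s → s ≤ t → episodeAt C₀ T ω s = e := fun s h h' =>
    (episodeAt_eq_of_le (by omega) (by rw [het]; omega) h').trans het
  have hest := not_lt.1 fun h => hx ((bad_iff (by linarith)).2 ⟨r, r + m, her.le, by omega, hrm,
    star (J r), h⟩)
  have hc := hG.concentration r (r + m) (by omega) (by omega) (by omega) x (star (J r))
  rw [Finset.sum_sub_distrib] at hc
  have hanti : ∑ s ∈ Finset.Icc r (r + m), runEstimate C₀ T ω s x (star (J r)) =
      - ∑ s ∈ Finset.Icc r (r + m), runEstimate C₀ T ω s (star (J r)) x := by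
    rw [← Finset.sum_neg_distrib]
    refine Finset.sum_congr rfl fun s _ => ?_
    unfold runEstimate gapEstimate
    ring
  have hM : ∑ s ∈ Finset.Icc r (r + m), meanEstimate (μ s) (armsAt C₀ T ω s) x (star (J r)) ≤
      ∑ s ∈ Finset.Icc r (r + m), (- (gap μ r x / 2)) := by
    refine Finset.sum_le_sum fun s hs => ?_
    rw [Finset.mem_Icc] at hs
    have hxs : x ∈ armsAt C₀ T ω s :=
      mem_armsAt_of_not_bad (t := t) (by omega) (by omega) (by rwa [hes s (by omega) (by omega)])
    have hss : star (J r) ∈ armsAt C₀ T ω s := by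
      rw [← hJs s hs.1 hs.2]
      refine safe_mem_armsAt hμ hC hT hP hG hstar (by omega) (by omega) ?_
      have h1 := le_startAt_of_scheduled hm hB (hes s (by omega) (by omega)) her hs.1 hs.2
      have h2 := startAt_le (C₀ := C₀) (T := T) (ω := ω) (r := s) (by omega)
      rw [hJs _ h1 (by omega), hJs s hs.1 hs.2]
    unfold meanEstimate
    rw [if_pos hxs, if_pos hss]
    have e1 := abs_le.1 (hP.close r s (by omega) (by omega) (by omega) (hJs s hs.1 hs.2).symm x)
    have e2 := abs_le.1 (hP.close r s (by omega) (by omega) (by omega) (hJs s hs.1 hs.2).symm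
      (star (J r)))
    obtain ⟨b, hb⟩ := exists_gap_eq (μ := μ) r x
    have e3 := hstar r (by omega) (by omega) b
    linarith [e1.1, e2.2]
  rw [Finset.sum_const, Nat.card_Icc, nsmul_eq_mul, show r + m + 1 - r = m + 1 by omega] at hM
  rw [show r + m - r = m by omega] at hc hest
  push_cast at hM
  linarith [gap_nonneg (μ := μ) r x]

end Deterministic

/-! ### The regret on the good event -/

section DetectionLength

variable {K T : ℕ} {H δ : ℝ}

theorem lt_detectionLength : (H * Real.log T) ^ 2 * K / δ ^ 2 < detectionLength K T H δ := by
  refine (Nat.lt_floor_add_one _).trans_le ?_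
  have : ⌊(H * Real.log T) ^ 2 * K / δ ^ 2⌋₊ + 1 ≤ detectionLength K T H δ :=
    Nat.le_pow_clog (by norm_num) _
  exact_mod_cast this

theorem detectionLength_le (h1 : 1 ≤ (H * Real.log T) ^ 2 * K / δ ^ 2) :
    (detectionLength K T H δ : ℝ) ≤ 4 * ((H * Real.log T) ^ 2 * K / δ ^ 2) := by
  set z := (H * Real.log T) ^ 2 * K / δ ^ 2 with hz
  have hf : 1 ≤ ⌊z⌋₊ := Nat.le_floor (by simpa using h1)
  have hlt : 2 ^ (Nat.clog 2 (⌊z⌋₊ + 1) - 1) < ⌊z⌋₊ + 1 :=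
    Nat.pow_pred_clog_lt_self (by norm_num) (by omega)
  have hpos : 0 < Nat.clog 2 (⌊z⌋₊ + 1) := Nat.clog_pos (by norm_num) (by omega)
  have heq : detectionLength K T H δ = 2 * 2 ^ (Nat.clog 2 (⌊z⌋₊ + 1) - 1) := by
    rw [detectionLength, ← hz, ← pow_succ', Nat.sub_add_cancel hpos]
  have h2 : detectionLength K T H δ ≤ 4 * ⌊z⌋₊ := by omega
  have h3 : (⌊z⌋₊ : ℝ) ≤ z := Nat.floor_le (by linarith)
  have h4 : (detectionLength K T H δ : ℝ) ≤ 4 * ⌊z⌋₊ := by exact_mod_cast h2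
  linarith

theorem detectionLength_mem_replayLengths (h1 : 1 ≤ (H * Real.log T) ^ 2 * K / δ ^ 2)
    (hT : detectionLength K T H δ ≤ T) : detectionLength K T H δ ∈ replayLengths T := by
  refine Finset.mem_image.2 ⟨_, Finset.mem_Icc.2 ⟨?_, ?_⟩, rfl⟩
  · refine Nat.clog_pos (by norm_num) ?_
    have : 1 ≤ ⌊(H * Real.log T) ^ 2 * K / δ ^ 2⌋₊ := Nat.le_floor (by simpa using h1)
    omega
  · rw [← Nat.pow_le_pow_iff_right (a := 2) (by norm_num)]
    exact hT.trans (Nat.le_pow_clog (by norm_num) _)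

theorem two_le_detectionLength (h1 : 1 ≤ (H * Real.log T) ^ 2 * K / δ ^ 2) :
    2 ≤ detectionLength K T H δ := by
  have h := lt_detectionLength (K := K) (T := T) (H := H) (δ := δ)
  have : (1 : ℝ) < detectionLength K T H δ := by linarith
  exact_mod_cast this

end DetectionLength

theorem sqrt_mul_inv_sqrt_le {x y c : ℝ} (hx : 0 < x) (hy : 0 < y) (hc : 0 ≤ c)
    (h : y ≤ c ^ 2 * x) : 1 / √x ≤ c * (1 / √y) := by
  rw [mul_one_div, div_le_div_iff₀ (Real.sqrt_pos.2 hx) (Real.sqrt_pos.2 hy), one_mul]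
  rw [← Real.sqrt_sq hc, ← Real.sqrt_mul (sq_nonneg c)]
  exact Real.sqrt_le_sqrt h

section Deterministic

variable {K : ℕ} [NeZero K] {μ : ℕ → Fin K → ℝ} {T : ℕ} {J : ℕ → ℕ} {ε C₀ : ℝ} {ω : Outcome K}

/-- The index that separates both the phases and the episodes. -/
def blockIndex (J : ℕ → ℕ) (C₀ : ℝ) (T : ℕ) (ω : Outcome K) (r : ℕ) : ℕ :=
  J (episodeAt C₀ T ω r) + J r

variable (hμ : ∀ r a, μ r a ∈ Set.Icc (0 : ℝ) 1) (hC : 400 ≤ C₀) (hT : 2 ≤ T)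
  (hP : IsPhasing μ T J ε) (hG : GoodOutcome μ T J ε C₀ ω) {star : ℕ → Fin K}
  (hstar : ∀ r, 1 ≤ r → r ≤ T → ∀ a, μ r a - μ r (star (J r)) ≤ 2 * ε)

include hμ hC hT hP hG hstar

/-- Rounds with the same block index lie in the same episode and in the same phase, as the index is
a sum of two monotone terms. -/
theorem blockIndex_eq {r r' : ℕ} (hr : 1 ≤ r) (hrr : r ≤ r') (hrT : r' ≤ T)
    (h : blockIndex J C₀ T ω r = blockIndex J C₀ T ω r') :
    episodeAt C₀ T ω r = episodeAt C₀ T ω r' ∧ J r = J r' := by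
  have h1 : J (episodeAt C₀ T ω r) ≤ J (episodeAt C₀ T ω r') := hP.mono (episodeAt_mono hr hrr)
  have h2 : J r ≤ J r' := hP.mono hrr
  unfold blockIndex at h
  exact ⟨episodeAt_eq_of_phase_eq hμ hC hT hP hG hstar hr hrr hrT (by omega), by omega⟩

/-- The gap of any arm at round `r` is of order `ε`, or the detection length exceeds the number of
rounds left before `t` or in the block, or `r` is a detection round; in the last three cases the gap
is of order `√K / √m` for the detection length `m`. -/
theorem anchor_gap_le {e r t : ℕ} {x : Fin K} (her : e < r) (hrt : r ≤ t) (htT : t ≤ T)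
    (het : episodeAt C₀ T ω t = e) :
    gap μ r x ≤ 8 * ε + 4 * (√C₀ + 14) * Real.log T * √(K : ℝ) *
      (1 / √(((blockLast T (blockIndex J C₀ T ω) r - r : ℕ) : ℝ) + 1) +
        2 * (1 / √(((t - r : ℕ) : ℝ) + 1)) +
        if r ∈ detectionRounds μ T J ε (2 * (√C₀ + 14)) e t x then
          1 / √(detectionLength K T (2 * (√C₀ + 14)) (gap μ r x) : ℝ) else 0) := by
  have hε := hP.pos
  have h20 := twenty_le_sqrt hC
  have hlg := two_thirds_le_log hT
  have hK : (1 : ℝ) ≤ K := by exact_mod_cast NeZero.one_le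
  have he1 : 1 ≤ e := het ▸ one_le_episodeAt t
  set H := 2 * (√C₀ + 14) with hH
  set δ := gap μ r x with hδ
  set m := detectionLength K T H δ with hm
  have hf0 : 0 ≤ 1 / √(((blockLast T (blockIndex J C₀ T ω) r - r : ℕ) : ℝ) + 1) := by positivity
  have ht0 : 0 ≤ 1 / √(((t - r : ℕ) : ℝ) + 1) := by positivity
  have hU0 : 0 ≤ if r ∈ detectionRounds μ T J ε H e t x then 1 / √(m : ℝ) else 0 := by
    split_ifs <;> positivity
  have hG0 : 0 ≤ 4 * (√C₀ + 14) * Real.log T * √(K : ℝ) := by positivity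
  rcases lt_or_ge δ (8 * ε) with hsmall | hbig
  · have : 0 ≤ 4 * (√C₀ + 14) * Real.log T * √(K : ℝ) *
      (1 / √(((blockLast T (blockIndex J C₀ T ω) r - r : ℕ) : ℝ) + 1) +
        2 * (1 / √(((t - r : ℕ) : ℝ) + 1)) +
        if r ∈ detectionRounds μ T J ε H e t x then 1 / √(m : ℝ) else 0) := by positivity
    linarith
  have hδ0 : 0 < δ := by linarith
  have hδ1 : δ ≤ 1 := gap_le_one hμ r x
  have hHl : 1 ≤ H * Real.log T := by nlinarith
  have hz1 : (K : ℝ) ≤ (H * Real.log T) ^ 2 * K / δ ^ 2 := by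
    rw [le_div_iff₀ (by positivity)]
    have : δ ^ 2 ≤ 1 := by nlinarith
    have : 1 ≤ (H * Real.log T) ^ 2 := by nlinarith
    nlinarith
  have hz : 1 ≤ (H * Real.log T) ^ 2 * K / δ ^ 2 := hK.trans hz1
  have hm2 : 2 ≤ m := two_le_detectionLength hz
  have hm0 : (0 : ℝ) < m := by exact_mod_cast (by omega : 0 < m)
  -- the detection length is comparable to `(H log T)² K / δ²`
  have hbound : δ ≤ 4 * (√C₀ + 14) * Real.log T * √(K : ℝ) * (1 / √(m : ℝ)) := by
    have h1 : (m : ℝ) ≤ 4 * ((H * Real.log T) ^ 2 * K / δ ^ 2) := detectionLength_le hz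
    have h2 : (m : ℝ) * δ ^ 2 ≤ 4 * ((H * Real.log T) ^ 2 * K) := by
      have : 4 * ((H * Real.log T) ^ 2 * K / δ ^ 2) * δ ^ 2 = 4 * ((H * Real.log T) ^ 2 * K) := by
        field_simp
      nlinarith [sq_nonneg δ]
    rw [mul_one_div, le_div_iff₀ (Real.sqrt_pos.2 hm0)]
    apply le_of_sq_le_sq _ hG0
    rw [mul_pow, Real.sq_sqrt hm0.le, mul_pow (4 * (√C₀ + 14) * Real.log T),
      Real.sq_sqrt (by positivity)]
    rw [hH] at h2
    nlinarith
  have hmul : ∀ {a b : ℝ}, a ≤ b → 4 * (√C₀ + 14) * Real.log T * √(K : ℝ) * a ≤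
      4 * (√C₀ + 14) * Real.log T * √(K : ℝ) * b := fun h => mul_le_mul_of_nonneg_left h hG0
  suffices h : 1 / √(m : ℝ) ≤ 1 / √(((blockLast T (blockIndex J C₀ T ω) r - r : ℕ) : ℝ) + 1) +
        2 * (1 / √(((t - r : ℕ) : ℝ) + 1)) +
        if r ∈ detectionRounds μ T J ε H e t x then 1 / √(m : ℝ) else 0 by
    have := hmul h
    linarith
  by_cases hrm : r + m < t
  · by_cases hJ : J (r + m) = J r
    · have hU : r ∈ detectionRounds μ T J ε H e t x :=
        Finset.mem_filter.2 ⟨Finset.mem_Ioc.2 ⟨her, hrt⟩, hbig, hrm, hJ⟩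
      rw [if_pos hU]
      linarith
    · -- the block of `r` ends before round `r + m`
      have hlast := blockLast_mem (T := T) (κ := blockIndex J C₀ T ω) (r := r) (by omega) (by omega)
      have hlt : blockLast T (blockIndex J C₀ T ω) r < r + m := by
        by_contra hge
        have hrl := le_blockLast (T := T) (κ := blockIndex J C₀ T ω) (r := r) (by omega)
          (by omega) rfl
        have h1 := (blockIndex_eq hμ hC hT hP hG hstar (by omega) hrl hlast.1 hlast.2.symm).2
        have h2 : J r ≤ J (r + m) := hP.mono (by omega)
        have h3 : J (r + m) ≤ J (blockLast T (blockIndex J C₀ T ω) r) := hP.mono (by omega)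
        omega
      have : 1 / √(m : ℝ) ≤
          1 / √(((blockLast T (blockIndex J C₀ T ω) r - r : ℕ) : ℝ) + 1) := by
        apply one_div_le_one_div_of_le (Real.sqrt_pos.2 (by positivity))
        apply Real.sqrt_le_sqrt
        have : blockLast T (blockIndex J C₀ T ω) r - r + 1 ≤ m := by omega
        exact_mod_cast this
      linarith
  · have : 1 / √(m : ℝ) ≤ 2 * (1 / √(((t - r : ℕ) : ℝ) + 1)) := by
      apply sqrt_mul_inv_sqrt_le hm0 (by positivity) (by norm_num)
      have : t - r + 1 ≤ 4 * m := by omega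
      have : ((t - r : ℕ) : ℝ) + 1 ≤ 4 * m := by exact_mod_cast this
      linarith
    linarith

/-- The detection rounds of an arm `x` that survives until round `t` have little weight: otherwise a
replay of the detection length would have been scheduled at one of them and would have evicted
`x`. -/
theorem sum_detectionRounds_le {e t : ℕ} {x : Fin K} (het' : e ≤ t) (htT : t ≤ T)
    (het : episodeAt C₀ T ω t = e) (hx : ¬ Bad C₀ T ω e t x) :
    ∑ u ∈ detectionRounds μ T J ε (2 * (√C₀ + 14)) e t x,
      1 / √(detectionLength K T (2 * (√C₀ + 14)) (gap μ u x) : ℝ) ≤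
        6 * Real.log T * √((t - e : ℕ) : ℝ) := by
  have hε := hP.pos
  have h20 := twenty_le_sqrt hC
  have hlg := two_thirds_le_log hT
  have hK : (1 : ℝ) ≤ K := by exact_mod_cast NeZero.one_le
  have he1 : 1 ≤ e := het ▸ one_le_episodeAt t
  set H := 2 * (√C₀ + 14) with hH
  have hlt : ∑ u ∈ detectionRounds μ T J ε H e t x,
      (replayProb e u (detectionLength K T H (gap μ u x)) : ℝ) < 6 * Real.log T := by
    by_contra hge
    obtain ⟨u, hu, hB⟩ := hG.detection e t he1 het' htT x (not_lt.1 hge)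
    obtain ⟨hu1, hu2, hu3, hu4⟩ := Finset.mem_filter.1 hu
    rw [Finset.mem_Ioc] at hu1
    rw [← hH] at hB
    have hδ0 : 0 < gap μ u x := by linarith
    have hδ1 : gap μ u x ≤ 1 := gap_le_one hμ u x
    set δ := gap μ u x with hδ
    have hHl : 1 ≤ H * Real.log T := by nlinarith
    have hz1 : (K : ℝ) ≤ (H * Real.log T) ^ 2 * K / δ ^ 2 := by
      rw [le_div_iff₀ (by positivity)]
      have : δ ^ 2 ≤ 1 := by nlinarith
      have : 1 ≤ (H * Real.log T) ^ 2 := by nlinarith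
      nlinarith
    have hz : 1 ≤ (H * Real.log T) ^ 2 * K / δ ^ 2 := hK.trans hz1
    have hlt := lt_detectionLength (K := K) (T := T) (H := H) (δ := δ)
    set m := detectionLength K T H δ with hm
    have hm2 : 2 ≤ m := two_le_detectionLength hz
    have hKm : K ≤ m := by
      have : (K : ℝ) < m := hz1.trans_lt hlt
      exact_mod_cast this.le
    have h := gap_le_of_replay hμ hC hT hP hG hstar hu1.1 htT het hx
      (detectionLength_mem_replayLengths hz (by omega)) (by omega) hB hu3 hu4 hu2
    rw [← hδ, ← hm, devScale_of_le hKm, ← hH] at h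
    have hm0 : (0 : ℝ) < m := by exact_mod_cast (by omega : 0 < m)
    have hsm : √(m : ℝ) * √(m : ℝ) = m := Real.mul_self_sqrt hm0.le
    have hsp : 0 < √(m : ℝ) := Real.sqrt_pos.2 hm0
    have h5 : √(m : ℝ) * δ ≤ H * Real.log T * √(K : ℝ) := by
      refine le_of_mul_le_mul_left ?_ hsp
      rw [← mul_assoc, hsm]
      linarith
    have h6 : (m : ℝ) * δ ^ 2 ≤ (H * Real.log T) ^ 2 * K := by
      have := pow_le_pow_left₀ (by positivity) h5 2
      rwa [mul_pow, mul_pow (H * Real.log T), Real.sq_sqrt hm0.le,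
        Real.sq_sqrt (by positivity)] at this
    rw [div_lt_iff₀ (by positivity)] at hlt
    linarith
  have hD0 : 0 ≤ √((t - e : ℕ) : ℝ) := Real.sqrt_nonneg _
  calc _ ≤ ∑ u ∈ detectionRounds μ T J ε H e t x,
        (replayProb e u (detectionLength K T H (gap μ u x)) : ℝ) * √((t - e : ℕ) : ℝ) := by
        refine Finset.sum_le_sum fun u hu => ?_
        have hu1 := Finset.mem_Ioc.1 (Finset.mem_filter.1 hu).1
        have hm0 : (0 : ℝ) < detectionLength K T H (gap μ u x) := by
          unfold detectionLength; positivity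
        have hue : (0 : ℝ) < ((u - e : ℕ) : ℝ) := by exact_mod_cast (by omega : 0 < u - e)
        have hle : √((u - e : ℕ) : ℝ) ≤ √((t - e : ℕ) : ℝ) :=
          Real.sqrt_le_sqrt (by exact_mod_cast (by omega : u - e ≤ t - e))
        simp only [replayProb]
        rw [Real.sqrt_mul hm0.le, one_div_mul_eq_div, le_div_iff₀ (by positivity),
          one_div_mul_eq_div, div_le_iff₀ (by positivity)]
        nlinarith [Real.sqrt_nonneg (detectionLength K T H (gap μ u x) : ℝ)]
    _ ≤ _ := by
        rw [← Finset.sum_mul]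
        exact mul_le_mul_of_nonneg_right hlt.le hD0

end Deterministic

section Deterministic

variable {K : ℕ} [NeZero K] {μ : ℕ → Fin K → ℝ} {T : ℕ} {J : ℕ → ℕ} {ε C₀ : ℝ} {ω : Outcome K}

/-- The part of the regret bound for round `r` that is due to a replay. -/
def replayTerm (C₀ : ℝ) (T : ℕ) (ω : Outcome K) (r : ℕ) : ℝ :=
  if episodeAt C₀ T ω r < startAt C₀ T ω r then
    1 / √(((r - startAt C₀ T ω r : ℕ) : ℝ) + 1) else 0

/-- The part of the regret bound for round `r` that is due to the ends of its block. -/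
def blockTerm (J : ℕ → ℕ) (C₀ : ℝ) (T : ℕ) (ω : Outcome K) (r : ℕ) : ℝ :=
  1 / √(((r - blockFirst (blockIndex J C₀ T ω) r : ℕ) : ℝ) + 1) +
    1 / √(((blockLast T (blockIndex J C₀ T ω) r - r : ℕ) : ℝ) + 1)

/-- A round of a replay is charged to the scheduled variable that started the replay; all scheduled
replays are counted, whether or not they were run in full. -/
theorem sum_replayTerm_le (hG : GoodOutcome μ T J ε C₀ ω) {e l : ℕ} (he : 1 ≤ e) (hel : e ≤ l)
    (hlT : l ≤ T) (hep : ∀ r ∈ Finset.Icc e l, episodeAt C₀ T ω r = e) :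
    ∑ r ∈ Finset.Icc e l, replayTerm C₀ T ω r ≤ 50 * Real.log T * √((l - e : ℕ) : ℝ) := by
  refine le_trans ?_ (hG.replays e l he hel hlT)
  have key : ∀ r ∈ Finset.Icc e l, replayTerm C₀ T ω r ≤
      ∑ s ∈ Finset.Ioc e l, ∑ m ∈ replayLengths T, (if ω.2.2 (e, s, m) = true then
        if s ≤ r ∧ r ≤ s + m then 1 / √(((r - s : ℕ) : ℝ) + 1) else 0 else 0) := by
    intro r hr
    have hr' := Finset.mem_Icc.1 hr
    have hnn : ∀ s ∈ Finset.Ioc e l, ∀ m ∈ replayLengths T,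
        0 ≤ (if ω.2.2 (e, s, m) = true then
          if s ≤ r ∧ r ≤ s + m then 1 / √(((r - s : ℕ) : ℝ) + 1) else 0 else 0) := by
      intro s _ m _
      split_ifs <;> positivity
    have hnn' : ∀ s ∈ Finset.Ioc e l, 0 ≤ ∑ m ∈ replayLengths T,
        (if ω.2.2 (e, s, m) = true then
          if s ≤ r ∧ r ≤ s + m then 1 / √(((r - s : ℕ) : ℝ) + 1) else 0 else 0) :=
      fun s hs => Finset.sum_nonneg (hnn s hs)
    unfold replayTerm
    split_ifs with h
    · obtain ⟨m, hm, hB, hrm⟩ := exists_scheduled_of_lt (by omega) h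
      rw [hep r hr] at h hB
      have hsr := startAt_le (C₀ := C₀) (T := T) (ω := ω) (r := r) (by omega)
      have hs : startAt C₀ T ω r ∈ Finset.Ioc e l := Finset.mem_Ioc.2 ⟨h, by omega⟩
      refine le_trans ?_ (Finset.single_le_sum hnn' hs)
      refine le_trans ?_ (Finset.single_le_sum (hnn _ hs) hm)
      rw [if_pos hB, if_pos ⟨hsr, hrm⟩]
    · exact Finset.sum_nonneg hnn'
  refine (Finset.sum_le_sum key).trans (le_of_eq ?_)
  rw [Finset.sum_comm]
  refine Finset.sum_congr rfl fun s hs => ?_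
  rw [Finset.sum_comm]
  refine Finset.sum_congr rfl fun m _ => ?_
  split_ifs with h
  · rw [replayCost, ← Finset.sum_filter]
    refine Finset.sum_congr ?_ fun _ _ => rfl
    ext r
    rw [Finset.mem_Ioc] at hs
    simp only [Finset.mem_filter, Finset.mem_Icc]
    omega
  · simp

variable (hμ : ∀ r a, μ r a ∈ Set.Icc (0 : ℝ) 1) (hC : 400 ≤ C₀) (hT : 2 ≤ T)
  (hP : IsPhasing μ T J ε) (hG : GoodOutcome μ T J ε C₀ ω) {star : ℕ → Fin K}
  (hstar : ∀ r, 1 ≤ r → r ≤ T → ∀ a, μ r a - μ r (star (J r)) ≤ 2 * ε)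

include hμ hC hT hP hG hstar

/-- The regret of an episode on the good event. -/
theorem episode_regret_le {e l : ℕ} (he : 1 ≤ e) (hel : e ≤ l) (hlT : l ≤ T)
    (hep : ∀ r ∈ Finset.Icc e l, episodeAt C₀ T ω r = e) :
    ∑ r ∈ Finset.Icc e l, gap μ r (armDrawn C₀ T ω r) ≤
      ∑ r ∈ Finset.Icc e l, (10 * ε +
        4 * (√C₀ + 14) * Real.log T * √(K : ℝ) * blockTerm J C₀ T ω r) +
      4 * (√C₀ + 14) * Real.log T * √(K : ℝ) *
        (62 * Real.log T * √((Finset.Icc e l).card : ℝ)) := by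
  have hε := hP.pos
  have h20 := twenty_le_sqrt hC
  have hlg := two_thirds_le_log hT
  have hK : (1 : ℝ) ≤ K := by exact_mod_cast NeZero.one_le
  have hsK : 1 ≤ √(K : ℝ) := Real.one_le_sqrt.2 hK
  have hepl : episodeAt C₀ T ω l = e := hep l (Finset.mem_Icc.2 ⟨hel, le_rfl⟩)
  obtain ⟨t, x, het, htl, hx, hlate⟩ := exists_anchor (C₀ := C₀) (T := T) (ω := ω) (r := l)
    (by omega)
  rw [hepl] at het hx
  have hept : episodeAt C₀ T ω t = e := hep t (Finset.mem_Icc.2 ⟨het, htl⟩)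
  set H := 2 * (√C₀ + 14) with hH
  set G := 4 * (√C₀ + 14) * Real.log T * √(K : ℝ) with hGdef
  have hG2 : 2 ≤ 2 * (√C₀ + 14) * Real.log T * √(K : ℝ) := by
    have : 2 ≤ 2 * (√C₀ + 14) * Real.log T := by nlinarith
    nlinarith
  have hG0 : 2 ≤ G := by rw [hGdef]; linarith
  set late : ℕ → ℝ := fun r => if r ≤ t then 2 * (1 / √(((t - r : ℕ) : ℝ) + 1)) else 0
    with hlatedef
  set det : ℕ → ℝ := fun r => if r ∈ detectionRounds μ T J ε H e t x then
    1 / √(detectionLength K T H (gap μ r x) : ℝ) else 0 with hdetdef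
  have hlate0 : ∀ r, 0 ≤ late r := fun r => by rw [hlatedef]; dsimp only; split_ifs <;> positivity
  have hdet0 : ∀ r, 0 ≤ det r := fun r => by rw [hdetdef]; dsimp only; split_ifs <;> positivity
  have hrep0 : ∀ r, 0 ≤ replayTerm C₀ T ω r := fun r => by
    unfold replayTerm; split_ifs <;> positivity
  have hblk0 : ∀ r, 0 ≤ blockTerm J C₀ T ω r := fun r => by unfold blockTerm; positivity
  have point : ∀ r ∈ Finset.Icc e l, gap μ r (armDrawn C₀ T ω r) ≤
      10 * ε + G * blockTerm J C₀ T ω r + G * (replayTerm C₀ T ω r + late r + det r) := by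
    intro r hr
    have hepr := hep r hr
    rw [Finset.mem_Icc] at hr
    have hle1 : gap μ r (armDrawn C₀ T ω r) ≤ 1 := gap_le_one hμ r _
    rcases lt_or_ge t r with htr | htr
    · -- the first round of a replay is charged to the replay, by the trivial bound
      have hs := hlate r htr hr.2
      have hrt : replayTerm C₀ T ω r = 1 := by
        unfold replayTerm
        rw [hs, if_pos (by omega)]
        simp
      have h1 := hblk0 r
      have h2 := hlate0 r
      have h3 := hdet0 r
      rw [hrt]
      have : 0 ≤ G * blockTerm J C₀ T ω r := by positivity
      have : G * 1 ≤ G * (1 + late r + det r) := by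
        apply mul_le_mul_of_nonneg_left _ (by linarith)
        linarith
      linarith
    · have hxr : x ∈ armsAt C₀ T ω r :=
        mem_armsAt_of_not_bad (t := t) (by omega) htr (by rwa [hepr])
      have ha : armDrawn C₀ T ω r ∈ armsAt C₀ T ω r := hG.drawn _ _ ⟨x, hxr⟩
      have hbf := blockFirst_mem (κ := blockIndex J C₀ T ω) (r := r) (by omega)
      have hbr := blockFirst_le (κ := blockIndex J C₀ T ω) (r := r) (r' := r) (by omega) rfl
      obtain ⟨hb1, hb2⟩ := blockIndex_eq hμ hC hT hP hG hstar hbf.1 hbr (by omega) hbf.2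
      have hb3 : e ≤ blockFirst (blockIndex J C₀ T ω) r := by
        rw [← hepr, ← hb1]; exact episodeAt_le hbf.1
      have hes := episodeAt_le_startAt (C₀ := C₀) (T := T) (ω := ω) r
      have hsr := startAt_le (C₀ := C₀) (T := T) (ω := ω) (r := r) (by omega)
      set b := blockFirst (blockIndex J C₀ T ω) r with hb
      -- the arm drawn against the anchor
      have hcand : μ r x - μ r (armDrawn C₀ T ω r) ≤ 2 * ε + G / 2 *
          (1 / √(((r - b : ℕ) : ℝ) + 1) + replayTerm C₀ T ω r) := by
        have hGh : 2 * (√C₀ + 14) * Real.log T * √(K : ℝ) = G / 2 := by rw [hGdef]; ring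
        rcases le_total (startAt C₀ T ω r) b with h | h
        · have := candidate_gap_le hμ hC hT hP hG (by omega) (by omega) htr
            (by rwa [hepr]) ha h hbr hb2
          rw [hGh] at this
          have : 0 ≤ G / 2 * replayTerm C₀ T ω r := mul_nonneg (by linarith) (hrep0 r)
          linarith
        · have hJs : J (startAt C₀ T ω r) = J r :=
            le_antisymm (hP.mono hsr) (hb2.ge.trans (hP.mono h))
          have := candidate_gap_le hμ hC hT hP hG (by omega) (by omega) htr
            (by rwa [hepr]) ha le_rfl hsr hJs
          rw [hGh] at this
          have h5 : 0 ≤ 1 / √(((r - b : ℕ) : ℝ) + 1) := by positivity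
          have h6 : 1 / √(((r - startAt C₀ T ω r : ℕ) : ℝ) + 1) ≤
              1 / √(((r - b : ℕ) : ℝ) + 1) + replayTerm C₀ T ω r := by
            rcases lt_or_ge e (startAt C₀ T ω r) with h7 | h7
            · have : replayTerm C₀ T ω r = 1 / √(((r - startAt C₀ T ω r : ℕ) : ℝ) + 1) := by
                unfold replayTerm
                rw [if_pos (by omega)]
              linarith
            · have : startAt C₀ T ω r = b := by omega
              rw [this]
              linarith [hrep0 r]
          have := mul_le_mul_of_nonneg_left h6 (by linarith : 0 ≤ G / 2)
          linarith
      -- the anchor against the best arm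
      have hanch : gap μ r x ≤ 8 * ε + G / 2 * (1 / √(((r - b : ℕ) : ℝ) + 1)) +
          G * (1 / √(((blockLast T (blockIndex J C₀ T ω) r - r : ℕ) : ℝ) + 1) +
            late r + det r) := by
        have hl : late r = 2 * (1 / √(((t - r : ℕ) : ℝ) + 1)) := by
          rw [hlatedef]; dsimp only; rw [if_pos htr]
        have h1 : 0 ≤ 1 / √(((r - b : ℕ) : ℝ) + 1) := by positivity
        have h2 : 0 ≤ 1 / √(((blockLast T (blockIndex J C₀ T ω) r - r : ℕ) : ℝ) + 1) := by
          positivity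
        rcases Nat.lt_or_ge e r with her | her
        · have := anchor_gap_le (x := x) hμ hC hT hP hG hstar her htr (by omega) hept
          rw [← hGdef, ← hH, ← hl] at this
          have h3 : 0 ≤ G / 2 * (1 / √(((r - b : ℕ) : ℝ) + 1)) := by positivity
          linarith
        · -- the detection rounds exclude the first round of the episode, which begins a block
          have hrb : r - b = 0 := by omega
          have h3 : 1 / √(((r - b : ℕ) : ℝ) + 1) = 1 := by rw [hrb]; simp
          have h4 := gap_le_one hμ r x
          have h5 : 0 ≤ G * (1 / √(((blockLast T (blockIndex J C₀ T ω) r - r : ℕ) : ℝ) + 1) +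
            late r + det r) := by
            have := hlate0 r
            have := hdet0 r
            positivity
          rw [h3]
          linarith
      have hsplit : gap μ r (armDrawn C₀ T ω r) =
          gap μ r x + (μ r x - μ r (armDrawn C₀ T ω r)) := by unfold gap; ring
      have hbt : blockTerm J C₀ T ω r = 1 / √(((r - b : ℕ) : ℝ) + 1) +
          1 / √(((blockLast T (blockIndex J C₀ T ω) r - r : ℕ) : ℝ) + 1) := rfl
      rw [hsplit, hbt]
      have : 0 ≤ G / 2 * replayTerm C₀ T ω r := mul_nonneg (by linarith) (hrep0 r)
      linarith
  refine (Finset.sum_le_sum point).trans ?_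
  rw [Finset.sum_add_distrib]
  gcongr
  rw [← Finset.mul_sum]
  apply mul_le_mul_of_nonneg_left _ (by linarith)
  rw [Finset.sum_add_distrib, Finset.sum_add_distrib]
  have s1 := sum_replayTerm_le hG he hel hlT hep
  have hcard : (Finset.Icc e l).card = l + 1 - e := Nat.card_Icc _ _
  have s2 : ∑ r ∈ Finset.Icc e l, late r ≤ 6 * Real.log T * √((Finset.Icc e l).card : ℝ) := by
    rw [hlatedef]
    dsimp only
    rw [← Finset.sum_filter, ← Finset.mul_sum]
    have h1 := sum_inv_sqrt_sub_right_le ((Finset.Icc e l).filter fun r => r ≤ t) t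
      fun r hr => (Finset.mem_filter.1 hr).2
    have h2 : √((((Finset.Icc e l).filter fun r => r ≤ t).card : ℝ)) ≤
        √((Finset.Icc e l).card : ℝ) := by
      apply Real.sqrt_le_sqrt
      exact_mod_cast Finset.card_filter_le _ _
    have h3 := Real.sqrt_nonneg ((Finset.Icc e l).card : ℝ)
    nlinarith
  have s3 : ∑ r ∈ Finset.Icc e l, det r ≤ 6 * Real.log T * √((Finset.Icc e l).card : ℝ) := by
    have h1 := sum_detectionRounds_le hμ hC hT hP hG hstar het (htl.trans hlT) hept hx
    rw [hdetdef]
    dsimp only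
    rw [← Finset.sum_filter]
    have h2 : (Finset.Icc e l).filter (fun r => r ∈ detectionRounds μ T J ε H e t x) ⊆
        detectionRounds μ T J ε H e t x := fun r hr => (Finset.mem_filter.1 hr).2
    refine (Finset.sum_le_sum_of_subset_of_nonneg h2 fun _ _ _ => by positivity).trans
      (h1.trans ?_)
    apply mul_le_mul_of_nonneg_left _ (by linarith)
    apply Real.sqrt_le_sqrt
    exact_mod_cast (by omega : t - e ≤ (Finset.Icc e l).card)
  have s4 : √((l - e : ℕ) : ℝ) ≤ √((Finset.Icc e l).card : ℝ) := by
    apply Real.sqrt_le_sqrt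
    exact_mod_cast (by omega : l - e ≤ (Finset.Icc e l).card)
  have s5 : 50 * Real.log T * √((l - e : ℕ) : ℝ) ≤
      50 * Real.log T * √((Finset.Icc e l).card : ℝ) :=
    mul_le_mul_of_nonneg_left s4 (by linarith)
  linarith

omit hstar in
/-- The regret on the good event. -/
theorem good_regret_le :
    ∑ r ∈ Finset.Icc 1 T, gap μ r (armDrawn C₀ T ω r) ≤
      10 * ε * T + 280 * (√C₀ + 14) * Real.log T ^ 2 * √(K * ((2 * J T + 1) * T)) := by
  obtain ⟨star, hstar⟩ := hP.exists_safe
  have hε := hP.pos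
  have h20 := twenty_le_sqrt hC
  have hlg := two_thirds_le_log hT
  set G := 4 * (√C₀ + 14) * Real.log T * √(K : ℝ) with hGdef
  have hG0 : 0 ≤ G := by positivity
  set E := (Finset.Icc 1 T).image (episodeAt C₀ T ω) with hE
  have hmap : ∀ r ∈ Finset.Icc 1 T, episodeAt C₀ T ω r ∈ E := fun r hr =>
    Finset.mem_image_of_mem _ hr
  have hEcard : E.card ≤ J T + 1 := by
    rw [← Finset.card_range (J T + 1)]
    refine Finset.card_le_card_of_injOn J ?_ ?_
    · intro e he
      obtain ⟨r, hr, rfl⟩ := Finset.mem_image.1 he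
      rw [Finset.mem_Icc] at hr
      exact Finset.mem_coe.2 (Finset.mem_range.2
        (Nat.lt_succ_of_le (hP.mono ((episodeAt_le hr.1).trans hr.2))))
    · intro e he e' he' h
      obtain ⟨r, hr, rfl⟩ := Finset.mem_image.1 he
      obtain ⟨r', hr', rfl⟩ := Finset.mem_image.1 he'
      rw [Finset.mem_Icc] at hr hr'
      rcases le_total r r' with h1 | h1
      · exact episodeAt_eq_of_phase_eq hμ hC hT hP hG hstar hr.1 h1 hr'.2 h
      · exact (episodeAt_eq_of_phase_eq hμ hC hT hP hG hstar hr'.1 h1 hr.2 h.symm).symm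
  have hfiber : ∀ e ∈ E, ∃ l, 1 ≤ e ∧ e ≤ l ∧ l ≤ T ∧
      (Finset.Icc 1 T).filter (fun r => episodeAt C₀ T ω r = e) = Finset.Icc e l ∧
      ∀ r ∈ Finset.Icc e l, episodeAt C₀ T ω r = e := by
    intro e he
    obtain ⟨r, hr, rfl⟩ := Finset.mem_image.1 he
    rw [Finset.mem_Icc] at hr
    set e := episodeAt C₀ T ω r with her
    have hl := blockLast_mem (T := T) (κ := episodeAt C₀ T ω) hr.1 hr.2
    have hrl := le_blockLast (κ := episodeAt C₀ T ω) hr.1 hr.2 rfl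
    have h1 : 1 ≤ e := one_le_episodeAt r
    have h2 : e ≤ r := episodeAt_le hr.1
    have h3 : ∀ r' ∈ Finset.Icc e (blockLast T (episodeAt C₀ T ω) r),
        episodeAt C₀ T ω r' = e := by
      intro r' hr'
      rw [Finset.mem_Icc] at hr'
      exact (episodeAt_eq_of_le (by omega) (by rw [hl.2]; omega) hr'.2).trans hl.2
    refine ⟨_, h1, h2.trans hrl, hl.1, ?_, h3⟩
    ext r'
    rw [Finset.mem_filter, Finset.mem_Icc]
    constructor
    · rintro ⟨⟨h4, h5⟩, h6⟩
      exact Finset.mem_Icc.2 ⟨h6 ▸ episodeAt_le h4, le_blockLast h4 h5 h6⟩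
    · intro h4
      have h5 := Finset.mem_Icc.1 h4
      exact ⟨⟨by omega, by omega⟩, h3 r' h4⟩
  have hsum : ∑ r ∈ Finset.Icc 1 T, gap μ r (armDrawn C₀ T ω r) ≤
      ∑ r ∈ Finset.Icc 1 T, (10 * ε + G * blockTerm J C₀ T ω r) +
        G * (62 * Real.log T * √((E.card : ℝ) * T)) := by
    rw [← Finset.sum_fiberwise_of_maps_to hmap,
      ← Finset.sum_fiberwise_of_maps_to hmap (fun r => 10 * ε + G * blockTerm J C₀ T ω r)]
    have hcs := sum_sqrt_card_fiber_le (Finset.Icc 1 T) (episodeAt C₀ T ω) E hmap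
    rw [Nat.card_Icc, Nat.add_sub_cancel] at hcs
    calc _ ≤ ∑ e ∈ E, (∑ r ∈ (Finset.Icc 1 T).filter (fun r => episodeAt C₀ T ω r = e),
            (10 * ε + G * blockTerm J C₀ T ω r) + G * (62 * Real.log T *
            √(((Finset.Icc 1 T).filter fun r => episodeAt C₀ T ω r = e).card : ℝ))) := by
          refine Finset.sum_le_sum fun e he => ?_
          obtain ⟨l, h1, h2, h3, h4, h5⟩ := hfiber e he
          rw [h4]
          exact episode_regret_le hμ hC hT hP hG hstar h1 h2 h3 h5
      _ ≤ _ := by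
          rw [Finset.sum_add_distrib, ← Finset.mul_sum, ← Finset.mul_sum]
          gcongr
  have hblock := sum_block_le T (blockIndex J C₀ T ω) (2 * J T) fun r hr => by
    rw [Finset.mem_Icc] at hr
    have h1 : J (episodeAt C₀ T ω r) ≤ J T := hP.mono ((episodeAt_le hr.1).trans hr.2)
    have h2 : J r ≤ J T := hP.mono hr.2
    unfold blockIndex
    omega
  have hblock' : ∑ r ∈ Finset.Icc 1 T, blockTerm J C₀ T ω r ≤
      4 * √((2 * (J T : ℝ) + 1) * T) := by
    push_cast at hblock
    exact hblock
  rw [Finset.sum_add_distrib, Finset.sum_const, Nat.card_Icc, Nat.add_sub_cancel, nsmul_eq_mul,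
    ← Finset.mul_sum] at hsum
  have h1 : √((E.card : ℝ) * T) ≤ √((2 * (J T : ℝ) + 1) * T) := by
    apply Real.sqrt_le_sqrt
    have : (E.card : ℝ) ≤ J T + 1 := by exact_mod_cast hEcard
    have : (0 : ℝ) ≤ J T := by positivity
    gcongr
    linarith
  rw [Real.sqrt_mul (by positivity)]
  set W := √((2 * (J T : ℝ) + 1) * T) with hW
  have hW0 : 0 ≤ W := Real.sqrt_nonneg _
  have h2 : G * ∑ r ∈ Finset.Icc 1 T, blockTerm J C₀ T ω r ≤ G * (8 * Real.log T * W) := by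
    apply mul_le_mul_of_nonneg_left _ hG0
    nlinarith
  have h3 : G * (62 * Real.log T * √((E.card : ℝ) * T)) ≤ G * (62 * Real.log T * W) := by
    gcongr
  have h4 : G * (8 * Real.log T * W) + G * (62 * Real.log T * W) =
      280 * (√C₀ + 14) * Real.log T ^ 2 * (√(K : ℝ) * W) := by rw [hGdef]; ring
  linarith

end Deterministic

/-! ### Measurability of the run and dependence on the past -/

section Discrete

theorem measurableSet_preimage_of_countable {Ω Z : Type*} [MeasurableSpace Ω] [Countable Z]
    {g : Ω → Z} (hg : ∀ z, MeasurableSet (g ⁻¹' {z})) (A : Set Z) : MeasurableSet (g ⁻¹' A) := by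
  rw [← Set.biUnion_preimage_singleton]
  exact MeasurableSet.biUnion A.to_countable fun z _ => hg z

/-- Composition of a discrete random variable with a family of measurable maps. -/
theorem measurableSet_comp_discrete {Ω S S' : Type*} [MeasurableSpace Ω] {X : Ω → S}
    (hX : ∀ A : Set S, MeasurableSet (X ⁻¹' A)) (hc : (Set.range X).Countable)
    {F : Ω → S → S'} {A : Set S'} (hF : ∀ σ, MeasurableSet ((fun ω => F ω σ) ⁻¹' A)) :
    MeasurableSet ((fun ω => F ω (X ω)) ⁻¹' A) := by
  have : (fun ω => F ω (X ω)) ⁻¹' A =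
      ⋃ σ ∈ Set.range X, X ⁻¹' {σ} ∩ (fun ω => F ω σ) ⁻¹' A := by
    ext ω
    simp only [Set.mem_preimage, Set.mem_iUnion, Set.mem_inter_iff, Set.mem_singleton_iff,
      exists_prop]
    constructor
    · exact fun h => ⟨X ω, ⟨ω, rfl⟩, rfl, h⟩
    · rintro ⟨σ, -, rfl, h⟩
      exact h
  rw [this]
  exact MeasurableSet.biUnion hc fun σ _ => (hX _).inter (hF σ)

theorem countable_range_comp_discrete {Ω S S' : Type*} {X : Ω → S} (hc : (Set.range X).Countable)
    {F : Ω → S → S'} (hF : ∀ σ, (Set.range fun ω => F ω σ).Countable) :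
    (Set.range fun ω => F ω (X ω)).Countable := by
  refine (hc.biUnion fun σ _ => hF σ).mono ?_
  rintro _ ⟨ω, rfl⟩
  exact Set.mem_biUnion ⟨ω, rfl⟩ ⟨ω, rfl⟩

end Discrete

section Measurability

variable {K : ℕ} (C₀ : ℝ) (T : ℕ)

theorem measurable_reward (s : ℕ) (a : Fin K) : Measurable fun ω : Outcome K => ω.1 s a := by
  fun_prop

theorem measurable_draw (i : ℕ × Finset (Fin K)) : Measurable fun ω : Outcome K => ω.2.1 i := by
  fun_prop

theorem measurable_gapEstimate {p : Outcome K → ℕ → Fin K} {w : Outcome K → ℕ → ℕ} {s : ℕ}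
    (hp : Measurable fun ω => p ω s) (hw : Measurable fun ω => w ω s) (a' a : Fin K) :
    Measurable fun ω : Outcome K => gapEstimate ω.1 (p ω) (w ω) s a' a := by
  unfold gapEstimate
  have h : ∀ b : Fin K, Measurable fun ω : Outcome K => if p ω s = b then (1 : ℝ) else 0 :=
    fun b => Measurable.ite (hp (measurableSet_singleton b)) measurable_const measurable_const
  have hw' : Measurable fun ω => (w ω s : ℝ) := measurable_from_nat.comp hw
  have h1 := measurable_reward (K := K) s a'
  have h2 := measurable_reward (K := K) s a
  exact hw'.mul ((h1.mul (h a')).sub (h2.mul (h a)))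

theorem measurableSet_meetsEviction {p : Outcome K → ℕ → Fin K} {w : Outcome K → ℕ → ℕ}
    (hp : ∀ s, Measurable fun ω => p ω s) (hw : ∀ s, Measurable fun ω => w ω s) (lo t : ℕ)
    (a : Fin K) : MeasurableSet {ω : Outcome K | MeetsEviction C₀ T ω.1 (p ω) (w ω) lo t a} := by
  have : {ω : Outcome K | MeetsEviction C₀ T ω.1 (p ω) (w ω) lo t a} =
      ⋃ s₁ : ℕ, ⋃ s₂ : ℕ, ⋃ _ : lo ≤ s₁ ∧ s₁ < s₂ ∧ s₂ < t, ⋃ a' : Fin K,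
        {ω : Outcome K | Real.log T * √(C₀ * max ((K : ℝ) * ((s₂ : ℝ) - (s₁ : ℝ))) ((K : ℝ) ^ 2))
        < ∑ s ∈ Finset.Icc s₁ s₂, gapEstimate ω.1 (p ω) (w ω) s a' a} := by
    ext ω
    simp only [Set.mem_ofPred_eq, MeetsEviction, Set.mem_iUnion, exists_prop, and_assoc]
  rw [this]
  refine MeasurableSet.iUnion fun s₁ => MeasurableSet.iUnion fun s₂ => MeasurableSet.iUnion
    fun _ => MeasurableSet.iUnion fun a' => measurableSet_lt measurable_const ?_
  exact Finset.measurable_sum _ fun s _ => measurable_gapEstimate (hp s) (hw s) a' a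

theorem mem_badArms {y : ℕ → Fin K → ℝ} {p : ℕ → Fin K} {w : ℕ → ℕ} {lo t : ℕ} {a : Fin K} :
    a ∈ badArms C₀ T y p w lo t ↔ MeetsEviction C₀ T y p w lo t a := by
  unfold badArms
  simp only [Finset.mem_filter, Finset.mem_univ, true_and]

theorem measurableSet_scheduled (e t : ℕ) (S : Finset ℕ) :
    MeasurableSet {ω : Outcome K | scheduled T ω.2.2 e t = S} := by
  have : {ω : Outcome K | scheduled T ω.2.2 e t = S} =
      ⋂ m : ℕ, {ω : Outcome K | (m ∈ replayLengths T ∧ ω.2.2 (e, t, m) = true) ↔ m ∈ S} := by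
    ext ω
    simp only [scheduled, Finset.ext_iff, Set.mem_iInter, Set.mem_ofPred_eq, Finset.mem_filter]
  rw [this]
  refine MeasurableSet.iInter fun m => ?_
  have hB : Measurable fun ω : Outcome K => ω.2.2 (e, t, m) := by fun_prop
  exact hB (MeasurableSet.of_discrete
    (s := {b : Bool | (m ∈ replayLengths T ∧ b = true) ↔ m ∈ S}))

theorem measurableSet_badArms {p : Outcome K → ℕ → Fin K} {w : Outcome K → ℕ → ℕ}
    (hp : ∀ s, Measurable fun ω => p ω s) (hw : ∀ s, Measurable fun ω => w ω s) (lo t : ℕ)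
    (A : Finset (Fin K)) :
    MeasurableSet {ω : Outcome K | badArms C₀ T ω.1 (p ω) (w ω) lo t = A} := by
  have : {ω : Outcome K | badArms C₀ T ω.1 (p ω) (w ω) lo t = A} =
      ⋂ a : Fin K, {ω | MeetsEviction C₀ T ω.1 (p ω) (w ω) lo t a ↔ a ∈ A} := by
    ext ω
    simp only [Finset.ext_iff, Set.mem_iInter, Set.mem_ofPred_eq, mem_badArms]
  rw [this]
  refine MeasurableSet.iInter fun a => ?_
  by_cases ha : a ∈ A
  · simp only [ha, iff_true]
    exact measurableSet_meetsEviction C₀ T hp hw lo t a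
  · simp only [ha, iff_false]
    exact (measurableSet_meetsEviction C₀ T hp hw lo t a).compl

/-- A round of META from a fixed state has a discrete result: it is a function of the arm drawn, of
the scheduled replays and of two sets of evicted arms. -/
theorem step_discrete (t : ℕ) (σ : State K) :
    (∀ A : Set (State K), MeasurableSet ((fun ω => step C₀ T ω t σ) ⁻¹' A)) ∧
      (Set.range fun ω => step C₀ T ω t σ).Countable := by
  set r := returnExpired (t + 1) σ.active σ.parents with hr
  set p : Outcome K → ℕ → Fin K := fun ω =>
    Function.update σ.played t (ω.2.1 (t, σ.active.arms)) with hpdef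
  set w : ℕ → ℕ := Function.update σ.width t σ.active.arms.card with hwdef
  have hp : ∀ s, Measurable fun ω => p ω s := by
    intro s
    by_cases hs : s = t
    · subst hs
      simp only [hpdef, Function.update_self]
      exact measurable_draw _
    · simp only [hpdef, Function.update_of_ne hs]
      exact measurable_const
  have hd : ∀ d, MeasurableSet {ω : Outcome K | ω.2.1 (t, σ.active.arms) = d} := fun d =>
    measurable_draw (t, σ.active.arms) (measurableSet_singleton d)
  have hb : ∀ lo A, MeasurableSet {ω : Outcome K | badArms C₀ T ω.1 (p ω) w lo (t + 1) = A} :=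
    fun lo A => measurableSet_badArms C₀ T hp (w := fun _ => w) (fun _ => measurable_const) lo
      (t + 1) A
  let g : Outcome K → Fin K × Finset ℕ × Finset (Fin K) × Finset (Fin K) := fun ω =>
    (ω.2.1 (t, σ.active.arms), scheduled T ω.2.2 σ.episode (t + 1),
    badArms C₀ T ω.1 (p ω) w σ.episode (t + 1),
    badArms C₀ T ω.1 (p ω) w r.1.start (t + 1))
  let F : Fin K × Finset ℕ × Finset (Fin K) × Finset (Fin K) → State K := fun z =>
    if h : z.2.1.Nonempty then
      { σ with
        active := ⟨t + 1, z.2.1.max' h, Finset.univ⟩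
        parents := σ.active :: σ.parents
        played := Function.update σ.played t z.1
        width := w }
    else if σ.master \ z.2.2.1 = ∅ then
      newEpisode T (t + 1) (Function.update σ.played t z.1) w
    else
      { episode := σ.episode
        master := σ.master \ z.2.2.1
        active := { r.1 with arms := r.1.arms \ z.2.2.2 }
        parents := r.2
        played := Function.update σ.played t z.1
        width := w }
  have hF : (fun ω => step C₀ T ω t σ) = F ∘ g := rfl
  have hg : ∀ z, MeasurableSet (g ⁻¹' {z}) := by
    rintro ⟨d, S, b₁, b₂⟩
    have : g ⁻¹' {(d, S, b₁, b₂)} = {ω | ω.2.1 (t, σ.active.arms) = d} ∩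
        ({ω | scheduled T ω.2.2 σ.episode (t + 1) = S} ∩
        ({ω | badArms C₀ T ω.1 (p ω) w σ.episode (t + 1) = b₁} ∩
        {ω | badArms C₀ T ω.1 (p ω) w r.1.start (t + 1) = b₂})) := by
      ext ω
      simp only [g, Set.mem_preimage, Set.mem_singleton_iff, Set.mem_inter_iff,
        Set.mem_ofPred_eq, Prod.mk.injEq]
    rw [this]
    exact (hd d).inter ((measurableSet_scheduled T _ _ S).inter ((hb _ b₁).inter (hb _ b₂)))
  rw [hF]
  refine ⟨fun A => ?_, (Set.countable_range F).mono (Set.range_comp_subset_range g F)⟩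
  rw [Set.preimage_comp]
  exact measurableSet_preimage_of_countable hg _

variable [NeZero K]

/-- The state after `n` rounds is a random variable with countably many values. Type `State K` bears
no σ-algebra, so every subset of it serves as an event. -/
theorem stateAfter_discrete (n : ℕ) :
    (∀ A : Set (State K), MeasurableSet ((fun ω => stateAfter C₀ T ω n) ⁻¹' A)) ∧
      (Set.range fun ω => stateAfter (K := K) C₀ T ω n).Countable := by
  induction n with
  | zero =>
    refine ⟨fun A => ?_, (Set.countable_singleton
      (newEpisode T 1 (fun _ => 0) (fun _ => 0))).mono ?_⟩
    · simp only [stateAfter]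
      classical
      rw [Set.preimage_const]
      split_ifs
      · exact MeasurableSet.univ
      · exact MeasurableSet.empty
    · rintro _ ⟨ω, rfl⟩
      rfl
  | succ n ih =>
    exact ⟨fun A => measurableSet_comp_discrete (F := fun ω σ => step C₀ T ω (n + 1) σ) ih.1 ih.2
      fun σ => (step_discrete C₀ T (n + 1) σ).1 A,
      countable_range_comp_discrete (F := fun ω σ => step C₀ T ω (n + 1) σ) ih.2
      fun σ => (step_discrete C₀ T (n + 1) σ).2⟩

theorem measurableSet_armsAt (r : ℕ) (S : Set (Finset (Fin K))) :
    MeasurableSet ((fun ω => armsAt C₀ T ω r) ⁻¹' S) :=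
  (stateAfter_discrete C₀ T (r - 1)).1 {σ | σ.active.arms ∈ S}

theorem measurable_comp_armsAt {β : Type*} [MeasurableSpace β] (h : Finset (Fin K) → β) (r : ℕ) :
    Measurable fun ω => h (armsAt C₀ T ω r) :=
  fun S _ => measurableSet_armsAt C₀ T r (h ⁻¹' S)

theorem measurable_armDrawn (r : ℕ) : Measurable fun ω : Outcome K => armDrawn C₀ T ω r :=
  fun _ hS => measurableSet_comp_discrete (F := fun (ω : Outcome K) A => ω.2.1 (r, A))
    (measurableSet_armsAt C₀ T r) (Set.to_countable _) fun _ => measurable_draw _ hS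

theorem measurable_runEstimate (s : ℕ) (a' a : Fin K) :
    Measurable fun ω : Outcome K => runEstimate C₀ T ω s a' a :=
  measurable_gapEstimate (measurable_armDrawn C₀ T s) (measurable_comp_armsAt C₀ T _ s) a' a

end Measurability

section Past

variable {K : ℕ} (C₀ : ℝ) (T : ℕ) {ω ω' : Outcome K}

theorem step_congr {t : ℕ} (h1 : ∀ s ≤ t, ω.1 s = ω'.1 s)
    (h2 : ∀ s ≤ t, ∀ A, ω.2.1 (s, A) = ω'.2.1 (s, A)) (h3 : ω.2.2 = ω'.2.2) (σ : State K) :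
    step C₀ T ω t σ = step C₀ T ω' t σ := by
  have hbad : ∀ p w lo, badArms C₀ T ω.1 p w lo (t + 1) = badArms C₀ T ω'.1 p w lo (t + 1) := by
    intro p w lo
    ext a
    rw [mem_badArms, mem_badArms]
    unfold MeetsEviction
    refine exists_congr fun s₁ => exists_congr fun s₂ => and_congr_right fun g1 =>
      and_congr_right fun g2 => and_congr_right fun g3 => exists_congr fun a' => ?_
    rw [Finset.sum_congr rfl fun s hs => ?_]
    rw [Finset.mem_Icc] at hs
    unfold gapEstimate
    rw [h1 s (by omega)]
  unfold step
  simp only [h2 t le_rfl, h3, hbad]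

variable [NeZero K]

/-- The state after `n` rounds depends on the rewards and draws of these rounds only. -/
theorem stateAfter_congr {n : ℕ} (h1 : ∀ s ≤ n, ω.1 s = ω'.1 s)
    (h2 : ∀ s ≤ n, ∀ A, ω.2.1 (s, A) = ω'.2.1 (s, A)) (h3 : ω.2.2 = ω'.2.2) :
    stateAfter C₀ T ω n = stateAfter C₀ T ω' n := by
  induction n with
  | zero => rfl
  | succ n ih =>
    simp only [stateAfter]
    rw [ih (fun s hs => h1 s (by omega)) (fun s hs => h2 s (by omega)), step_congr C₀ T h1 h2 h3]

theorem armsAt_congr {r n : ℕ} (hrn : r ≤ n + 1) (h1 : ∀ s ≤ n, ω.1 s = ω'.1 s)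
    (h2 : ∀ s ≤ n, ∀ A, ω.2.1 (s, A) = ω'.2.1 (s, A)) (h3 : ω.2.2 = ω'.2.2) :
    armsAt C₀ T ω r = armsAt C₀ T ω' r := by
  unfold armsAt
  rw [stateAfter_congr C₀ T (fun s hs => h1 s (by omega)) (fun s hs => h2 s (by omega)) h3]

theorem runEstimate_congr {r n : ℕ} (hrn : r ≤ n) (h1 : ∀ s ≤ n, ω.1 s = ω'.1 s)
    (h2 : ∀ s ≤ n, ∀ A, ω.2.1 (s, A) = ω'.2.1 (s, A)) (h3 : ω.2.2 = ω'.2.2) (a' a : Fin K) :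
    runEstimate C₀ T ω r a' a = runEstimate C₀ T ω' r a' a := by
  unfold runEstimate gapEstimate armDrawn
  dsimp only
  rw [armsAt_congr C₀ T (r := r) (by omega) h1 h2 h3, h1 r hrn, h2 r hrn]

end Past

/-! ### Resampling one round -/

section Resample

open scoped Classical in
/-- The family `p.1` with the coordinates in `s` taken from `p.2`. -/
def overwrite {ι : Type*} {X : ι → Type*} (s : Set ι) (p : (∀ i, X i) × (∀ i, X i)) (i : ι) : X i :=
  if i ∈ s then p.2 i else p.1 i

/-- Replacing the coordinates in `s` by those of an independent copy preserves a product measure. -/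
theorem measurePreserving_overwrite {ι : Type*} {X : ι → Type*} [∀ i, MeasurableSpace (X i)]
    (μ : ∀ i, Measure (X i)) [∀ i, IsProbabilityMeasure (μ i)] (s : Set ι) :
    MeasurePreserving (overwrite s)
      ((Measure.infinitePi μ).prod (Measure.infinitePi μ)) (Measure.infinitePi μ) := by
  classical
  have hm : Measurable (overwrite (X := X) s) := by
    refine measurable_pi_iff.2 fun i => ?_
    unfold overwrite
    split_ifs <;> fun_prop
  refine ⟨hm, Measure.eq_infinitePi μ fun I t ht => ?_⟩
  rw [Measure.map_apply hm (MeasurableSet.pi I.countable_toSet fun i _ => ht i)]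
  have : overwrite (X := X) s ⁻¹' ((I : Set ι).pi t) =
      ((I.filter fun i => ¬ i ∈ s : Finset ι) : Set ι).pi t ×ˢ
        ((I.filter fun i => i ∈ s : Finset ι) : Set ι).pi t := by
    ext p
    simp only [Set.mem_preimage, Set.mem_pi, Set.mem_prod, Finset.mem_coe, Finset.mem_filter,
      overwrite]
    constructor
    · refine fun h => ⟨fun i hi => ?_, fun i hi => ?_⟩
      · simpa [hi.2] using h i hi.1
      · simpa [hi.2] using h i hi.1
    · rintro ⟨h1, h2⟩ i hi
      split_ifs with his
      · exact h2 i ⟨hi, his⟩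
      · exact h1 i ⟨hi, his⟩
  rw [this, Measure.prod_prod, Measure.infinitePi_pi _ fun i _ => ht i,
    Measure.infinitePi_pi _ fun i _ => ht i, mul_comm, Finset.prod_filter_mul_prod_filter_not]

theorem measurePreserving_prod_pairs {α β : Type*} [MeasurableSpace α] [MeasurableSpace β]
    {μ : Measure α} {ν : Measure β} [IsProbabilityMeasure μ] [IsProbabilityMeasure ν]
    {f : α × α → α} {g : β × β → β} (hf : MeasurePreserving f (μ.prod μ) μ)
    (hg : MeasurePreserving g (ν.prod ν) ν) :
    MeasurePreserving (fun p : (α × β) × (α × β) => (f (p.1.1, p.2.1), g (p.1.2, p.2.2)))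
      ((μ.prod ν).prod (μ.prod ν)) (μ.prod ν) := by
  have hfm := hf.measurable
  have hgm := hg.measurable
  have hm : Measurable
      (fun p : (α × β) × (α × β) => (f (p.1.1, p.2.1), g (p.1.2, p.2.2))) := by fun_prop
  refine ⟨hm, (Measure.prod_eq fun s t hs ht => ?_).symm⟩
  rw [Measure.map_apply hm (hs.prod ht), Measure.prod_apply (hm (hs.prod ht))]
  have h1 : ∀ p : α × β, (μ.prod ν) (Prod.mk p ⁻¹' ((fun p : (α × β) × (α × β) =>
      (f (p.1.1, p.2.1), g (p.1.2, p.2.2))) ⁻¹' s ×ˢ t)) =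
      μ (Prod.mk p.1 ⁻¹' (f ⁻¹' s)) * ν (Prod.mk p.2 ⁻¹' (g ⁻¹' t)) := by
    intro p
    rw [← Measure.prod_prod]
    rfl
  simp_rw [h1]
  rw [lintegral_prod_mul (measurable_measure_prodMk_left (hfm hs)).aemeasurable
    (measurable_measure_prodMk_left (hgm ht)).aemeasurable, ← Measure.prod_apply (hfm hs),
    ← Measure.prod_apply (hgm ht), hf.measure_preimage hs.nullMeasurableSet,
    hg.measure_preimage ht.nullMeasurableSet]

variable {K : ℕ}

/-- The outcome `ω` with the reward vector and the draws of round `n` taken from `ω'`. -/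
def resample (n : ℕ) (p : Outcome K × Outcome K) : Outcome K :=
  (overwrite {n} (p.1.1, p.2.1), overwrite {i | i.1 = n} (p.1.2.1, p.2.2.1), p.1.2.2)

variable [NeZero K] {ν : ℕ → Measure (Fin K → ℝ)} (hν : IsRewardLaw ν)

instance : IsProbabilityMeasure (outcomeLaw ν hν) := by
  have := hν.isProbabilityMeasure
  unfold outcomeLaw
  infer_instance

theorem measurePreserving_resample (n : ℕ) :
    MeasurePreserving (resample n) ((outcomeLaw ν hν).prod (outcomeLaw ν hν))
      (outcomeLaw ν hν) := by
  have := hν.isProbabilityMeasure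
  have h1 := measurePreserving_overwrite ν {n}
  have h2 := measurePreserving_overwrite (fun i : ℕ × Finset (Fin K) => armLaw i.2) {i | i.1 = n}
  have h3 := measurePreserving_fst
    (μ := Measure.infinitePi fun i : ℕ × ℕ × ℕ =>
      bernoulliMeasure true false (replayProb i.1 i.2.1 i.2.2))
    (ν := Measure.infinitePi fun i : ℕ × ℕ × ℕ =>
      bernoulliMeasure true false (replayProb i.1 i.2.1 i.2.2))
  exact measurePreserving_prod_pairs h1 (measurePreserving_prod_pairs h2 h3)

/-- The reward vector of round `n` and the draw for a fixed candidate set are independent, with the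
prescribed laws. -/
theorem measurePreserving_round (n : ℕ) (A : Finset (Fin K)) :
    MeasurePreserving (fun ω : Outcome K => (ω.1 n, ω.2.1 (n, A))) (outcomeLaw ν hν)
      ((ν n).prod (armLaw A)) := by
  have := hν.isProbabilityMeasure
  have h1 := measurePreserving_eval_infinitePi ν n
  have h2 := (measurePreserving_eval_infinitePi
    (fun i : ℕ × Finset (Fin K) => armLaw i.2) (n, A)).comp
    (measurePreserving_fst (μ := Measure.infinitePi fun i : ℕ × Finset (Fin K) => armLaw i.2)
      (ν := Measure.infinitePi fun i : ℕ × ℕ × ℕ =>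
        bernoulliMeasure true false (replayProb i.1 i.2.1 i.2.2)))
  exact h1.prod h2

theorem measurePreserving_schedule :
    MeasurePreserving (fun ω : Outcome K => ω.2.2) (outcomeLaw ν hν)
      (Measure.infinitePi fun i : ℕ × ℕ × ℕ =>
        bernoulliMeasure true false (replayProb i.1 i.2.1 i.2.2)) := by
  have := hν.isProbabilityMeasure
  exact measurePreserving_snd.comp measurePreserving_snd

/-- Conditional expectation of round `n` given the past: if `Z` and the candidate set `A` do not
depend on the rewards and draws of round `n`, these can be integrated out for fixed `A`. -/
theorem lintegral_round_le {n : ℕ} {Z : Outcome K → ENNReal} (hZ : Measurable Z)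
    (hZn : ∀ ω ω', Z (resample n (ω, ω')) = Z ω) {A : Outcome K → Finset (Fin K)}
    (hA : ∀ S : Set (Finset (Fin K)), MeasurableSet (A ⁻¹' S))
    (hAn : ∀ ω ω', A (resample n (ω, ω')) = A ω)
    {g : Finset (Fin K) → (Fin K → ℝ) × Fin K → ENNReal} (hg : ∀ A, Measurable (g A)) {c : ENNReal}
    (hc : ∀ A, ∫⁻ p, g A p ∂((ν n).prod (armLaw A)) ≤ c) :
    ∫⁻ ω, Z ω * g (A ω) (ω.1 n, ω.2.1 (n, A ω)) ∂(outcomeLaw ν hν) ≤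
      c * ∫⁻ ω, Z ω ∂(outcomeLaw ν hν) := by
  have hgm : Measurable fun ω : Outcome K => g (A ω) (ω.1 n, ω.2.1 (n, A ω)) :=
    fun S hS => measurableSet_comp_discrete
      (F := fun (ω : Outcome K) A => g A (ω.1 n, ω.2.1 (n, A))) hA (Set.to_countable _)
      fun B => ((hg B).comp (measurePreserving_round hν n B).measurable) hS
  have hcomp := (measurePreserving_resample hν n).lintegral_comp (hZ.mul hgm)
  simp only [Pi.mul_apply] at hcomp
  have hm : Measurable fun p : Outcome K × Outcome K => Z (resample n p) *
      g (A (resample n p)) ((resample n p).1 n, (resample n p).2.1 (n, A (resample n p))) :=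
    (hZ.mul hgm).comp (measurePreserving_resample hν n).measurable
  rw [← hcomp, lintegral_prod _ hm.aemeasurable, ← lintegral_const_mul _ hZ]
  refine lintegral_mono fun ω => ?_
  have h1 : ∀ ω' : Outcome K, Z (resample n (ω, ω')) *
      g (A (resample n (ω, ω'))) ((resample n (ω, ω')).1 n,
        (resample n (ω, ω')).2.1 (n, A (resample n (ω, ω')))) =
      Z ω * g (A ω) (ω'.1 n, ω'.2.1 (n, A ω)) := by
    intro ω'
    rw [hZn, hAn]
    simp [resample, overwrite]
  simp_rw [h1]
  have hgA : Measurable fun ω' : Outcome K => g (A ω) (ω'.1 n, ω'.2.1 (n, A ω)) :=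
    (hg (A ω)).comp (measurePreserving_round hν n (A ω)).measurable
  rw [lintegral_const_mul _ hgA,
    (measurePreserving_round hν n (A ω)).lintegral_comp (hg (A ω)), mul_comm]
  gcongr
  exact hc _

end Resample

/-! ### Concentration of the gap estimates -/

/-- Bernstein's bound for the exponential moment of a bounded centred variable. -/
theorem lintegral_exp_le {Ω : Type*} [MeasurableSpace Ω] {Q : Measure Ω} [IsProbabilityMeasure Q]
    {W : Ω → ℝ} (hW : Measurable W) {l b v : ℝ} (hl : 0 ≤ l) (hlb : l * b ≤ 1)
    (hb : ∀ᵐ x ∂Q, |W x| ≤ b) (h0 : ∫ x, W x ∂Q = 0) (hv : ∫ x, W x ^ 2 ∂Q ≤ v) :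
    ∫⁻ x, ENNReal.ofReal (Real.exp (l * W x)) ∂Q ≤ ENNReal.ofReal (Real.exp (l ^ 2 * v)) := by
  have hWi : Integrable W Q := Integrable.of_bound hW.aestronglyMeasurable b
    (by filter_upwards [hb] with x hx using by rwa [Real.norm_eq_abs])
  have hW2 : Integrable (fun x => W x ^ 2) Q := by
    refine Integrable.of_bound (hW.pow_const 2).aestronglyMeasurable (b ^ 2) ?_
    filter_upwards [hb] with x hx
    rw [Real.norm_eq_abs, abs_pow]
    exact pow_le_pow_left₀ (abs_nonneg _) hx 2
  have hI : Integrable (fun x => 1 + l * W x + l ^ 2 * W x ^ 2) Q :=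
    ((integrable_const 1).add (hWi.const_mul l)).add (hW2.const_mul (l ^ 2))
  calc ∫⁻ x, ENNReal.ofReal (Real.exp (l * W x)) ∂Q
      ≤ ∫⁻ x, ENNReal.ofReal (1 + l * W x + l ^ 2 * W x ^ 2) ∂Q := by
        refine lintegral_mono_ae ?_
        filter_upwards [hb] with x hx
        apply ENNReal.ofReal_le_ofReal
        have h1 : |l * W x| ≤ 1 := by
          rw [abs_mul, abs_of_nonneg hl]
          exact (mul_le_mul_of_nonneg_left hx hl).trans hlb
        have := (abs_le.1 (Real.abs_exp_sub_one_sub_id_le h1)).2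
        linarith [mul_pow l (W x) 2]
    _ = ENNReal.ofReal (∫ x, (1 + l * W x + l ^ 2 * W x ^ 2) ∂Q) := by
        rw [ofReal_integral_eq_lintegral_ofReal hI]
        refine Filter.Eventually.of_forall fun x => ?_
        dsimp only [Pi.zero_apply]
        nlinarith [sq_nonneg (l * W x + 1), sq_nonneg (l * W x)]
    _ ≤ _ := by
        apply ENNReal.ofReal_le_ofReal
        have h1 : ∫ x, (1 + l * W x + l ^ 2 * W x ^ 2) ∂Q = 1 + l ^ 2 * ∫ x, W x ^ 2 ∂Q := by
          have hi : Integrable (fun x => 1 + l * W x) Q :=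
            (integrable_const 1).add (hWi.const_mul l)
          rw [integral_add hi (hW2.const_mul (l ^ 2)),
            integral_add (integrable_const 1) (hWi.const_mul l), integral_const_mul,
            integral_const_mul, h0]
          simp
        rw [h1]
        have h2 := Real.add_one_le_exp (l ^ 2 * v)
        nlinarith [sq_nonneg l]

section Concentration

theorem armLaw_real_singleton {K : ℕ} {A : Finset (Fin K)} (hA : A.Nonempty) (a : Fin K) :
    (armLaw A).real {a} = if a ∈ A then 1 / (A.card : ℝ) else 0 := by
  unfold armLaw
  rw [if_pos hA, measureReal_def, ← Finset.coe_singleton, uniformOn_apply_finset]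
  by_cases ha : a ∈ A
  · rw [if_pos ha, Finset.inter_singleton_of_mem ha]
    simp
  · rw [if_neg ha, Finset.inter_singleton_of_notMem ha]
    simp

variable {K : ℕ} [NeZero K] {ν : ℕ → Measure (Fin K → ℝ)} (hν : IsRewardLaw ν)

/-- The estimate of one round as a function of the reward vector and the draw. -/
def roundEstimate (A : Finset (Fin K)) (a' a : Fin K) (p : (Fin K → ℝ) × Fin K) : ℝ :=
  (A.card : ℝ) * (p.1 a' * (if p.2 = a' then 1 else 0) - p.1 a * (if p.2 = a then 1 else 0))

omit [NeZero K] in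
theorem measurable_indicator_arm (a : Fin K) :
    Measurable fun d : Fin K => if d = a then (1 : ℝ) else 0 := measurable_of_finite _

omit [NeZero K] in
theorem measurable_roundEstimate (A : Finset (Fin K)) (a' a : Fin K) :
    Measurable (roundEstimate A a' a) := by
  unfold roundEstimate
  have h := fun b : Fin K => (measurable_indicator_arm b).comp
    (measurable_snd : Measurable (Prod.snd : (Fin K → ℝ) × Fin K → Fin K))
  have h' : ∀ b : Fin K, Measurable fun p : (Fin K → ℝ) × Fin K => p.1 b := fun b => by fun_prop
  exact measurable_const.mul (((h' a').mul (h a')).sub ((h' a).mul (h a)))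

include hν in
omit [NeZero K] in
theorem meanReward_mem (r : ℕ) (a : Fin K) : meanReward ν r a ∈ Set.Icc (0 : ℝ) 1 := by
  have := hν.isProbabilityMeasure r
  have hb := hν.bounded r
  have hm : Measurable fun y : Fin K → ℝ => y a := by fun_prop
  have hi : Integrable (fun y : Fin K → ℝ => y a) (ν r) :=
    Integrable.of_bound hm.aestronglyMeasurable 1 (by
      filter_upwards [hb] with y hy
      rw [Real.norm_eq_abs, abs_of_nonneg (hy a).1]
      exact (hy a).2)
  constructor
  · exact integral_nonneg_of_ae (by filter_upwards [hb] with y hy using (hy a).1)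
  · have : ∫ y, y a ∂(ν r) ≤ ∫ _, (1 : ℝ) ∂(ν r) :=
      integral_mono_ae hi (integrable_const _) (by filter_upwards [hb] with y hy using (hy a).2)
    simpa [meanReward] using this

include hν in
omit [NeZero K] in
theorem integral_reward_mul_indicator (n : ℕ) {A : Finset (Fin K)} (hA : A.Nonempty) (a : Fin K) :
    ∫ p, p.1 a * (if p.2 = a then (1 : ℝ) else 0) ∂((ν n).prod (armLaw A)) =
      meanReward ν n a * (if a ∈ A then 1 / (A.card : ℝ) else 0) := by
  have := hν.isProbabilityMeasure n
  rw [integral_prod_mul (μ := ν n) (ν := armLaw A) (fun y : Fin K → ℝ => y a)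
    (fun d : Fin K => if d = a then (1 : ℝ) else 0), meanReward, ← armLaw_real_singleton hA]
  congr 1
  rw [← integral_indicator_one (measurableSet_singleton a)]
  refine integral_congr_ae (Filter.Eventually.of_forall fun d => ?_)
  by_cases h : d = a <;> simp [h]

include hν in
omit [NeZero K] in
theorem ae_prod_reward_mem (n : ℕ) (A : Finset (Fin K)) :
    ∀ᵐ p ∂((ν n).prod (armLaw A)), ∀ a, p.1 a ∈ Set.Icc (0 : ℝ) 1 := by
  have := hν.isProbabilityMeasure n
  exact Measure.quasiMeasurePreserving_fst.ae (hν.bounded n)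

include hν in
theorem integrable_reward_mul_indicator (n : ℕ) (A : Finset (Fin K)) (a : Fin K) :
    Integrable (fun p : (Fin K → ℝ) × Fin K => p.1 a * (if p.2 = a then (1 : ℝ) else 0))
      ((ν n).prod (armLaw A)) := by
  have := hν.isProbabilityMeasure n
  have h' : Measurable fun p : (Fin K → ℝ) × Fin K => p.1 a := by fun_prop
  refine Integrable.of_bound (h'.mul ((measurable_indicator_arm a).comp
    measurable_snd)).aestronglyMeasurable 1 ?_
  filter_upwards [ae_prod_reward_mem hν n A] with p hp
  have := hp a
  rw [Real.norm_eq_abs]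
  split_ifs
  · rw [mul_one, abs_of_nonneg this.1]; exact this.2
  · simp

include hν in
theorem integral_roundEstimate (n : ℕ) {A : Finset (Fin K)} (hA : A.Nonempty) (a' a : Fin K) :
    ∫ p, roundEstimate A a' a p ∂((ν n).prod (armLaw A)) =
      meanEstimate (meanReward ν n) A a' a := by
  have hc : (A.card : ℝ) ≠ 0 := by exact_mod_cast hA.card_pos.ne'
  unfold roundEstimate
  rw [integral_const_mul, integral_sub (integrable_reward_mul_indicator hν n A a')
    (integrable_reward_mul_indicator hν n A a), integral_reward_mul_indicator hν n hA,
    integral_reward_mul_indicator hν n hA, meanEstimate]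
  split_ifs <;> field_simp <;> ring

include hν in
theorem integral_roundEstimate_sq_le (n : ℕ) {A : Finset (Fin K)} (hA : A.Nonempty)
    (a' a : Fin K) :
    ∫ p, roundEstimate A a' a p ^ 2 ∂((ν n).prod (armLaw A)) ≤ 2 * K := by
  have := hν.isProbabilityMeasure n
  have hc : (0 : ℝ) < A.card := by exact_mod_cast hA.card_pos
  have hcK : (A.card : ℝ) ≤ K := by
    have := Finset.card_le_univ A
    rw [Fintype.card_fin] at this
    exact_mod_cast this
  have hi := fun b => integrable_reward_mul_indicator hν n A b
  have hmu := fun b => meanReward_mem hν n b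
  calc _ ≤ ∫ p, (A.card : ℝ) ^ 2 * (p.1 a' * (if p.2 = a' then (1 : ℝ) else 0) +
        p.1 a * (if p.2 = a then (1 : ℝ) else 0)) ∂((ν n).prod (armLaw A)) := by
        refine integral_mono_of_nonneg (Filter.Eventually.of_forall fun p => sq_nonneg _)
          (((hi a').add (hi a)).const_mul _) ?_
        filter_upwards [ae_prod_reward_mem hν n A] with p hp
        obtain ⟨h1, h2⟩ := hp a'
        obtain ⟨h3, h4⟩ := hp a
        unfold roundEstimate
        rw [mul_pow]
        apply mul_le_mul_of_nonneg_left _ (sq_nonneg _)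
        split_ifs <;> nlinarith
    _ = (A.card : ℝ) ^ 2 * (meanReward ν n a' * (if a' ∈ A then 1 / (A.card : ℝ) else 0) +
        meanReward ν n a * (if a ∈ A then 1 / (A.card : ℝ) else 0)) := by
        rw [integral_const_mul, integral_add (hi a') (hi a), integral_reward_mul_indicator hν n hA,
          integral_reward_mul_indicator hν n hA]
    _ ≤ (A.card : ℝ) ^ 2 * (1 / A.card + 1 / A.card) := by
        apply mul_le_mul_of_nonneg_left _ (sq_nonneg _)
        have h0 : 0 ≤ 1 / (A.card : ℝ) := by positivity
        have key : ∀ b, meanReward ν n b * (if b ∈ A then 1 / (A.card : ℝ) else 0) ≤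
            1 / A.card := by
          intro b
          obtain ⟨h1, h2⟩ := hmu b
          split_ifs
          · nlinarith
          · simp
        linarith [key a', key a]
    _ = 2 * A.card := by field_simp; ring
    _ ≤ _ := by linarith

include hν in
theorem lintegral_exp_roundEstimate_le (n : ℕ) (A : Finset (Fin K)) (a' a : Fin K) {l : ℝ}
    (hl : 0 ≤ l) (hlK : l * (2 * K) ≤ 1) :
    ∫⁻ p, ENNReal.ofReal (Real.exp (l * (roundEstimate A a' a p -
      meanEstimate (meanReward ν n) A a' a))) ∂((ν n).prod (armLaw A)) ≤
      ENNReal.ofReal (Real.exp (l ^ 2 * (2 * K))) := by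
  have := hν.isProbabilityMeasure n
  rcases A.eq_empty_or_nonempty with rfl | hA
  · simp only [roundEstimate, meanEstimate, Finset.card_empty, Nat.cast_zero, zero_mul,
      Finset.notMem_empty, if_false, sub_zero, mul_zero, Real.exp_zero, lintegral_const,
      measure_univ, mul_one]
    apply ENNReal.ofReal_le_ofReal
    exact Real.one_le_exp (by positivity)
  have hK : (1 : ℝ) ≤ K := by exact_mod_cast NeZero.one_le
  have hcK : (A.card : ℝ) ≤ K := by
    have := Finset.card_le_univ A
    rw [Fintype.card_fin] at this
    exact_mod_cast this
  have hc0 : (0 : ℝ) ≤ A.card := by positivity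
  have hmu := fun b => meanReward_mem hν n b
  set M := meanEstimate (meanReward ν n) A a' a with hM
  have hM1 : |M| ≤ 1 := by
    rw [hM, meanEstimate, abs_le]
    obtain ⟨h1, h2⟩ := hmu a'
    obtain ⟨h3, h4⟩ := hmu a
    split_ifs <;> constructor <;> linarith
  have hb : ∀ᵐ p ∂((ν n).prod (armLaw A)), |roundEstimate A a' a p| ≤ K := by
    filter_upwards [ae_prod_reward_mem hν n A] with p hp
    obtain ⟨h1, h2⟩ := hp a'
    obtain ⟨h3, h4⟩ := hp a
    unfold roundEstimate
    rw [abs_mul, abs_of_nonneg hc0]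
    have : |p.1 a' * (if p.2 = a' then (1 : ℝ) else 0) -
        p.1 a * (if p.2 = a then (1 : ℝ) else 0)| ≤ 1 := by
      rw [abs_le]
      split_ifs <;> constructor <;> linarith
    nlinarith [abs_nonneg (p.1 a' * (if p.2 = a' then (1 : ℝ) else 0) -
        p.1 a * (if p.2 = a then (1 : ℝ) else 0))]
  have hXm := measurable_roundEstimate A a' a
  have hXi : Integrable (roundEstimate A a' a) ((ν n).prod (armLaw A)) :=
    Integrable.of_bound hXm.aestronglyMeasurable K
      (by filter_upwards [hb] with x hx using by rwa [Real.norm_eq_abs])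
  have hX2 : Integrable (fun p => roundEstimate A a' a p ^ 2) ((ν n).prod (armLaw A)) := by
    refine Integrable.of_bound (hXm.pow_const 2).aestronglyMeasurable ((K : ℝ) ^ 2) ?_
    filter_upwards [hb] with x hx
    rw [Real.norm_eq_abs, abs_pow]
    exact pow_le_pow_left₀ (abs_nonneg _) hx 2
  have hmean := integral_roundEstimate hν n hA a' a
  refine lintegral_exp_le (hXm.sub_const M) hl hlK ?_ ?_ ?_
  · filter_upwards [hb] with p hp
    have := abs_sub (roundEstimate A a' a p) M
    linarith
  · rw [integral_sub hXi (integrable_const _), hmean, ← hM]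
    simp
  · have h1 : ∫ p, (roundEstimate A a' a p - M) ^ 2 ∂((ν n).prod (armLaw A)) =
        ∫ p, roundEstimate A a' a p ^ 2 ∂((ν n).prod (armLaw A)) - M ^ 2 := by
      have : ∀ p, (roundEstimate A a' a p - M) ^ 2 =
          roundEstimate A a' a p ^ 2 - (2 * M) * roundEstimate A a' a p + M ^ 2 := fun p => by ring
      simp_rw [this]
      have hi : Integrable (fun p => roundEstimate A a' a p ^ 2 - (2 * M) * roundEstimate A a' a p)
          ((ν n).prod (armLaw A)) := hX2.sub (hXi.const_mul _)
      rw [integral_add hi (integrable_const _), integral_sub hX2 (hXi.const_mul _),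
        integral_const_mul, hmean, ← hM]
      simp
      ring
    rw [h1]
    have := integral_roundEstimate_sq_le hν n hA a' a
    nlinarith [sq_nonneg M]

/-- The exponential supermartingale of the centred gap estimates. -/
theorem lintegral_exp_sum_le (C₀ : ℝ) (T : ℕ) {s₁ : ℕ} (a' a : Fin K) {l : ℝ} (hl : 0 ≤ l)
    (hlK : l * (2 * K) ≤ 1) (m : ℕ) :
    ∫⁻ ω, ENNReal.ofReal (Real.exp (l * ∑ s ∈ Finset.Ico (s₁ + 1) (s₁ + 1 + m),
      (runEstimate C₀ T ω s a' a -
        meanEstimate (meanReward ν s) (armsAt C₀ T ω s) a' a))) ∂(outcomeLaw ν hν) ≤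
      ENNReal.ofReal (Real.exp (l ^ 2 * (2 * K) * m)) := by
  induction m with
  | zero => simp
  | succ m ih =>
    set n := s₁ + 1 + m with hn
    have hsplit : ∀ ω : Outcome K,
        ENNReal.ofReal (Real.exp (l * ∑ s ∈ Finset.Ico (s₁ + 1) (s₁ + 1 + (m + 1)),
          (runEstimate C₀ T ω s a' a -
            meanEstimate (meanReward ν s) (armsAt C₀ T ω s) a' a))) =
        ENNReal.ofReal (Real.exp (l * ∑ s ∈ Finset.Ico (s₁ + 1) n,
          (runEstimate C₀ T ω s a' a -
            meanEstimate (meanReward ν s) (armsAt C₀ T ω s) a' a))) *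
        (fun A p => ENNReal.ofReal (Real.exp (l * (roundEstimate A a' a p -
          meanEstimate (meanReward ν n) A a' a)))) (armsAt C₀ T ω n)
          (ω.1 n, ω.2.1 (n, armsAt C₀ T ω n)) := by
      intro ω
      rw [← ENNReal.ofReal_mul (Real.exp_nonneg _), ← Real.exp_add, ← mul_add, ← add_assoc,
        Finset.sum_Ico_succ_top (by omega)]
      rfl
    simp_rw [hsplit]
    have hres : ∀ ω ω' : Outcome K, (∀ s ≤ n - 1, (resample n (ω, ω')).1 s = ω.1 s) ∧
        (∀ s ≤ n - 1, ∀ A, (resample n (ω, ω')).2.1 (s, A) = ω.2.1 (s, A)) ∧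
        (resample n (ω, ω')).2.2 = ω.2.2 := by
      intro ω ω'
      refine ⟨fun s hs => ?_, fun s hs A => ?_, rfl⟩
      · have : s ≠ n := by omega
        simp [resample, overwrite, this]
      · have : s ≠ n := by omega
        simp [resample, overwrite, this]
    refine (lintegral_round_le hν (n := n) (c := ENNReal.ofReal (Real.exp (l ^ 2 * (2 * K))))
      (Z := fun ω => ENNReal.ofReal (Real.exp (l * ∑ s ∈ Finset.Ico (s₁ + 1) n,
          (runEstimate C₀ T ω s a' a -
            meanEstimate (meanReward ν s) (armsAt C₀ T ω s) a' a))))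
      (g := fun A p => ENNReal.ofReal (Real.exp (l * (roundEstimate A a' a p -
          meanEstimate (meanReward ν n) A a' a)))) ?_ ?_
      (measurableSet_armsAt C₀ T n) ?_ ?_ ?_).trans ?_
    · refine ENNReal.measurable_ofReal.comp (Real.measurable_exp.comp (measurable_const.mul
        (Finset.measurable_sum _ fun s _ => ?_)))
      exact (measurable_runEstimate C₀ T s a' a).sub
        (measurable_comp_armsAt C₀ T (fun A => meanEstimate (meanReward ν s) A a' a) s)
    · intro ω ω'
      obtain ⟨h1, h2, h3⟩ := hres ω ω'
      congr 3
      refine Finset.sum_congr rfl fun s hs => ?_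
      rw [Finset.mem_Ico] at hs
      rw [runEstimate_congr C₀ T (by omega) h1 h2 h3, armsAt_congr C₀ T (by omega) h1 h2 h3]
    · intro ω ω'
      obtain ⟨h1, h2, h3⟩ := hres ω ω'
      exact armsAt_congr C₀ T (by omega) h1 h2 h3
    · intro A
      exact ENNReal.measurable_ofReal.comp (Real.measurable_exp.comp (measurable_const.mul
        ((measurable_roundEstimate A a' a).sub_const _)))
    · intro A
      exact lintegral_exp_roundEstimate_le hν n A a' a hl hlK
    · refine (mul_le_mul_right ih _).trans (le_of_eq ?_)
      rw [← ENNReal.ofReal_mul (Real.exp_nonneg _), ← Real.exp_add]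
      congr 2
      push_cast
      ring

/-- Bernstein's inequality for the centred gap estimates of an interval of rounds. -/
theorem measure_deviation_le (C₀ : ℝ) (T : ℕ) {s₁ s₂ : ℕ} (h1 : 1 ≤ s₁) (h12 : s₁ < s₂)
    (a' a : Fin K) :
    outcomeLaw ν hν {ω | 14 * Real.log T * devScale K (s₂ - s₁) <
      ∑ s ∈ Finset.Icc s₁ s₂, (runEstimate C₀ T ω s a' a -
        meanEstimate (meanReward ν s) (armsAt C₀ T ω s) a' a)} ≤
      ENNReal.ofReal (Real.exp (1 - 7 * Real.log T)) := by
  have hK : (1 : ℝ) ≤ K := by exact_mod_cast NeZero.one_le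
  set n := s₂ - s₁ with hn
  have hn1 : (1 : ℝ) ≤ n := by exact_mod_cast (by omega : 1 ≤ n)
  set q := devScale K n with hq
  have hqK : (K : ℝ) ≤ q := Real.le_sqrt_of_sq_le (le_max_right _ _)
  have hq0 : 0 < q := by linarith
  have hqq : (K : ℝ) * n ≤ q ^ 2 := by
    rw [hq, devScale, Real.sq_sqrt (by positivity)]
    exact le_max_left _ _
  -- this exponent makes the variance term `l ^ 2 * (2 * K) * (n + 1)` at most `1`
  set l := 1 / (2 * q) with hl
  have hl0 : 0 ≤ l := by positivity
  have hlK : l * (2 * K) ≤ 1 := by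
    rw [hl, one_div_mul_eq_div, div_le_one (by positivity)]
    linarith
  have hexp := lintegral_exp_sum_le hν C₀ T (s₁ := s₁ - 1) a' a hl0 hlK (n + 1)
  have hIcc : Finset.Ico (s₁ - 1 + 1) (s₁ - 1 + 1 + (n + 1)) = Finset.Icc s₁ s₂ := by
    ext s
    simp only [Finset.mem_Ico, Finset.mem_Icc]
    omega
  rw [hIcc] at hexp
  set X : Outcome K → ℝ := fun ω => ∑ s ∈ Finset.Icc s₁ s₂, (runEstimate C₀ T ω s a' a -
        meanEstimate (meanReward ν s) (armsAt C₀ T ω s) a' a) with hX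
  have hXm : Measurable X := Finset.measurable_sum _ fun s _ =>
    (measurable_runEstimate C₀ T s a' a).sub
      (measurable_comp_armsAt C₀ T (fun A => meanEstimate (meanReward ν s) A a' a) s)
  have hfm : Measurable fun ω => ENNReal.ofReal (Real.exp (l * X ω)) :=
    ENNReal.measurable_ofReal.comp (Real.measurable_exp.comp (measurable_const.mul hXm))
  have hθ : 0 < Real.exp (l * (14 * Real.log T * q)) := Real.exp_pos _
  calc _ ≤ outcomeLaw ν hν {ω | ENNReal.ofReal (Real.exp (l * (14 * Real.log T * q))) ≤
        ENNReal.ofReal (Real.exp (l * X ω))} := by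
        refine measure_mono fun ω hω => ?_
        refine ENNReal.ofReal_le_ofReal (Real.exp_le_exp.2 (mul_le_mul_of_nonneg_left ?_ hl0))
        exact le_of_lt hω
    _ ≤ (∫⁻ ω, ENNReal.ofReal (Real.exp (l * X ω)) ∂(outcomeLaw ν hν)) /
        ENNReal.ofReal (Real.exp (l * (14 * Real.log T * q))) :=
        meas_ge_le_lintegral_div hfm.aemeasurable (by simpa using hθ) ENNReal.ofReal_ne_top
    _ ≤ ENNReal.ofReal (Real.exp (l ^ 2 * (2 * K) * ((n + 1 : ℕ) : ℝ))) /
        ENNReal.ofReal (Real.exp (l * (14 * Real.log T * q))) := by gcongr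
    _ ≤ _ := by
        rw [← ENNReal.ofReal_div_of_pos hθ, ← Real.exp_sub]
        apply ENNReal.ofReal_le_ofReal
        apply Real.exp_le_exp.2
        have e1 : l * (14 * Real.log T * q) = 7 * Real.log T := by rw [hl]; field_simp; ring
        have e2 : l ^ 2 * (2 * K) * ((n + 1 : ℕ) : ℝ) ≤ 1 := by
          rw [hl, div_pow, one_pow, mul_assoc, one_div_mul_eq_div, div_le_one (by positivity)]
          push_cast
          nlinarith
        linarith

end Concentration

/-! ### The replay schedule -/

section Schedule

/-- The law of the replay schedules of all episodes. -/
def scheduleLaw : Measure (ℕ × ℕ × ℕ → Bool) :=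
  Measure.infinitePi fun i : ℕ × ℕ × ℕ =>
    bernoulliMeasure true false (replayProb i.1 i.2.1 i.2.2)

instance : IsProbabilityMeasure scheduleLaw := by unfold scheduleLaw; infer_instance

theorem scheduleLaw_forall_false_le (e : ℕ) (m : ℕ → ℕ) (S : Finset ℕ) :
    scheduleLaw {B | ∀ u ∈ S, B (e, u, m u) = false} ≤
      ENNReal.ofReal (Real.exp (-∑ u ∈ S, (replayProb e u (m u) : ℝ))) := by
  have hinj : Set.InjOn (fun u => (e, u, m u)) (S : Set ℕ) := by
    intro a _ b _ h
    simp only [Prod.mk.injEq] at h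
    exact h.2.1
  have hset : {B : ℕ × ℕ × ℕ → Bool | ∀ u ∈ S, B (e, u, m u) = false} =
      ((S.image fun u => (e, u, m u) : Finset (ℕ × ℕ × ℕ)) : Set (ℕ × ℕ × ℕ)).pi
        fun _ => {false} := by
    ext B
    simp [Set.mem_pi]
  rw [hset, scheduleLaw, Measure.infinitePi_pi _ fun i _ => measurableSet_singleton _,
    Finset.prod_image hinj, ← Finset.sum_neg_distrib, Real.exp_sum,
    ENNReal.ofReal_prod_of_nonneg fun i _ => Real.exp_nonneg _]
  refine Finset.prod_le_prod' fun u _ => ?_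
  rw [← ENNReal.ofReal_toReal (measure_ne_top (bernoulliMeasure true false _) {false})]
  apply ENNReal.ofReal_le_ofReal
  have h := bernoulliMeasure_real_apply_of_notMem_of_mem (x := true) (y := false) (s := {false})
    (replayProb e u (m u)) (measurableSet_singleton _) (by simp) rfl
  rw [← measureReal_def, h]
  have := Real.add_one_le_exp (-(replayProb e u (m u) : ℝ))
  linarith

/-- The exponential moment of a weighted Bernoulli variable of the schedule, from
`exp y ≤ 1 + 2 y` on `[0, 1]`. -/
theorem mgf_schedule_le {w c : ℝ} (hw : 0 < w) (hc : 0 ≤ c) (hcw : c ≤ w) (i : ℕ × ℕ × ℕ) :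
    mgf (fun B : ℕ × ℕ × ℕ → Bool => if B i = true then c / w else 0) scheduleLaw 1 ≤
      Real.exp (2 / w * ((replayProb i.1 i.2.1 i.2.2 : ℝ) * c)) := by
  set p := replayProb i.1 i.2.1 i.2.2 with hp
  have h1 : mgf (fun B : ℕ × ℕ × ℕ → Bool => if B i = true then c / w else 0) scheduleLaw 1 =
      ∫ b, Real.exp (if b = true then c / w else 0) ∂(bernoulliMeasure true false p) := by
    have h2 := measurePreserving_eval_infinitePi (fun i : ℕ × ℕ × ℕ =>
      bernoulliMeasure true false (replayProb i.1 i.2.1 i.2.2)) i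
    rw [mgf, scheduleLaw, hp, ← h2.map_eq,
      integral_map h2.measurable.aemeasurable (measurable_of_finite _).aestronglyMeasurable]
    simp only [one_mul, Function.eval]
  rw [h1, integral_bernoulliMeasure]
  simp only [if_true, Bool.false_eq_true, if_false, Real.exp_zero, smul_eq_mul, mul_one]
  have h3 : 0 ≤ c / w := by positivity
  have h4 : c / w ≤ 1 := (div_le_one hw).2 hcw
  have h5 : Real.exp (c / w) ≤ 1 + 2 * (c / w) := by
    have := (abs_le.1 (Real.abs_exp_sub_one_sub_id_le (x := c / w)
      (by rw [abs_of_nonneg h3]; exact h4))).2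
    nlinarith
  have h6 := Real.add_one_le_exp (2 / w * ((p : ℝ) * c))
  have h7 : 0 ≤ (p : ℝ) := p.2.1
  have h8 : 2 / w * ((p : ℝ) * c) = (p : ℝ) * (2 * (c / w)) := by field_simp
  have h9 := mul_le_mul_of_nonneg_left h5 h7
  linarith

/-- Chernoff's bound for weighted sums of the variables of the replay schedule. -/
theorem scheduleLaw_weighted_sum_le (I : Finset (ℕ × ℕ × ℕ)) (c : ℕ × ℕ × ℕ → ℝ) {w M x : ℝ}
    (hw : 0 < w) (hc : ∀ i, 0 ≤ c i) (hcw : ∀ i, c i ≤ w)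
    (hM : ∑ i ∈ I, (replayProb i.1 i.2.1 i.2.2 : ℝ) * c i ≤ M) :
    scheduleLaw.real {B | 2 * M + w * x ≤ ∑ i ∈ I, if B i = true then c i else 0} ≤
      Real.exp (-x) := by
  set X : ℕ × ℕ × ℕ → (ℕ × ℕ × ℕ → Bool) → ℝ := fun i B => if B i = true then c i / w else 0
    with hX
  have hXm : ∀ i, Measurable (X i) := fun i =>
    (measurable_of_finite fun b : Bool => if b = true then c i / w else (0 : ℝ)).comp
      (measurable_pi_apply i)
  have hind : iIndepFun X scheduleLaw :=
    iIndepFun_infinitePi (X := fun i b => if b = true then c i / w else (0 : ℝ))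
      fun i => measurable_of_finite _
  have hint : Integrable (fun B => Real.exp (1 * (∑ i ∈ I, X i) B)) scheduleLaw := by
    have hm : Measurable (∑ i ∈ I, X i) := by
      simpa only [Finset.sum_fn] using Finset.measurable_sum I fun i _ => hXm i
    refine Integrable.of_bound (Real.measurable_exp.comp
      (hm.const_mul 1)).aestronglyMeasurable (Real.exp (∑ i ∈ I, c i / w))
      (Filter.Eventually.of_forall fun B => ?_)
    rw [Real.norm_eq_abs, Real.abs_exp, one_mul, Finset.sum_apply]
    apply Real.exp_le_exp.2
    refine Finset.sum_le_sum fun i _ => ?_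
    have := div_nonneg (hc i) hw.le
    simp only [hX]
    split_ifs <;> linarith
  have hch := measure_ge_le_exp_mul_mgf (μ := scheduleLaw) (X := ∑ i ∈ I, X i) (t := 1)
    (2 / w * M + x) zero_le_one hint
  have hset : {B : ℕ × ℕ × ℕ → Bool | 2 * M + w * x ≤ ∑ i ∈ I, if B i = true then c i else 0} =
      {B | 2 / w * M + x ≤ (∑ i ∈ I, X i) B} := by
    ext B
    have h1 : (∑ i ∈ I, X i) B = (∑ i ∈ I, if B i = true then c i else 0) / w := by
      rw [Finset.sum_apply, Finset.sum_div]
      refine Finset.sum_congr rfl fun i _ => ?_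
      simp only [hX]
      split_ifs <;> simp
    have h2 : 2 / w * M + x = (2 * M + w * x) / w := by field_simp
    simp only [Set.mem_ofPred_eq]
    rw [h1, h2, div_le_div_iff_of_pos_right hw]
  rw [hset]
  refine hch.trans ?_
  rw [hind.mgf_sum hXm]
  calc _ ≤ Real.exp (-1 * (2 / w * M + x)) *
        ∏ i ∈ I, Real.exp (2 / w * ((replayProb i.1 i.2.1 i.2.2 : ℝ) * c i)) := by
        apply mul_le_mul_of_nonneg_left _ (Real.exp_nonneg _)
        exact Finset.prod_le_prod (fun i _ => mgf_nonneg)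
          fun i _ => mgf_schedule_le hw (hc i) (hcw i) i
    _ = Real.exp (-1 * (2 / w * M + x) +
        2 / w * ∑ i ∈ I, (replayProb i.1 i.2.1 i.2.2 : ℝ) * c i) := by
        rw [← Real.exp_sum, ← Real.exp_add, Finset.mul_sum]
    _ ≤ _ := by
        apply Real.exp_le_exp.2
        have := mul_le_mul_of_nonneg_left hM (by positivity : 0 ≤ 2 / w)
        linarith

theorem replayCost_nonneg (s m l : ℕ) : 0 ≤ replayCost s m l :=
  Finset.sum_nonneg fun _ _ => by positivity

theorem replayCost_le_sqrt_length (s m l : ℕ) : replayCost s m l ≤ 2 * √((m : ℝ) + 1) := by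
  refine (sum_inv_sqrt_sub_left_le _ s fun r hr =>
    (Finset.mem_Icc.1 (Finset.mem_filter.1 hr).1).1).trans ?_
  gcongr
  have : ((Finset.Icc s l).filter fun r => r ≤ s + m).card ≤ m + 1 := by
    refine (Finset.card_le_card (t := Finset.Icc s (s + m)) fun r hr => ?_).trans
      (by rw [Nat.card_Icc]; omega)
    rw [Finset.mem_filter, Finset.mem_Icc] at hr
    exact Finset.mem_Icc.2 ⟨hr.1.1, hr.2⟩
  exact_mod_cast this

theorem replayCost_le_sqrt_rest (s m l : ℕ) : replayCost s m l ≤ 2 * √((l + 1 - s : ℕ) : ℝ) := by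
  refine (sum_inv_sqrt_sub_left_le _ s fun r hr =>
    (Finset.mem_Icc.1 (Finset.mem_filter.1 hr).1).1).trans ?_
  gcongr
  refine (Finset.card_filter_le _ _).trans ?_
  rw [Nat.card_Icc]

/-- The expected cost of a scheduled replay does not depend on its length: a replay of length `m`
costs `√m` and has a probability proportional to `1 / √m`. -/
theorem replayProb_mul_replayCost_le {e s m l : ℕ} (hs : e < s) (hm : 1 ≤ m) :
    (replayProb e s m : ℝ) * replayCost s m l ≤ 3 * (1 / √(((s - (e + 1) : ℕ) : ℝ) + 1)) := by
  have hm' : (1 : ℝ) ≤ m := by exact_mod_cast hm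
  have hse : ((s - (e + 1) : ℕ) : ℝ) + 1 = ((s - e : ℕ) : ℝ) := by
    have : s - (e + 1) + 1 = s - e := by omega
    exact_mod_cast this
  have hse0 : (0 : ℝ) < ((s - e : ℕ) : ℝ) := by exact_mod_cast (by omega : 0 < s - e)
  rw [hse]
  simp only [replayProb]
  have h1 := replayCost_le_sqrt_length s m l
  have h2 : 2 * √((m : ℝ) + 1) ≤ 3 * √(m : ℝ) := by
    apply le_of_sq_le_sq _ (by positivity)
    rw [mul_pow, mul_pow, Real.sq_sqrt (by positivity), Real.sq_sqrt (by positivity)]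
    nlinarith
  have hsm : 0 < √(m : ℝ) := Real.sqrt_pos.2 (by linarith)
  have hss : 0 < √((s - e : ℕ) : ℝ) := Real.sqrt_pos.2 hse0
  rw [Real.sqrt_mul (by positivity), one_div_mul_eq_div, mul_one_div,
    div_le_div_iff₀ (by positivity) hss]
  nlinarith

theorem card_replayLengths_le (T : ℕ) (hT : 2 ≤ T) :
    ((replayLengths T).card : ℝ) ≤ 3 * Real.log T := by
  have h1 : (replayLengths T).card ≤ Nat.clog 2 T := by
    refine Finset.card_image_le.trans ?_
    rw [Nat.card_Icc, Nat.add_sub_cancel]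
  have h2 : 2 ^ (Nat.clog 2 T - 1) < T := Nat.pow_pred_clog_lt_self (by norm_num) (by omega)
  have h3 : ((Nat.clog 2 T - 1 : ℕ) : ℝ) * Real.log 2 ≤ Real.log T := by
    rw [← Real.log_pow]
    exact Real.log_le_log (by positivity) (by exact_mod_cast h2.le)
  have h4 : (Nat.clog 2 T : ℝ) ≤ ((Nat.clog 2 T - 1 : ℕ) : ℝ) + 1 := by
    exact_mod_cast (by omega : Nat.clog 2 T ≤ Nat.clog 2 T - 1 + 1)
  have h5 := Real.log_two_gt_d9
  have h6 := two_thirds_le_log hT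
  have h7 : ((replayLengths T).card : ℝ) ≤ Nat.clog 2 T := by exact_mod_cast h1
  have h8 : (0 : ℝ) ≤ ((Nat.clog 2 T - 1 : ℕ) : ℝ) := by positivity
  nlinarith

theorem one_le_of_mem_replayLengths {T m : ℕ} (hm : m ∈ replayLengths T) : 1 ≤ m := by
  obtain ⟨n, -, rfl⟩ := Finset.mem_image.1 hm
  exact Nat.one_le_two_pow

/-- With high probability the scheduled replays of an episode are not too costly. -/
theorem scheduleLaw_replays_le {T : ℕ} (hT : 2 ≤ T) (e l : ℕ) :
    scheduleLaw {B | 50 * Real.log T * √((l - e : ℕ) : ℝ) < ∑ s ∈ Finset.Ioc e l,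
      ∑ m ∈ replayLengths T, (if B (e, s, m) = true then replayCost s m l else 0)} ≤
      ENNReal.ofReal (Real.exp (-(6 * Real.log T))) := by
  have hlg := two_thirds_le_log hT
  rcases Nat.lt_or_ge e l with hel | hel
  swap
  · rw [Finset.Ioc_eq_empty_of_le hel]
    simp only [Finset.sum_empty]
    have : {B : ℕ × ℕ × ℕ → Bool | 50 * Real.log T * √((l - e : ℕ) : ℝ) < 0} = ∅ := by
      ext B
      simp only [Set.mem_ofPred_eq, Set.mem_empty_iff_false, iff_false, not_lt]
      positivity
    rw [this]
    simp
  set W := √((l - e : ℕ) : ℝ) with hW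
  have hW0 : 0 < W := Real.sqrt_pos.2 (by exact_mod_cast (by omega : 0 < l - e))
  set I : Finset (ℕ × ℕ × ℕ) := (Finset.Ioc e l ×ˢ replayLengths T).image fun q => (e, q)
    with hI
  have hinj : Set.InjOn (fun q : ℕ × ℕ => (e, q))
      ((Finset.Ioc e l ×ˢ replayLengths T : Finset (ℕ × ℕ)) : Set (ℕ × ℕ)) := by
    intro a _ b _ h
    simpa using h
  set c : ℕ × ℕ × ℕ → ℝ := fun i =>
    if e < i.2.1 ∧ i.2.1 ≤ l then replayCost i.2.1 i.2.2 l else 0 with hcdef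
  have hsum : ∀ f : ℕ → ℕ → ℝ → ℝ, ∑ i ∈ I, f i.2.1 i.2.2 (c i) = ∑ s ∈ Finset.Ioc e l,
      ∑ m ∈ replayLengths T, f s m (replayCost s m l) := by
    intro f
    rw [hI, Finset.sum_image hinj, Finset.sum_product]
    refine Finset.sum_congr rfl fun s hs => Finset.sum_congr rfl fun m _ => ?_
    rw [Finset.mem_Ioc] at hs
    simp only [hcdef]
    rw [if_pos hs]
  have hsumP : ∑ i ∈ I, (replayProb i.1 i.2.1 i.2.2 : ℝ) * c i = ∑ s ∈ Finset.Ioc e l,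
      ∑ m ∈ replayLengths T, (replayProb e s m : ℝ) * replayCost s m l := by
    rw [← hsum fun s m x => (replayProb e s m : ℝ) * x]
    refine Finset.sum_congr rfl fun i hi => ?_
    obtain ⟨q, -, rfl⟩ := Finset.mem_image.1 hi
    rfl
  have hM : ∑ i ∈ I, (replayProb i.1 i.2.1 i.2.2 : ℝ) * c i ≤ 18 * Real.log T * W := by
    rw [hsumP]
    calc _ ≤ ∑ s ∈ Finset.Ioc e l, ∑ m ∈ replayLengths T,
          3 * (1 / √(((s - (e + 1) : ℕ) : ℝ) + 1)) :=
          Finset.sum_le_sum fun s hs => Finset.sum_le_sum fun m hm =>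
            replayProb_mul_replayCost_le (Finset.mem_Ioc.1 hs).1 (one_le_of_mem_replayLengths hm)
      _ = (replayLengths T).card * (3 * ∑ s ∈ Finset.Ioc e l,
          1 / √(((s - (e + 1) : ℕ) : ℝ) + 1)) := by
          simp only [Finset.sum_const, nsmul_eq_mul, ← Finset.mul_sum]
      _ ≤ (3 * Real.log T) * (3 * (2 * W)) := by
          have h1 := sum_inv_sqrt_sub_left_le (Finset.Ioc e l) (e + 1)
            fun r hr => (Finset.mem_Ioc.1 hr).1
          rw [Nat.card_Ioc] at h1
          have h2 := card_replayLengths_le T hT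
          have h3 : 0 ≤ ∑ s ∈ Finset.Ioc e l, 1 / √(((s - (e + 1) : ℕ) : ℝ) + 1) :=
            Finset.sum_nonneg fun _ _ => by positivity
          gcongr
      _ = _ := by ring
  have hch := scheduleLaw_weighted_sum_le I c (w := 2 * W) (M := 18 * Real.log T * W)
    (x := 6 * Real.log T) (by positivity) (fun i => ?_) (fun i => ?_) hM
  · have hsub : {B : ℕ × ℕ × ℕ → Bool | 50 * Real.log T * W < ∑ s ∈ Finset.Ioc e l,
        ∑ m ∈ replayLengths T, (if B (e, s, m) = true then replayCost s m l else 0)} ⊆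
        {B | 2 * (18 * Real.log T * W) + 2 * W * (6 * Real.log T) ≤
          ∑ i ∈ I, if B i = true then c i else 0} := by
      intro B hB
      simp only [Set.mem_ofPred_eq] at hB ⊢
      have h1 : ∑ i ∈ I, (if B i = true then c i else 0) = ∑ s ∈ Finset.Ioc e l,
          ∑ m ∈ replayLengths T, (if B (e, s, m) = true then replayCost s m l else 0) := by
        rw [← hsum fun s m x => if B (e, s, m) = true then x else 0]
        refine Finset.sum_congr rfl fun i hi => ?_
        obtain ⟨q, -, rfl⟩ := Finset.mem_image.1 hi
        rfl
      rw [h1]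
      have : 0 < Real.log T * W := by positivity
      linarith
    refine (measure_mono hsub).trans ?_
    rw [← ENNReal.ofReal_toReal (measure_ne_top scheduleLaw _)]
    exact ENNReal.ofReal_le_ofReal hch
  · simp only [hcdef]
    split_ifs
    · exact replayCost_nonneg _ _ _
    · exact le_rfl
  · simp only [hcdef]
    split_ifs with h
    · refine (replayCost_le_sqrt_rest _ _ _).trans ?_
      have : ((l + 1 - i.2.1 : ℕ) : ℝ) ≤ ((l - e : ℕ) : ℝ) := by
        exact_mod_cast (by omega : l + 1 - i.2.1 ≤ l - e)
      exact mul_le_mul_of_nonneg_left (Real.sqrt_le_sqrt this) zero_le_two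
    · positivity

end Schedule

/-! ### The good event -/

section GoodEvent

variable {K : ℕ} [NeZero K] {ν : ℕ → Measure (Fin K → ℝ)}

theorem ae_draw_mem (hν : IsRewardLaw ν) :
    ∀ᵐ ω ∂(outcomeLaw ν hν), ∀ (r : ℕ) (A : Finset (Fin K)), A.Nonempty → ω.2.1 (r, A) ∈ A := by
  have := hν.isProbabilityMeasure
  rw [ae_all_iff]
  intro r
  rw [ae_all_iff]
  intro A
  by_cases hA : A.Nonempty
  swap
  · exact Filter.Eventually.of_forall fun _ h => absurd h hA
  have h1 : ∀ᵐ b ∂(armLaw A), b ∈ A := by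
    unfold armLaw
    rw [if_pos hA, ae_iff]
    have : {b | b ∉ A} = ((A : Set (Fin K)))ᶜ := rfl
    rw [this, uniformOn, cond_apply A.measurableSet]
    simp
  have h2 : ∀ᵐ p ∂((ν r).prod (armLaw A)), p.2 ∈ A :=
    Measure.quasiMeasurePreserving_snd.ae h1
  filter_upwards [(measurePreserving_round hν r A).quasiMeasurePreserving.ae h2] with ω hω _
  exact hω

/-- Outside an event of probability `O(1 / T)` the outcome is good. -/
theorem measure_not_goodOutcome_le (hν : IsRewardLaw ν) {T : ℕ} (hT : 2 ≤ T) (hKT : K ≤ T)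
    (J : ℕ → ℕ) (ε C₀ : ℝ) :
    outcomeLaw ν hν {ω | ¬ GoodOutcome (meanReward ν) T J ε C₀ ω} ≤ ENNReal.ofReal (5 / T) := by
  set P := outcomeLaw ν hν with hP
  set R := Finset.Icc 1 T with hR
  set H := 2 * (√C₀ + 14) with hH
  set μ := meanReward ν with hμ
  set D : ℕ × ℕ × Fin K × Fin K → Set (Outcome K) := fun i =>
    {ω | i.1 ∈ R ∧ i.1 < i.2.1 ∧ 14 * Real.log T * devScale K (i.2.1 - i.1) <
      ∑ s ∈ Finset.Icc i.1 i.2.1, (runEstimate C₀ T ω s i.2.2.1 i.2.2.2 -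
        meanEstimate (μ s) (armsAt C₀ T ω s) i.2.2.1 i.2.2.2)} with hD
  set E : ℕ × ℕ × Fin K → Set (Outcome K) := fun i =>
    {ω | 6 * Real.log T ≤ ∑ u ∈ detectionRounds μ T J ε H i.1 i.2.1 i.2.2,
        (replayProb i.1 u (detectionLength K T H (gap μ u i.2.2)) : ℝ) ∧
      ∀ u ∈ detectionRounds μ T J ε H i.1 i.2.1 i.2.2,
        ω.2.2 (i.1, u, detectionLength K T H (gap μ u i.2.2)) = false} with hE
  set F : ℕ × ℕ → Set (Outcome K) := fun i =>
    {ω | 50 * Real.log T * √((i.2 - i.1 : ℕ) : ℝ) < ∑ s ∈ Finset.Ioc i.1 i.2,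
      ∑ m ∈ replayLengths T, (if ω.2.2 (i.1, s, m) = true then replayCost s m i.2 else 0)} with hF
  set N : Set (Outcome K) :=
    {ω | ¬ ∀ (r : ℕ) (A : Finset (Fin K)), A.Nonempty → ω.2.1 (r, A) ∈ A} with hN
  have hcover : {ω | ¬ GoodOutcome μ T J ε C₀ ω} ⊆
      N ∪ ((⋃ i ∈ R ×ˢ R ×ˢ (Finset.univ : Finset (Fin K)) ×ˢ (Finset.univ : Finset (Fin K)), D i) ∪
        ((⋃ i ∈ R ×ˢ R ×ˢ (Finset.univ : Finset (Fin K)), E i) ∪ ⋃ i ∈ R ×ˢ R, F i)) := by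
    intro ω hω
    by_contra hcon
    simp only [Set.mem_union, Set.mem_iUnion, not_or, not_exists, Finset.mem_product,
      Finset.mem_univ, and_true] at hcon
    obtain ⟨h0, h1, h2, h3⟩ := hcon
    refine hω ⟨not_not.1 h0, ?_, ?_, ?_⟩
    · intro s₁ s₂ hs hs' hs2 a' a
      have hs1 : s₁ ∈ R := Finset.mem_Icc.2 (by omega)
      have hs2 : s₂ ∈ R := Finset.mem_Icc.2 (by omega)
      by_contra! hc
      exact h1 (s₁, s₂, a', a) ⟨hs1, hs2⟩ ⟨hs1, hs', hc⟩
    · intro e t he het htT a hsum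
      have hs1 : e ∈ R := Finset.mem_Icc.2 (by omega)
      have hs2 : t ∈ R := Finset.mem_Icc.2 (by omega)
      by_contra! hc
      exact h2 (e, t, a) ⟨hs1, hs2⟩ ⟨hsum, fun u hu => Bool.not_eq_true _ ▸ hc u hu⟩
    · intro e l he hel hlT
      have hs1 : e ∈ R := Finset.mem_Icc.2 (by omega)
      have hs2 : l ∈ R := Finset.mem_Icc.2 (by omega)
      by_contra! hc
      exact h3 (e, l) ⟨hs1, hs2⟩ hc
  have hT0 : (0 : ℝ) < T := by exact_mod_cast (by omega : 0 < T)
  have hT2 : (2 : ℝ) ≤ T := by exact_mod_cast hT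
  have hexp : ∀ n : ℕ, Real.exp (-(n * Real.log T)) = 1 / (T : ℝ) ^ n := by
    intro n
    rw [Real.exp_neg, Real.exp_nat_mul, Real.exp_log hT0, one_div]
  have hN0 : P N = 0 := ae_draw_mem hν
  have hDm : ∀ i, P (D i) ≤ ENNReal.ofReal (3 / (T : ℝ) ^ 7) := by
    rintro ⟨s₁, s₂, a', a⟩
    by_cases h : s₁ ∈ R ∧ s₁ < s₂
    · refine (measure_mono fun ω hω => hω.2.2).trans
        ((measure_deviation_le hν C₀ T (Finset.mem_Icc.1 h.1).1 h.2 a' a).trans ?_)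
      apply ENNReal.ofReal_le_ofReal
      have h7 := hexp 7
      have h8 := Real.exp_one_lt_d9
      rw [sub_eq_add_neg, Real.exp_add]
      push_cast at h7
      rw [h7, mul_one_div]
      gcongr
      linarith
    · have : D (s₁, s₂, a', a) = ∅ := by
        ext ω
        simp only [hD, Set.mem_empty_iff_false, iff_false]
        exact fun hω => h ⟨hω.1, hω.2.1⟩
      rw [this, measure_empty]
      exact zero_le
  have h6 := hexp 6
  push_cast at h6
  have hEm : ∀ i, P (E i) ≤ ENNReal.ofReal (1 / (T : ℝ) ^ 6) := by
    rintro ⟨e, t, a⟩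
    by_cases h : 6 * Real.log T ≤ ∑ u ∈ detectionRounds μ T J ε H e t a,
        (replayProb e u (detectionLength K T H (gap μ u a)) : ℝ)
    · have h1 := scheduleLaw_forall_false_le e (fun u => detectionLength K T H (gap μ u a))
        (detectionRounds μ T J ε H e t a)
      have h2 := (measurePreserving_schedule hν).measure_preimage_le
        {B : ℕ × ℕ × ℕ → Bool | ∀ u ∈ detectionRounds μ T J ε H e t a,
          B (e, u, detectionLength K T H (gap μ u a)) = false}
      refine (measure_mono fun ω hω => hω.2).trans (h2.trans (h1.trans ?_))
      rw [← h6]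
      exact ENNReal.ofReal_le_ofReal (Real.exp_le_exp.2 (neg_le_neg h))
    · have : E (e, t, a) = ∅ := by
        ext ω
        simp only [hE, Set.mem_empty_iff_false, iff_false]
        exact fun hω => h hω.1
      rw [this, measure_empty]
      exact zero_le
  have hFm : ∀ i, P (F i) ≤ ENNReal.ofReal (1 / (T : ℝ) ^ 6) := by
    rintro ⟨e, l⟩
    have h2 := (measurePreserving_schedule hν).measure_preimage_le
        {B | 50 * Real.log T * √((l - e : ℕ) : ℝ) < ∑ s ∈ Finset.Ioc e l,
          ∑ m ∈ replayLengths T, (if B (e, s, m) = true then replayCost s m l else 0)}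
    rw [← h6]
    exact h2.trans (scheduleLaw_replays_le hT e l)
  have hunion : ∀ {ι : Type} (I : Finset ι) (G : ι → Set (Outcome K)) (n : ℕ) (x : ℝ), 0 ≤ x →
      I.card ≤ T ^ n → (∀ i, P (G i) ≤ ENNReal.ofReal x) →
      P (⋃ i ∈ I, G i) ≤ ENNReal.ofReal ((T : ℝ) ^ n * x) := by
    intro ι I G n x hx hI hG
    refine (measure_biUnion_finset_le I G).trans ((Finset.sum_le_card_nsmul I _ _
      fun i _ => hG i).trans ?_)
    rw [nsmul_eq_mul, ENNReal.ofReal_mul (by positivity)]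
    gcongr
    rw [← ENNReal.ofReal_natCast]
    apply ENNReal.ofReal_le_ofReal
    exact_mod_cast hI
  have hRc : R.card = T := by rw [hR, Nat.card_Icc, Nat.add_sub_cancel]
  have hD' := hunion (R ×ˢ R ×ˢ (Finset.univ : Finset (Fin K)) ×ˢ (Finset.univ : Finset (Fin K)))
    D 4 _ (by positivity) (by
      simp only [Finset.card_product, hRc, Finset.card_univ, Fintype.card_fin]
      calc T * (T * (K * K)) ≤ T * (T * (T * T)) := by gcongr
        _ = _ := by ring) hDm
  have hE' := hunion (R ×ˢ R ×ˢ (Finset.univ : Finset (Fin K))) E 3 _ (by positivity) (by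
      simp only [Finset.card_product, hRc, Finset.card_univ, Fintype.card_fin]
      calc T * (T * K) ≤ T * (T * T) := by gcongr
        _ = _ := by ring) hEm
  have hF' := hunion (R ×ˢ R) F 2 _ (by positivity) (by
      simp only [Finset.card_product, hRc]
      exact (sq T).ge) hFm
  refine (measure_mono hcover).trans ((measure_union_le _ _).trans ?_)
  rw [hN0, zero_add]
  refine (measure_union_le _ _).trans ((add_le_add hD' ((measure_union_le _ _).trans
    (add_le_add hE' hF'))).trans ?_)
  rw [← ENNReal.ofReal_add (by positivity) (by positivity),
    ← ENNReal.ofReal_add (by positivity) (by positivity)]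
  apply ENNReal.ofReal_le_ofReal
  have hinv : (1 : ℝ) / T ≤ 1 := by
    rw [div_le_one hT0]
    linarith
  have hinv0 : (0 : ℝ) ≤ 1 / T := by positivity
  have e1 : (T : ℝ) ^ 4 * (3 / (T : ℝ) ^ 7) = 3 * (1 / T) * (1 / T) ^ 2 := by field_simp
  have e2 : (T : ℝ) ^ 3 * (1 / (T : ℝ) ^ 6) = 1 / T * (1 / T) ^ 2 := by field_simp
  have e3 : (T : ℝ) ^ 2 * (1 / (T : ℝ) ^ 6) = 1 / T * (1 / T) ^ 3 := by field_simp
  have b2 : (1 / (T : ℝ)) ^ 2 ≤ 1 := pow_le_one₀ hinv0 hinv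
  have b3 : (1 / (T : ℝ)) ^ 3 ≤ 1 := pow_le_one₀ hinv0 hinv
  have m2 := mul_le_mul_of_nonneg_left b2 hinv0
  have m3 := mul_le_mul_of_nonneg_left b3 hinv0
  rw [e1, e2, e3]
  have e4 : (5 : ℝ) / T = 5 * (1 / T) := by ring
  rw [e4]
  linarith

end GoodEvent

/-! ### The expected regret -/

section Expectation

variable {K : ℕ} [NeZero K] {ν : ℕ → Measure (Fin K → ℝ)}

theorem dynamicRegret_eq_integral (hν : IsRewardLaw ν) (C₀ : ℝ) (T : ℕ) :
    dynamicRegret (meanReward ν) (outcomeLaw ν hν) (metaArm C₀ T) T =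
      ∫ ω, ∑ r ∈ Finset.Icc 1 T, gap (meanReward ν) r (armDrawn C₀ T ω r) ∂(outcomeLaw ν hν) := by
  have hm : ∀ r, Measurable fun ω : Outcome K => meanReward ν r (armDrawn C₀ T ω r) :=
    fun r => (measurable_of_finite (meanReward ν r)).comp (measurable_armDrawn C₀ T r)
  have hint : Integrable (fun ω : Outcome K => ∑ r ∈ Finset.Icc 1 T,
      meanReward ν r (armDrawn C₀ T ω r)) (outcomeLaw ν hν) :=
    integrable_finsetSum _ fun r _ => Integrable.of_bound (hm r).aestronglyMeasurable 1
      (Filter.Eventually.of_forall fun ω => by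
        have h := meanReward_mem hν r (armDrawn C₀ T ω r)
        rw [Real.norm_eq_abs, abs_of_nonneg h.1]
        exact h.2)
  have h1 : ∀ ω : Outcome K, ∑ r ∈ Finset.Icc 1 T, gap (meanReward ν) r (armDrawn C₀ T ω r) =
      ∑ r ∈ Finset.Icc 1 T, (⨆ a, meanReward ν r a) -
        ∑ r ∈ Finset.Icc 1 T, meanReward ν r (armDrawn C₀ T ω r) := fun ω => by
    simp only [gap, Finset.sum_sub_distrib]
  have h2 : ∀ ω : Outcome K, ∑ r ∈ Finset.Icc 1 T, meanReward ν r (metaArm C₀ T r ω) =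
      ∑ r ∈ Finset.Icc 1 T, meanReward ν r (armDrawn C₀ T ω r) := fun ω =>
    Finset.sum_congr rfl fun r hr => by
      rw [metaArm_eq_armDrawn C₀ T ω (Finset.mem_Icc.1 hr).1]
  simp only [dynamicRegret, h1, h2]
  rw [integral_sub (integrable_const _) hint, integral_const, probReal_univ, one_smul]

theorem sum_gap_mem (hν : IsRewardLaw ν) (C₀ : ℝ) (T : ℕ) (ω : Outcome K) :
    ∑ r ∈ Finset.Icc 1 T, gap (meanReward ν) r (armDrawn C₀ T ω r) ∈ Set.Icc (0 : ℝ) T := by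
  refine ⟨Finset.sum_nonneg fun r _ => gap_nonneg r _, ?_⟩
  refine (Finset.sum_le_card_nsmul _ _ 1 fun r _ => gap_le_one (meanReward_mem hν) r _).trans ?_
  simp

theorem dynamicRegret_le_horizon (hν : IsRewardLaw ν) (C₀ : ℝ) (T : ℕ) :
    dynamicRegret (meanReward ν) (outcomeLaw ν hν) (metaArm C₀ T) T ≤ T := by
  rw [dynamicRegret_eq_integral]
  refine (integral_mono_of_nonneg (Filter.Eventually.of_forall fun ω => (sum_gap_mem hν C₀ T ω).1)
    (integrable_const (T : ℝ)) (Filter.Eventually.of_forall fun ω =>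
      (sum_gap_mem hν C₀ T ω).2)).trans ?_
  simp

/-- The expected regret in terms of a phasing: off the good event the regret is at most `T`. -/
theorem dynamicRegret_le_of_isPhasing (hν : IsRewardLaw ν) {T : ℕ} (hT : 2 ≤ T) (hKT : K ≤ T)
    {C₀ ε : ℝ} (hC : 400 ≤ C₀) {J : ℕ → ℕ} (hP : IsPhasing (meanReward ν) T J ε) :
    dynamicRegret (meanReward ν) (outcomeLaw ν hν) (metaArm C₀ T) T ≤
      10 * ε * T + 280 * (√C₀ + 14) * Real.log T ^ 2 * √((K : ℝ) * ((2 * J T + 1) * T)) + 5 := by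
  rw [dynamicRegret_eq_integral]
  set P := outcomeLaw ν hν
  set B := 10 * ε * T + 280 * (√C₀ + 14) * Real.log T ^ 2 * √((K : ℝ) * ((2 * J T + 1) * T))
  have hB : 0 ≤ B := by
    have := hP.pos
    positivity
  have hT0 : (0 : ℝ) < T := by exact_mod_cast (by omega : 0 < T)
  -- The good event itself need not be measurable.
  set S := toMeasurable P {ω | ¬ GoodOutcome (meanReward ν) T J ε C₀ ω} with hS
  have hSm : MeasurableSet S := measurableSet_toMeasurable _ _
  have hSP : P.real S ≤ 5 / T := by
    rw [measureReal_def, hS, measure_toMeasurable]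
    exact ENNReal.toReal_le_of_le_ofReal (by positivity)
      (measure_not_goodOutcome_le hν hT hKT J ε C₀)
  have hint : Integrable (S.indicator fun _ => (T : ℝ)) P :=
    (integrable_const _).indicator hSm
  calc _ ≤ ∫ ω, (B + S.indicator (fun _ => (T : ℝ)) ω) ∂P := by
        refine integral_mono_of_nonneg
          (Filter.Eventually.of_forall fun ω => (sum_gap_mem hν C₀ T ω).1)
          ((integrable_const _).add hint) (Filter.Eventually.of_forall fun ω => ?_)
        by_cases hω : ω ∈ S
        · simp only [Set.indicator_of_mem hω]
          linarith [(sum_gap_mem hν C₀ T ω).2]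
        · simp only [Set.indicator_of_notMem hω, add_zero]
          have hG : GoodOutcome (meanReward ν) T J ε C₀ ω := by
            by_contra h
            exact hω (subset_toMeasurable _ _ h)
          exact good_regret_le (meanReward_mem hν) hC hT hP hG
    _ = B + P.real S * T := by
        rw [integral_add (integrable_const _) hint, integral_const, probReal_univ, one_smul,
          integral_indicator_const _ hSm, smul_eq_mul]
    _ ≤ B + 5 := by
        have := mul_le_mul_of_nonneg_right hSP hT0.le
        rw [div_mul_cancel₀ _ hT0.ne'] at this
        linarith

end Expectation

/-! ### Phases of small variation -/

section Phases

variable {K : ℕ} (μ : ℕ → Fin K → ℝ)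

theorem totalVariation_succ {r : ℕ} (hr : 1 ≤ r) :
    totalVariation μ (r + 1) = totalVariation μ r + ⨆ a, |μ (r + 1) a - μ r a| := by
  unfold totalVariation
  rw [Finset.sum_Icc_succ_top (by omega), Nat.add_sub_cancel]

theorem totalVariation_mono : Monotone (totalVariation μ) := fun _ _ h =>
  Finset.sum_le_sum_of_subset_of_nonneg (Finset.Icc_subset_Icc le_rfl h)
    fun _ _ _ => Real.iSup_nonneg fun _ => abs_nonneg _

theorem totalVariation_nonneg (r : ℕ) : 0 ≤ totalVariation μ r :=
  Finset.sum_nonneg fun _ _ => Real.iSup_nonneg fun _ => abs_nonneg _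

theorem abs_sub_le_totalVariation {r r' : ℕ} (hr : 1 ≤ r) (h : r ≤ r') (a : Fin K) :
    |μ r a - μ r' a| ≤ totalVariation μ r' - totalVariation μ r := by
  induction r', h using Nat.le_induction with
  | base => simp
  | succ n hn ih =>
    have h1 := le_ciSup (Set.finite_range fun a => |μ (n + 1) a - μ n a|).bddAbove a
    have h2 := abs_sub_le (μ r a) (μ n a) (μ (n + 1) a)
    rw [abs_sub_comm (μ n a)] at h2
    rw [totalVariation_succ μ (hr.trans hn)]
    linarith

/-- The phase of round `r`: a new phase begins when `T / x` rounds have passed, or when the mean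
rewards have varied by `ε`. -/
def phaseIndex (T : ℕ) (x ε : ℝ) (r : ℕ) : ℕ :=
  ⌊(r : ℝ) * x / T⌋₊ + ⌊totalVariation μ r / ε⌋₊

theorem phaseIndex_mono (T : ℕ) {x ε : ℝ} (hx : 0 ≤ x) (hε : 0 ≤ ε) :
    Monotone (phaseIndex μ T x ε) := fun r r' h => by
  have h1 : (r : ℝ) ≤ r' := by exact_mod_cast h
  have h2 := totalVariation_mono μ h
  unfold phaseIndex
  gcongr

theorem sub_lt_one_of_floor_eq {u v : ℝ} (hu : 0 ≤ u) (h : ⌊u⌋₊ = ⌊v⌋₊) : v - u < 1 := by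
  have h1 := Nat.floor_le hu
  have h2 := Nat.lt_floor_add_one v
  rw [← h] at h2
  linarith

/-- The phases of length at most `T / x` in which the mean rewards vary by less than
`ε = √(K x / T)`; at this value a gap `ε` is as large as the noise `√(K / n)` at `n = T / x`. -/
theorem isPhasing_phaseIndex [NeZero K] {T : ℕ} (hT : 1 ≤ T) {x : ℝ} (hx : 0 < x) :
    IsPhasing μ T (phaseIndex μ T x √(K * x / T)) √(K * x / T) := by
  have hK : (0 : ℝ) < K := by exact_mod_cast Nat.pos_of_neZero K
  have hT0 : (0 : ℝ) < T := by exact_mod_cast hT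
  set ε := √(K * x / T) with hε
  have hε0 : 0 < ε := Real.sqrt_pos.2 (by positivity)
  have key : ∀ r r' : ℕ, r ≤ r' → phaseIndex μ T x ε r = phaseIndex μ T x ε r' →
      totalVariation μ r' - totalVariation μ r ≤ ε ∧ ((r' - r : ℕ) : ℝ) * x ≤ T := by
    intro r r' h hJ
    have h0 : (r : ℝ) ≤ r' := by exact_mod_cast h
    have h1 : ⌊(r : ℝ) * x / T⌋₊ ≤ ⌊(r' : ℝ) * x / T⌋₊ := by gcongr
    have h2 : ⌊totalVariation μ r / ε⌋₊ ≤ ⌊totalVariation μ r' / ε⌋₊ := by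
      have := totalVariation_mono μ h
      gcongr
    unfold phaseIndex at hJ
    have h3 := sub_lt_one_of_floor_eq (by positivity)
      (by omega : ⌊(r : ℝ) * x / T⌋₊ = ⌊(r' : ℝ) * x / T⌋₊)
    have h4 := sub_lt_one_of_floor_eq (div_nonneg (totalVariation_nonneg μ r) hε0.le)
      (by omega : ⌊totalVariation μ r / ε⌋₊ = ⌊totalVariation μ r' / ε⌋₊)
    rw [← sub_div, div_lt_one (by positivity)] at h3 h4
    rw [Nat.cast_sub h]
    exact ⟨h4.le, by linarith⟩
  refine ⟨hε0, phaseIndex_mono μ T hx.le hε0.le, fun r r' hr h _ hJ a =>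
    (abs_sub_le_totalVariation μ hr h a).trans (key r r' h hJ).1, fun r r' _ h _ hJ => ?_⟩
  have h1 := (key r r' h hJ).2
  set n : ℝ := ((r' - r : ℕ) : ℝ)
  have hn : 0 ≤ n := Nat.cast_nonneg _
  apply Real.le_sqrt_of_sq_le
  rw [mul_pow, hε, Real.sq_sqrt (by positivity)]
  have h2 : K * x / T * n ^ 2 = K * n * (n * x / T) := by ring
  have h3 : n * x / T ≤ 1 := (div_le_one hT0).2 h1
  rw [h2]
  exact mul_le_of_le_one_right (by positivity) h3

/-- The number of phases is at most of order `x` if the total variation is at most `x ε`. -/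
theorem phaseIndex_horizon_le {T : ℕ} (hT : 1 ≤ T) {x ε : ℝ} (hx : 0 ≤ x) (hε : 0 < ε)
    (hV : totalVariation μ T ≤ x * ε) : (phaseIndex μ T x ε T : ℝ) ≤ 2 * x := by
  have hT0 : (T : ℝ) ≠ 0 := by exact_mod_cast (by omega : T ≠ 0)
  have h1 : (T : ℝ) * x / T = x := by field_simp
  have h2 := Nat.floor_le hx
  have h3 := Nat.floor_le (div_nonneg (totalVariation_nonneg μ T) hε.le)
  have h4 : totalVariation μ T / ε ≤ x := (div_le_iff₀ hε).2 hV
  unfold phaseIndex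
  rw [h1]
  push_cast
  linarith

end Phases

/-! ### The bound by the total variation -/

section TotalVariation

variable {K : ℕ} [NeZero K] {ν : ℕ → Measure (Fin K → ℝ)}

/-- The regret is of order `√(K x T)` up to logarithms if the total variation is so small that about
`x` phases suffice. -/
theorem dynamicRegret_le_sqrt (hν : IsRewardLaw ν) {T : ℕ} (hT : 2 ≤ T) (hKT : K ≤ T)
    {C₀ : ℝ} (hC : 400 ≤ C₀) {x : ℝ} (hx : 1 ≤ x)
    (hV : totalVariation (meanReward ν) T ≤ x * √(K * x / T)) :
    dynamicRegret (meanReward ν) (outcomeLaw ν hν) (metaArm C₀ T) T ≤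
      (15 + 840 * (√C₀ + 14) * Real.log T ^ 2) * √(K * x * T) := by
  have hK : (1 : ℝ) ≤ K := by exact_mod_cast Nat.pos_of_neZero K
  have hT1 : (1 : ℝ) ≤ T := by exact_mod_cast (by omega : 1 ≤ T)
  have hε : 0 < √(K * x / T) := Real.sqrt_pos.2 (by positivity)
  have h1 := dynamicRegret_le_of_isPhasing hν hT hKT hC
    (isPhasing_phaseIndex (meanReward ν) (T := T) (by omega) (x := x) (by linarith))
  have h2 := phaseIndex_horizon_le (meanReward ν) (by omega : 1 ≤ T) (by linarith) hε hV
  set j : ℝ := (phaseIndex (meanReward ν) T x √(K * x / T) T : ℝ)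
  have h3 : √(K * x / T) * T = √(K * x * T) := by
    rw [← Real.sqrt_sq (by positivity : 0 ≤ √(K * x / T) * T), mul_pow,
      Real.sq_sqrt (by positivity)]
    congr 1
    field_simp
  have h4 : √((K : ℝ) * ((2 * j + 1) * T)) ≤ 3 * √(K * x * T) := by
    rw [← Real.sqrt_sq (by norm_num : (0 : ℝ) ≤ 3), ← Real.sqrt_mul (by norm_num)]
    apply Real.sqrt_le_sqrt
    calc (K : ℝ) * ((2 * j + 1) * T) ≤ K * (9 * x * T) := by
          gcongr
          linarith
      _ = _ := by ring
  have h5 : 1 ≤ √(K * x * T) :=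
    Real.one_le_sqrt.2 (one_le_mul_of_one_le_of_one_le (one_le_mul_of_one_le_of_one_le hK hx) hT1)
  have h6 : 0 ≤ 280 * (√C₀ + 14) * Real.log T ^ 2 := by positivity
  have h7 := mul_le_mul_of_nonneg_left h4 h6
  rw [mul_assoc 10, h3] at h1
  linarith

/-- The number of phases is balanced so that `K x T` is the maximum of `K T` and of
`(K V)^(2/3) T^(4/3)`. -/
theorem exists_phase_number {K T V : ℝ} (hK : 0 < K) (hT : 0 < T) (hV : 0 ≤ V) :
    ∃ x, 1 ≤ x ∧ V ≤ x * √(K * x / T) ∧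
      √(K * x * T) ≤ √(K * T) + (K * V) ^ ((1 : ℝ) / 3) * T ^ ((2 : ℝ) / 3) := by
  set z := (K * V) ^ ((1 : ℝ) / 3) * T ^ ((2 : ℝ) / 3) with hz
  have hz0 : 0 ≤ z := by positivity
  have hz3 : z ^ 3 = K * V * T ^ 2 := by
    rw [hz, mul_pow, ← Real.rpow_mul_natCast (by positivity), ← Real.rpow_mul_natCast hT.le]
    norm_num
  refine ⟨max 1 (z ^ 2 / (K * T)), le_max_left _ _, ?_, ?_⟩
  · set x := max 1 (z ^ 2 / (K * T)) with hx
    have hx1 : 1 ≤ x := le_max_left _ _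
    have hx2 : z ^ 2 / (K * T) ≤ x := le_max_right _ _
    have hx3 := pow_le_pow_left₀ (by positivity) hx2 3
    have h1 : (z ^ 2 / (K * T)) ^ 3 = V ^ 2 * T / K := by
      rw [div_pow, ← pow_mul, mul_comm 2 3, pow_mul, hz3]
      field_simp
    apply le_of_sq_le_sq _ (by positivity)
    rw [mul_pow, Real.sq_sqrt (by positivity)]
    rw [h1, div_le_iff₀ hK] at hx3
    have h2 : x ^ 2 * (K * x / T) = x ^ 3 * K / T := by ring
    rw [h2, le_div_iff₀ hT]
    exact hx3
  · have h1 : K * max 1 (z ^ 2 / (K * T)) * T = max (K * T) (z ^ 2) := by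
      rw [mul_right_comm, mul_max_of_nonneg _ _ (by positivity), mul_one,
        mul_div_cancel₀ _ (by positivity)]
    rw [h1]
    rcases max_cases (K * T) (z ^ 2) with h | h
    · rw [h.1]
      linarith
    · rw [h.1, Real.sqrt_sq hz0]
      linarith [Real.sqrt_nonneg (K * T)]

end TotalVariation

end SwitchingBandit

end

theorem corollary2 :
    ∃ c₀ : ℝ, 0 < c₀ ∧ ∀ C₀ : ℝ, c₀ ≤ C₀ → ∃ C : ℝ, 0 < C ∧
      ∀ (K T : ℕ) [NeZero K], 2 ≤ T →
      ∀ (ν : ℕ → MeasureTheory.Measure (Fin K → ℝ)) (hν : SwitchingBandit.IsRewardLaw ν),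
        SwitchingBandit.dynamicRegret (SwitchingBandit.meanReward ν)
            (SwitchingBandit.outcomeLaw ν hν) (SwitchingBandit.metaArm C₀ T) T
          ≤ C * Real.log T ^ 3 *
            (√((K : ℝ) * T) +
              ((K : ℝ) * SwitchingBandit.totalVariation (SwitchingBandit.meanReward ν) T)
                  ^ ((1 : ℝ) / 3) * (T : ℝ) ^ ((2 : ℝ) / 3)) := by
  refine ⟨400, by norm_num, fun C₀ hC => ⟨60 + 1260 * (√C₀ + 14), by positivity, ?_⟩⟩
  intro K T _ hT ν hν
  have hK0 : (0 : ℝ) < K := by exact_mod_cast Nat.pos_of_neZero K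
  have hT0 : (0 : ℝ) < T := by exact_mod_cast (by omega : 0 < T)
  have hV0 := SwitchingBandit.totalVariation_nonneg (SwitchingBandit.meanReward ν) T
  have hlg := SwitchingBandit.two_thirds_le_log hT
  set lg := Real.log T
  have hs : 0 ≤ √C₀ := Real.sqrt_nonneg _
  have hlg2 : 0 ≤ lg ^ 2 := by positivity
  have hlg3 : lg ^ 2 ≤ 3 / 2 * lg ^ 3 := by nlinarith
  have hlg3' : (1 : ℝ) ≤ 27 / 8 * lg ^ 3 := by
    have := pow_le_pow_left₀ (by norm_num) hlg 3
    linarith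
  have hconst : 15 + 840 * (√C₀ + 14) * lg ^ 2 ≤ (60 + 1260 * (√C₀ + 14)) * lg ^ 3 := by
    have := mul_le_mul_of_nonneg_left hlg3 (by positivity : 0 ≤ 840 * (√C₀ + 14))
    linarith
  have hone : 1 ≤ (60 + 1260 * (√C₀ + 14)) * lg ^ 3 := by
    have : 0 ≤ 840 * (√C₀ + 14) * lg ^ 2 := by positivity
    linarith
  set z := ((K : ℝ) * SwitchingBandit.totalVariation (SwitchingBandit.meanReward ν) T)
    ^ ((1 : ℝ) / 3) * (T : ℝ) ^ ((2 : ℝ) / 3) with hz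
  have hz0 : 0 ≤ z := by positivity
  rcases le_or_gt K T with hKT | hKT
  · obtain ⟨x, hx1, hxV, hx⟩ := SwitchingBandit.exists_phase_number hK0 hT0 hV0
    refine (SwitchingBandit.dynamicRegret_le_sqrt hν hT hKT hC hx1 hxV).trans ?_
    exact mul_le_mul hconst hx (Real.sqrt_nonneg _) (by linarith)
  · -- With more arms than rounds the trivial bound `T ≤ √(K T)` suffices.
    refine (SwitchingBandit.dynamicRegret_le_horizon hν C₀ T).trans ?_
    have h1 : (T : ℝ) ≤ √((K : ℝ) * T) := by
      apply Real.le_sqrt_of_sq_le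
      have : (T : ℝ) ≤ K := by exact_mod_cast hKT.le
      nlinarith
    have h2 : (T : ℝ) ≤ √((K : ℝ) * T) + z := by linarith
    exact h2.trans (le_mul_of_one_le_left (by positivity) hone)
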